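/- Let $X=(X_t)_{t\ge 0}$ be a real-valued Lévy process with respect to a right-continuous, complete filtration $(\mathcal F_t)_{t\ge0}$; write $\mathbb P_x$, $\mathbb E_x$ for the law and expectation when $X$ starts in $x\in\mathbb R$, and assume $0<\mathbb E_0[X_1]<\infty$. For $y\in\mathbb R$ let $\tau_y:=\inf\{t\ge 0: X_t\ge y\}$. Let $\gamma:\mathbb R\to\mathbb R$ be nondecreasing and differentiable, and let $h:\mathbb R\to[0,\infty)$ be continuous with $\mathbb E_x\big[\int_0^{\tau_y}h(X_s)\,ds\big]<\infty$ for all $x<y$. Let $\mathcal T$ be the set of all stopping times $\tau$ with $\mathbb E_x[\tau]<\infty$ and $\mathbb E_x\big[\int_0^\tau h(X_s)\,ds\big]<\infty$ for all $x\in\mathbb R$, and for $x\in\mathbb R$ let $\mathcal T_x:=\{\tau\in\mathcal T: X_\tau\ge x\ \ \mathbb P_x\text{-a.s.}\}$. For $\rho\in\mathbb R$ put $$g_\rho(x):=g^{\mathcal T_x}_\rho(x):=\sup_{\tau\in\mathcal T_x}\mathbb E_x\Big[\gamma(X_\tau)-\int_0^\tau\big(h(X_s)+\rho\big)\,ds\Big].$$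 Assume that there is a function $f:\mathbb R\to\mathbb R$ such that (i) for all $x\le y$, the following expectations exist and are finite and $$\gamma(x)=\mathbb E_x\Big[\int_0^{\tau_y}f\big(\sup_{r\le t}X_r\big)\,dt\Big]+\mathbb E_x\Big[\gamma(X_{\tau_y})-\int_0^{\tau_y}h(X_s)\,ds\Big];$$ (ii) for some $a\in\mathbb R$, $f$ is strictly decreasing on $(-\infty,a]$ and strictly increasing on $[a,\infty)$. Let $\rho\in\mathbb R$ be such that $f+\rho$ has exactly two roots $\underline x<\overline x$ and is negative on $(\underline x,\overline x)$. Then: 1. For every $x\ge\underline x$, the threshold time $\tau_{\overline x}$ belongs to $\mathcal T_x$ and is optimal for $g_\rho(x)$, i.e. $$g_\rho(x)=\mathbb E_x\Big[\gamma(X_{\tau_{\overline x}})-\int_0^{\tau_{\overline x}}\big(h(X_s)+\rho\big)\,ds\Big].$$ 2. For every $x<\underline x$ there is $x^*\in[\underline x,\overline x]$ with $g_\rho(x)\le g_\rho(x^*)$. -/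

import Mathlib

open MeasureTheory ProbabilityTheory Set Filter Topology
open scoped NNReal ENNReal

noncomputable section

namespace LevyStopping

variable {Ω : Type*} [mΩ : MeasurableSpace Ω]

/-- `X`, adapted to the filtration `𝓕`, is a real Lévy process under the family `(P x)` of
probability measures, where `P x` is the law under which `X` starts in `x`: a.s. càdlàg paths,
increments independent of the past `𝓕 s` and, under every `P x`, with the law that the increment
over a time interval of the same length has under `P 0`. The filtration is right continuous and
`𝓕 0` contains every set that is null under all `P x`; moreover `0 < 𝔼₀ X₁ < ∞`. -/
structure IsLevyFamily (𝓕 : Filtration ℝ≥0 mΩ) (P : ℝ → Measure Ω) (X : ℝ≥0 → Ω → ℝ) : Prop where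
  isProbabilityMeasure : ∀ x, IsProbabilityMeasure (P x)
  rightContinuous : 𝓕.IsRightContinuous
  complete : ∀ N : Set Ω, (∀ x, P x N = 0) → MeasurableSet[𝓕 0] N
  adapted : Adapted 𝓕 X
  start : ∀ x, ∀ᵐ ω ∂P x, X 0 ω = x
  cadlag : ∀ x, ∀ᵐ ω ∂P x, ∀ t : ℝ≥0,
    ContinuousWithinAt (fun s => X s ω) (Ici t) t ∧
      ∃ l : ℝ, Tendsto (fun s => X s ω) (𝓝[<] t) (𝓝 l)
  indepIncrements : ∀ x, ∀ s t : ℝ≥0,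
    Indep (MeasurableSpace.comap (fun ω => X (s + t) ω - X s ω) inferInstance) (𝓕 s) (P x)
  stationaryIncrements : ∀ x, ∀ s t : ℝ≥0,
    (P x).map (fun ω => X (s + t) ω - X s ω) = (P 0).map (fun ω => X t ω - X 0 ω)
  integrable_one : Integrable (X 1) (P 0)
  mean_pos : 0 < ∫ ω, X 1 ω ∂P 0

/-- The threshold time `τ_y = inf {t ≥ 0 | X_t ≥ y}` (which is `∞` if there is no such `t`). -/
def thresholdTime (X : ℝ≥0 → Ω → ℝ) (y : ℝ) : Ω → WithTop ℝ≥0 :=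
  hittingAfter X (Ici y) 0

/-- The running supremum `sup_{r ≤ t} X_r`. -/
def runningSup (X : ℝ≥0 → Ω → ℝ) (t : ℝ≥0) (ω : Ω) : ℝ :=
  sSup ((fun r => X r ω) '' Iic t)

/-- The pathwise time integral `∫_0^τ φ(Y_s) ds`. -/
def timeIntegral (φ : ℝ → ℝ) (Y : ℝ≥0 → Ω → ℝ) (τ : Ω → WithTop ℝ≥0) (ω : Ω) : ℝ :=
  ∫ s in {s : ℝ | 0 ≤ s ∧ (s.toNNReal : WithTop ℝ≥0) < τ ω}, φ (Y s.toNNReal ω)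

/-- A time in `[0, ∞]`, given as an element of `WithTop ℝ≥0`, as an element of `ℝ≥0∞`. -/
def timeToENNReal (t : WithTop ℝ≥0) : ℝ≥0∞ :=
  WithTop.recTopCoe (C := fun _ => ℝ≥0∞) ⊤ (fun r : ℝ≥0 => (r : ℝ≥0∞)) t

/-- The expectation `𝔼[τ] ∈ [0, ∞]` of a random time. -/
def expectedTime (μ : Measure Ω) (τ : Ω → WithTop ℝ≥0) : ℝ≥0∞ :=
  ∫⁻ ω, timeToENNReal (τ ω) ∂μ

/-- The expectation `𝔼[∫_0^τ φ(Y_s) ds] ∈ [0, ∞]`, for nonnegative `φ`. -/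
def expectedCost (μ : Measure Ω) (φ : ℝ → ℝ) (Y : ℝ≥0 → Ω → ℝ) (τ : Ω → WithTop ℝ≥0) : ℝ≥0∞ :=
  ∫⁻ ω, (∫⁻ s in {s : ℝ | 0 ≤ s ∧ (s.toNNReal : WithTop ℝ≥0) < τ ω},
    ENNReal.ofReal (φ (Y s.toNNReal ω))) ∂μ

/-- The extended expectation `𝔼[Z⁺] - 𝔼[Z⁻] ∈ [-∞, ∞]`. It is a real number exactly if `𝔼[Z⁺]` and
`𝔼[Z⁻]` are both finite (in `EReal`, `⊤ - ⊤ = ⊥`). -/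
def extExp (μ : Measure Ω) (Z : Ω → ℝ) : EReal :=
  ((∫⁻ ω, ENNReal.ofReal (Z ω) ∂μ : ℝ≥0∞) : EReal) -
    ((∫⁻ ω, ENNReal.ofReal (-Z ω) ∂μ : ℝ≥0∞) : EReal)

/-- The standing assumptions on the payoff function `γ` and the running cost `h`. -/
structure PayoffCostAssumption (P : ℝ → Measure Ω) (X : ℝ≥0 → Ω → ℝ) (γ h : ℝ → ℝ) : Prop where
  monotone : Monotone γ
  differentiable : Differentiable ℝ γ
  nonneg : ∀ x, 0 ≤ h x
  continuous : Continuous h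
  cost_lt_top : ∀ x y : ℝ, x < y → expectedCost (P x) h X (thresholdTime X y) < ⊤

/-- The maximum representation of `γ` (with respect to `h`) by `f`: for all `x ≤ y`,
`γ(x) = 𝔼ₓ[∫_0^{τ_y} f(sup_{r ≤ t} X_r) dt] + 𝔼ₓ[γ(X_{τ_y}) - ∫_0^{τ_y} h(X_s) ds]`.
As the left-hand side is real, both expectations are required to be finite. -/
def MaxRepresentation (P : ℝ → Measure Ω) (X : ℝ≥0 → Ω → ℝ) (γ h f : ℝ → ℝ) : Prop :=
  ∀ x y : ℝ, x ≤ y →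
    (γ x : EReal) = extExp (P x) (timeIntegral f (runningSup X) (thresholdTime X y)) +
      extExp (P x) (fun ω => γ (stoppedValue X (thresholdTime X y) ω) -
        timeIntegral h X (thresholdTime X y) ω)

/-- `f` is strictly decreasing on `(-∞, a]` and strictly increasing on `[a, ∞)` for some `a`
(so that `a` is its unique minimum). -/
def IsUnimodal (f : ℝ → ℝ) : Prop :=
  ∃ a : ℝ, StrictAntiOn f (Iic a) ∧ StrictMonoOn f (Ici a)

/-- The class `𝒯` of the stopping times `τ` with `𝔼ₓ[τ] < ∞` and `𝔼ₓ[∫_0^τ h(X_s) ds] < ∞` for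
all `x`. -/
def stoppingTimes (𝓕 : Filtration ℝ≥0 mΩ) (P : ℝ → Measure Ω) (X : ℝ≥0 → Ω → ℝ) (h : ℝ → ℝ) :
    Set (Ω → WithTop ℝ≥0) :=
  {τ | IsStoppingTime 𝓕 τ ∧ ∀ x, expectedTime (P x) τ < ⊤ ∧ expectedCost (P x) h X τ < ⊤}

/-- The class `𝒯_y` of those `τ ∈ 𝒯` with `X_τ ≥ y` a.s. under `P y`. -/
def stoppingTimesFrom (𝓕 : Filtration ℝ≥0 mΩ) (P : ℝ → Measure Ω) (X : ℝ≥0 → Ω → ℝ)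
    (h : ℝ → ℝ) (y : ℝ) : Set (Ω → WithTop ℝ≥0) :=
  {τ | τ ∈ stoppingTimes 𝓕 P X h ∧ ∀ᵐ ω ∂P y, y ≤ stoppedValue X τ ω}

/-- The expected gain `𝔼ₓ[γ(X_τ) - ∫_0^τ (h(X_s) + ρ) ds]`. -/
def expectedGain (P : ℝ → Measure Ω) (X : ℝ≥0 → Ω → ℝ) (γ h : ℝ → ℝ) (ρ x : ℝ)
    (τ : Ω → WithTop ℝ≥0) : EReal :=
  extExp (P x) (fun ω => γ (stoppedValue X τ ω) - timeIntegral (fun z => h z + ρ) X τ ω)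

/-- The value `g_ρ^{𝒯_y}(x)`, the supremum over `τ ∈ 𝒯_y` of the expected gain under `P x`. -/
def stoppingValue (𝓕 : Filtration ℝ≥0 mΩ) (P : ℝ → Measure Ω) (X : ℝ≥0 → Ω → ℝ)
    (γ h : ℝ → ℝ) (ρ y x : ℝ) : EReal :=
  ⨆ τ ∈ stoppingTimesFrom 𝓕 P X h y, expectedGain P X γ h ρ x τ

end LevyStopping

end

noncomputable section

namespace LevyStopping

/-! Write M for the running supremum. The maximum representation turns the gain of stopping into an
integral of f + ρ along M, and the sign pattern of f + ρ decides everything. By unimodality f + ρ =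
p + q - r, where p ≥ 0 is nonincreasing and lives left of `xlo`, q ≥ 0 is nondecreasing and lives
right of `xhi`, and r = (f + ρ)⁻ is bounded and lives between the roots
(`exists_gainDecomposition`). Put R(x) = 𝔼ₓ ∫_0^∞ r(M_t) dt; this is finite because r(M_t) vanishes
after τ_{xhi}, which has finite mean.

Upper bound: every admissible τ has expected gain at most γ(x) + R(x). For a stopping time κ ≤ τ_y
with y ≥ `xhi`, take the representation up to τ_y once from x and once from the random point X_κ,
using the strong Markov property, and compare. The terms for time, for cost and for the payoff at
τ_y match. Since X_κ ≥ x, the p-integral started in X_κ is at most the one started in x. The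
supremum restarted at κ is at most M, so the q-integral does not increase either. The r-term at X_κ
is nonnegative and is dropped. This is `gain_le_of_le_thresholdTime`; `lintegral_gain_le` removes κ
≤ τ_y by localizing with τ ∧ τ_{y_n} and Fatou's lemma.

Equality: for x ≥ `xlo` and stopping at τ_{xhi} the supremum only visits [xlo, xhi] before stopping,
so p and q contribute nothing and the gain is exactly γ(x) + R(x) (`lintegral_gain_thresholdTime`).
This is the first claim.

For x < `xlo`, r(M) vanishes before τ_{xlo}, so R(x) is the mean of R(X_{τ_{xlo}}) and hence R(x) ≤
R(z) for some z ≥ `xlo` (`exists_lintegral_supIntegral_le`). If z > `xhi` then R(z) = 0 and `xlo`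
serves instead. Monotonicity of γ gives the second claim.

Most of the length is the underlying theory of Lévy processes: the strong Markov property on a space
of right-continuous paths (`strongMarkov`), finite means of threshold times by a Wald argument
(`thresholdTime_finite_mean`), and quasi-left-continuity (`ae_announcedTime_eq`), which makes closed
half-line hitting times a.s. equal to a measurable functional of the path. Estimates are done in
`ℝ≥0∞`, with ρ split into ρ⁺ and ρ⁻ on opposite sides, so that no integrability question arises
before the end. -/

@[simp]
lemma timeToENNReal_coe (u : ℝ≥0) : timeToENNReal (u : WithTop ℝ≥0) = u := rfl

@[simp]
lemma timeToENNReal_top : timeToENNReal ⊤ = ⊤ := rfl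

/-! ### Integrals over random time intervals -/

/-- The time interval `[0, U)` as a set of real numbers. -/
def timeSet (U : WithTop ℝ≥0) : Set ℝ := {s : ℝ | 0 ≤ s ∧ (s.toNNReal : WithTop ℝ≥0) < U}

/-- The integral `∫_0^U g(t) dt` of a nonnegative function of time. -/
def timeLIntegral (U : WithTop ℝ≥0) (g : ℝ≥0 → ℝ≥0∞) : ℝ≥0∞ := ∫⁻ s in timeSet U, g s.toNNReal

lemma measurableSet_timeSet_prod {α : Type*} [MeasurableSpace α] {U : α → WithTop ℝ≥0}
    (hU : Measurable U) : MeasurableSet {p : α × ℝ | p.2 ∈ timeSet (U p.1)} := by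
  have h1 : MeasurableSet {p : α × ℝ | 0 ≤ p.2} := measurableSet_le measurable_const measurable_snd
  have h2 : MeasurableSet {p : α × ℝ | (p.2.toNNReal : WithTop ℝ≥0) < U p.1} :=
    measurableSet_lt (measurable_snd.real_toNNReal.withTop_coe) (hU.comp measurable_fst)
  exact h1.inter h2

lemma measurableSet_timeSet (U : WithTop ℝ≥0) : MeasurableSet (timeSet U) := by
  have := measurableSet_timeSet_prod (α := Unit) (U := fun _ => U) measurable_const
  exact this.preimage (measurable_const.prodMk measurable_id : Measurable fun s : ℝ => ((), s))

lemma measurable_timeLIntegral {α : Type*} [MeasurableSpace α] {U : α → WithTop ℝ≥0}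
    (hU : Measurable U) {g : α → ℝ≥0 → ℝ≥0∞} (hg : Measurable fun p : α × ℝ≥0 => g p.1 p.2) :
    Measurable fun a => timeLIntegral (U a) (g a) := by
  have h : ∀ a, timeLIntegral (U a) (g a) =
      ∫⁻ s, ({p : α × ℝ | p.2 ∈ timeSet (U p.1)}.indicator
        (fun p => g p.1 p.2.toNNReal)) (a, s) := by
    intro a
    rw [timeLIntegral, ← lintegral_indicator (measurableSet_timeSet _)]
    rfl
  simp_rw [h]
  refine Measurable.lintegral_prod_right' (f := ({p : α × ℝ | p.2 ∈ timeSet (U p.1)}.indicator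
        (fun p => g p.1 p.2.toNNReal))) (Measurable.indicator ?_ (measurableSet_timeSet_prod hU))
  exact hg.comp (measurable_fst.prodMk measurable_snd.real_toNNReal)

lemma timeSet_mono {U V : WithTop ℝ≥0} (h : U ≤ V) : timeSet U ⊆ timeSet V :=
  fun _ hs => ⟨hs.1, hs.2.trans_le h⟩

lemma timeSet_coe (κ : ℝ≥0) : timeSet κ = Ico 0 (κ : ℝ) := by
  ext s
  simp only [timeSet, mem_ofPred_eq, mem_Ico, WithTop.coe_lt_coe]
  refine and_congr_right fun hs => ?_
  rw [← NNReal.coe_lt_coe, Real.coe_toNNReal _ hs]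

lemma timeSet_top : timeSet ⊤ = Ici 0 := by
  ext s
  exact ⟨fun h => h.1, fun h => ⟨h, WithTop.coe_lt_top _⟩⟩

lemma timeLIntegral_mono {U V : WithTop ℝ≥0} (hUV : U ≤ V) {f g : ℝ≥0 → ℝ≥0∞}
    (hfg : ∀ t : ℝ≥0, (t : WithTop ℝ≥0) < U → f t ≤ g t) :
    timeLIntegral U f ≤ timeLIntegral V g := by
  refine le_trans (setLIntegral_mono' (measurableSet_timeSet U) fun s hs => hfg _ hs.2) ?_
  exact lintegral_mono_set (timeSet_mono hUV)

lemma timeLIntegral_congr {U : WithTop ℝ≥0} {f g : ℝ≥0 → ℝ≥0∞}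
    (hfg : ∀ t : ℝ≥0, (t : WithTop ℝ≥0) < U → f t = g t) :
    timeLIntegral U f = timeLIntegral U g :=
  le_antisymm (timeLIntegral_mono le_rfl fun t ht => (hfg t ht).le)
    (timeLIntegral_mono le_rfl fun t ht => (hfg t ht).ge)

lemma timeLIntegral_const (U : WithTop ℝ≥0) (c : ℝ≥0∞) :
    timeLIntegral U (fun _ => c) = c * timeToENNReal U := by
  rw [timeLIntegral, setLIntegral_const]
  congr 1
  induction U with
  | top => simp [timeSet_top]
  | coe κ =>
    rw [timeSet_coe, Real.volume_Ico, sub_zero]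
    exact ENNReal.ofReal_coe_nnreal

lemma timeLIntegral_add {U : WithTop ℝ≥0} {f g : ℝ≥0 → ℝ≥0∞} (hf : Measurable f) :
    timeLIntegral U (fun t => f t + g t) = timeLIntegral U f + timeLIntegral U g :=
  lintegral_add_left (hf.comp measurable_real_toNNReal) _

lemma timeLIntegral_zero_fun (U : WithTop ℝ≥0) : timeLIntegral U (fun _ => 0) = 0 := by
  simp [timeLIntegral]

lemma timeLIntegral_zero (f : ℝ≥0 → ℝ≥0∞) : timeLIntegral 0 f = 0 := by
  have : timeSet 0 = ∅ := by
    have := timeSet_coe 0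
    simpa using this
  simp [timeLIntegral, this]

/-- Split [0, κ + V) at κ and use translation invariance of Lebesgue measure. All comparisons of a
path with its shift by κ go through this identity. -/
lemma timeLIntegral_coe_add (κ : ℝ≥0) (V : WithTop ℝ≥0) (f : ℝ≥0 → ℝ≥0∞) :
    timeLIntegral (κ + V) f = timeLIntegral κ f + timeLIntegral V (fun t => f (κ + t)) := by
  have hu : timeSet (κ + V) = timeSet κ ∪ (fun s : ℝ => -(κ : ℝ) + s) ⁻¹' timeSet V := by
    ext s
    rw [mem_union, mem_preimage, timeSet_coe]
    simp only [timeSet, mem_ofPred_eq, mem_Ico]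
    rcases lt_or_ge s κ with h | h
    · have h1 : ¬ (0 ≤ -(κ : ℝ) + s) := by linarith
      simp only [h, h1, and_true, false_and, or_false, and_iff_left_iff_imp]
      intro hs
      refine lt_of_lt_of_le (b := (κ : WithTop ℝ≥0)) ?_ le_self_add
      rw [WithTop.coe_lt_coe, ← NNReal.coe_lt_coe, Real.coe_toNNReal _ hs]
      exact h
    · have h1 : (0 ≤ -(κ : ℝ) + s) := by linarith
      have h0 : 0 ≤ s := κ.coe_nonneg.trans h
      have h2 : s.toNNReal = κ + (-(κ : ℝ) + s).toNNReal := by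
        rw [← NNReal.coe_inj, NNReal.coe_add, Real.coe_toNNReal _ h0, Real.coe_toNNReal _ h1]
        ring
      simp only [h1, h0, h.not_gt, true_and, and_false, false_or]
      rw [h2, WithTop.coe_add]
      induction V with
      | top => exact iff_of_true (by rw [add_top]; exact WithTop.coe_lt_top _) (WithTop.coe_lt_top _)
      | coe v => norm_cast; simp
  have hd : Disjoint (timeSet κ) ((fun s : ℝ => -(κ : ℝ) + s) ⁻¹' timeSet V) := by
    rw [Set.disjoint_left]
    intro s hs hs'
    rw [timeSet_coe] at hs
    have := hs'.1
    have := hs.2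
    linarith
  have hm : MeasurableSet ((fun s : ℝ => -(κ : ℝ) + s) ⁻¹' timeSet V) :=
    (measurableSet_timeSet V).preimage (measurable_const_add _)
  rw [timeLIntegral, hu, lintegral_union hm hd]
  congr 1
  rw [timeLIntegral, ← lintegral_indicator hm, ← lintegral_indicator (measurableSet_timeSet V),
    ← lintegral_add_left_eq_self (fun s => indicator _ (fun s => f s.toNNReal) s) (κ : ℝ)]
  refine lintegral_congr fun s => ?_
  have e : ((κ : ℝ) + s ∈ (fun s : ℝ => -(κ : ℝ) + s) ⁻¹' timeSet V) ↔ s ∈ timeSet V := by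
    rw [mem_preimage, neg_add_cancel_left]
  by_cases hs : s ∈ timeSet V
  · rw [indicator_of_mem (e.2 hs), indicator_of_mem hs]
    congr 1
    rw [← NNReal.coe_inj, NNReal.coe_add, Real.coe_toNNReal _ hs.1,
      Real.coe_toNNReal _ (add_nonneg κ.coe_nonneg hs.1)]
  · rw [indicator_of_notMem (mt e.1 hs), indicator_of_notMem hs]

lemma timeToENNReal_coe_add (κ : ℝ≥0) (V : WithTop ℝ≥0) :
    timeToENNReal (κ + V) = κ + timeToENNReal V := by
  induction V with
  | top => rw [add_top, timeToENNReal_top, add_top]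
  | coe v => norm_cast

lemma measurable_timeToENNReal : Measurable timeToENNReal := by
  refine WithTop.measurable_of_measurable_comp_coe ?_
  exact measurable_coe_nnreal_ennreal

lemma timeToENNReal_mono : Monotone timeToENNReal := by
  intro U V h
  induction V with
  | top => exact le_top
  | coe v =>
    induction U with
    | top => exact (WithTop.not_top_le_coe v h).elim
    | coe u => exact ENNReal.coe_le_coe.2 (WithTop.coe_le_coe.1 h)

lemma timeToENNReal_eq_top {U : WithTop ℝ≥0} : timeToENNReal U = ⊤ ↔ U = ⊤ := by
  induction U with
  | top => simp
  | coe u => exact iff_of_false ENNReal.coe_ne_top (WithTop.coe_ne_top)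

/-! ### The space of regular paths -/

/-- Right-continuous paths that are bounded above on compact time intervals. -/
def IsRegularPath (w : ℝ≥0 → ℝ) : Prop :=
  (∀ t, ContinuousWithinAt w (Ici t) t) ∧ ∀ t, BddAbove (w '' Iic t)

/-- The space of regular paths, with the σ-algebra generated by the coordinates. -/
abbrev RegularPath : Type := {w : ℝ≥0 → ℝ // IsRegularPath w}

/-- The coordinate process. -/
def coord (t : ℝ≥0) (w : RegularPath) : ℝ := w.1 t

lemma measurable_coord (t : ℝ≥0) : Measurable (coord t) :=
  (measurable_pi_apply t).comp measurable_subtype_coe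

/-- The smallest multiple of `1 / (k + 1)` that is larger than `t`. -/
def approxTime (k : ℕ) (t : ℝ≥0) : ℝ≥0 := (⌊(k + 1) * t⌋₊ + 1) / (k + 1)

lemma lt_approxTime (k : ℕ) (t : ℝ≥0) : t < approxTime k t := by
  rw [approxTime, lt_div_iff₀ (by positivity), mul_comm]
  exact Nat.lt_floor_add_one _

lemma approxTime_le (k : ℕ) (t : ℝ≥0) : approxTime k t ≤ t + 1 / (k + 1) := by
  have h : (0 : ℝ≥0) < k + 1 := by positivity
  rw [approxTime, div_le_iff₀ h, add_mul t, div_mul_cancel₀ _ h.ne', mul_comm t]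
  gcongr
  exact Nat.floor_le (zero_le)

lemma tendsto_approxTime (t : ℝ≥0) :
    Tendsto (fun k => approxTime k t) atTop (𝓝[≥] t) := by
  refine tendsto_nhdsWithin_iff.2 ⟨?_, Eventually.of_forall fun k => (lt_approxTime k t).le⟩
  refine tendsto_of_tendsto_of_tendsto_of_le_of_le tendsto_const_nhds ?_
    (fun k => (lt_approxTime k t).le) (fun k => approxTime_le k t)
  have : Tendsto (fun k : ℕ => (1 : ℝ≥0) / (k + 1)) atTop (𝓝 0) :=
    tendsto_one_div_add_atTop_nhds_zero_nat
  simpa using this.const_add t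

lemma tendsto_of_rightContinuous {w : ℝ≥0 → ℝ} {t : ℝ≥0} (h : ContinuousWithinAt w (Ici t) t) :
    Tendsto (fun k => w (approxTime k t)) atTop (𝓝 (w t)) :=
  h.tendsto.comp (tendsto_approxTime t)

/-- The evaluation `(w, t) ↦ w t` is jointly measurable on regular paths. -/
lemma measurable_eval : Measurable fun p : RegularPath × ℝ≥0 => p.1.1 p.2 := by
  refine measurable_of_tendsto_metrizable (f := fun k (p : RegularPath × ℝ≥0) =>
    p.1.1 (approxTime k p.2)) (fun k => ?_) ?_
  -- The approximating times take countably many values, so the approximation is a coordinate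
  -- selected by a measurable integer.
  · have h1 : Measurable fun q : RegularPath × ℕ => q.1.1 ((q.2 + 1) / (k + 1) : ℝ≥0) :=
      measurable_from_prod_countable_left fun n => measurable_coord ((n + 1) / (k + 1) : ℝ≥0)
    have h2 : Measurable fun p : RegularPath × ℝ≥0 => (p.1, ⌊(k + 1) * p.2⌋₊) :=
      measurable_fst.prodMk (Nat.measurable_floor.comp (measurable_snd.const_mul _))
    exact h1.comp h2
  · rw [tendsto_pi_nhds]
    exact fun p => tendsto_of_rightContinuous (p.1.2.1 p.2)

/-- The path of a process all of whose paths are regular. -/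
def pathMap {Ω : Type*} (X : ℝ≥0 → Ω → ℝ) (hreg : ∀ ω, IsRegularPath fun t => X t ω) (ω : Ω) :
    RegularPath := ⟨fun t => X t ω, hreg ω⟩

lemma measurable_pathMap {Ω : Type*} [MeasurableSpace Ω] {X : ℝ≥0 → Ω → ℝ}
    (hX : ∀ t, Measurable (X t)) (hreg : ∀ ω, IsRegularPath fun t => X t ω) :
    Measurable (pathMap X hreg) :=
  Measurable.subtype_mk (measurable_pi_lambda _ hX)

lemma IsRegularPath.shift {w : ℝ≥0 → ℝ} (hw : IsRegularPath w) (κ : ℝ≥0) :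
    IsRegularPath fun t => w (κ + t) := by
  refine ⟨fun t => ?_, fun t => ?_⟩
  · refine ContinuousWithinAt.comp (t := Ici (κ + t)) (hw.1 _)
      (continuous_const_add κ).continuousWithinAt fun s hs => ?_
    exact add_le_add (le_refl κ) (mem_Ici.1 hs)
  · refine (hw.2 (κ + t)).mono ?_
    rintro _ ⟨r, hr, rfl⟩
    exact ⟨κ + r, add_le_add (le_refl κ) (mem_Iic.1 hr), rfl⟩

lemma IsRegularPath.const_add {w : ℝ≥0 → ℝ} (hw : IsRegularPath w) (z : ℝ) :
    IsRegularPath fun t => z + w t := by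
  refine ⟨fun t => continuousWithinAt_const.add (hw.1 t), fun t => ?_⟩
  obtain ⟨B, hB⟩ := hw.2 t
  refine ⟨z + B, ?_⟩
  rintro _ ⟨r, hr, rfl⟩
  have := hB ⟨r, hr, rfl⟩
  simpa using this

/-- The path seen from time `κ` on. -/
def shiftPath (κ : ℝ≥0) (w : RegularPath) : RegularPath := ⟨fun t => w.1 (κ + t), w.2.shift κ⟩

/-- The path translated in space by `z`. -/
def translatePath (z : ℝ) (w : RegularPath) : RegularPath := ⟨fun t => z + w.1 t, w.2.const_add z⟩

lemma measurable_translatePath :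
    Measurable fun p : ℝ × RegularPath => translatePath p.1 p.2 :=
  Measurable.subtype_mk (measurable_pi_lambda _ fun t =>
    measurable_fst.add ((measurable_coord t).comp measurable_snd))

lemma measurable_shiftPath : Measurable fun p : ℝ≥0 × RegularPath => shiftPath p.1 p.2 :=
  Measurable.subtype_mk (measurable_pi_lambda _ fun t =>
    measurable_eval.comp (measurable_snd.prodMk (measurable_fst.add_const t)))

/-! ### The running supremum -/

lemma le_runningSup (w : RegularPath) {r t : ℝ≥0} (h : r ≤ t) : w.1 r ≤ runningSup coord t w :=
  le_csSup (w.2.2 t) ⟨r, h, rfl⟩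

lemma runningSup_le {w : RegularPath} {t : ℝ≥0} {c : ℝ} (h : ∀ r ≤ t, w.1 r ≤ c) :
    runningSup coord t w ≤ c :=
  csSup_le ⟨_, 0, mem_Iic.2 zero_le, rfl⟩ (by rintro _ ⟨r, hr, rfl⟩; exact h r hr)

/-- Right continuity lets countably many times decide the bound, except at the endpoint t, which
cannot be approached from the right inside [0, t]. The times t · min(1, q⁺) are dense in [0, t] and
contain t itself through q = 1. -/
lemma runningSup_le_iff {w : RegularPath} {t : ℝ≥0} {c : ℝ} :
    runningSup coord t w ≤ c ↔ ∀ q : ℚ, w.1 (t * min 1 (q : ℝ).toNNReal) ≤ c := by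
  constructor
  · intro h q
    refine (le_runningSup w ?_).trans h
    exact mul_le_of_le_one_right (zero_le) (min_le_left _ _)
  · intro h
    refine runningSup_le fun r hr => ?_
    rcases hr.eq_or_lt with rfl | hr
    · simpa using h 1
    have ht : 0 < t := (zero_le).trans_lt hr
    by_contra! hc
    have hev := (w.2.1 r).eventually (lt_mem_nhds hc)
    obtain ⟨u, hu, hsub⟩ := (mem_nhdsGE_iff_exists_Ico_subset' hr).1 hev
    have hlt : (r : ℝ) / t < min ((u : ℝ) / t) 1 := by
      refine lt_min ?_ ?_
      · have : (r : ℝ) < u := hu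
        exact div_lt_div_of_pos_right this (by exact_mod_cast ht)
      · rw [div_lt_one (by exact_mod_cast ht)]
        exact_mod_cast hr
    obtain ⟨q, hq1, hq2⟩ := exists_rat_btwn hlt
    have hq0 : (0 : ℝ) ≤ q := le_trans (by positivity) hq1.le
    have hq3 : (q : ℝ) < 1 := hq2.trans_le (min_le_right _ _)
    have hmin : ((min 1 (q : ℝ).toNNReal : ℝ≥0) : ℝ) = q := by
      rw [NNReal.coe_min, Real.coe_toNNReal _ hq0, NNReal.coe_one, min_eq_right hq3.le]
    have ht' : (0 : ℝ) < t := by exact_mod_cast ht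
    refine absurd (h q) (not_le.2 (hsub ⟨?_, ?_⟩))
    · rw [← NNReal.coe_le_coe, NNReal.coe_mul, hmin, mul_comm]
      exact (div_le_iff₀ ht').1 hq1.le
    · rw [← NNReal.coe_lt_coe, NNReal.coe_mul, hmin, mul_comm]
      exact (lt_div_iff₀ ht').1 (hq2.trans_le (min_le_left _ _))

lemma measurable_runningSup :
    Measurable fun p : RegularPath × ℝ≥0 => runningSup coord p.2 p.1 := by
  refine measurable_of_Iic fun c => ?_
  have : (fun p : RegularPath × ℝ≥0 => runningSup coord p.2 p.1) ⁻¹' Iic c =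
      ⋂ q : ℚ, {p | p.1.1 (p.2 * min 1 (q : ℝ).toNNReal) ≤ c} := by
    ext p
    simp [runningSup_le_iff]
  rw [this]
  refine MeasurableSet.iInter fun q => measurableSet_le ?_ measurable_const
  exact measurable_eval.comp (measurable_fst.prodMk (measurable_snd.mul_const _))

lemma runningSup_shiftPath_le (κ t : ℝ≥0) (w : RegularPath) :
    runningSup coord t (shiftPath κ w) ≤ runningSup coord (κ + t) w :=
  runningSup_le fun _ hr => le_runningSup w (add_le_add le_rfl hr)

lemma runningSup_translatePath (z : ℝ) (t : ℝ≥0) (w : RegularPath) :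
    runningSup coord t (translatePath z w) = z + runningSup coord t w := by
  refine le_antisymm (runningSup_le fun r hr => add_le_add le_rfl (le_runningSup w hr)) ?_
  rw [← le_sub_iff_add_le']
  refine runningSup_le fun r hr => ?_
  rw [le_sub_iff_add_le']
  exact le_runningSup (translatePath z w) hr

/-! ### Hitting times of regular paths -/

lemma exists_mem_lt_of_hittingAfter_lt {w : RegularPath} {A : Set ℝ} {t : ℝ≥0}
    (h : hittingAfter coord A 0 w < t) : ∃ r < t, w.1 r ∈ A := by
  obtain ⟨r, hr, hrA⟩ := hittingAfter_lt_iff.1 h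
  exact ⟨r, hr.2, hrA⟩

/-- At the hitting time of `A` a right-continuous path lies in the closure of `A`. -/
lemma coord_hittingAfter_mem_closure {w : RegularPath} {A : Set ℝ} {s : ℝ≥0}
    (h : hittingAfter coord A 0 w = s) : w.1 s ∈ closure A := by
  rw [mem_closure_iff_nhds]
  intro V hV
  have hev := (w.2.1 s) hV
  obtain ⟨u, hu, hsub⟩ := (mem_nhdsGE_iff_exists_Ico_subset).1 hev
  obtain ⟨r, hr, hrA⟩ := exists_mem_lt_of_hittingAfter_lt (w := w) (A := A) (t := u)
    (by rw [h]; exact WithTop.coe_lt_coe.2 hu)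
  refine ⟨w.1 r, hsub ⟨?_, hr⟩, hrA⟩
  have := hittingAfter_le_of_mem (u := coord) (zero_le) hrA
  rw [h] at this
  exact WithTop.coe_le_coe.1 this

lemma coord_lt_of_lt_thresholdTime {w : RegularPath} {y : ℝ} {t : ℝ≥0}
    (h : (t : WithTop ℝ≥0) < thresholdTime coord y w) : w.1 t < y :=
  not_le.1 fun h' => notMem_of_lt_hittingAfter h (zero_le) h'

lemma thresholdTime_le {w : RegularPath} {y : ℝ} {t : ℝ≥0} (h : y ≤ w.1 t) :
    thresholdTime coord y w ≤ t :=
  hittingAfter_le_of_mem (zero_le) h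

lemma le_coord_thresholdTime {w : RegularPath} {y : ℝ} {s : ℝ≥0}
    (h : thresholdTime coord y w = s) : y ≤ w.1 s := by
  have := coord_hittingAfter_mem_closure h
  rwa [isClosed_Ici.closure_eq] at this

lemma runningSup_le_of_lt_thresholdTime {w : RegularPath} {y : ℝ} {t : ℝ≥0}
    (h : (t : WithTop ℝ≥0) < thresholdTime coord y w) : runningSup coord t w ≤ y :=
  runningSup_le fun _ hr =>
    (coord_lt_of_lt_thresholdTime ((WithTop.coe_le_coe.2 hr).trans_lt h)).le

lemma le_runningSup_of_thresholdTime_le {w : RegularPath} {y : ℝ} {t : ℝ≥0}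
    (h : thresholdTime coord y w ≤ t) : y ≤ runningSup coord t w := by
  cases h' : thresholdTime coord y w with
  | top => rw [h'] at h; exact (WithTop.not_top_le_coe _ h).elim
  | coe s =>
    rw [h'] at h
    exact (le_coord_thresholdTime h').trans (le_runningSup w (WithTop.coe_le_coe.1 h))

/-- Before the threshold time is reached, the remaining time is the threshold time of the shifted
path. -/
lemma thresholdTime_eq_add {w : RegularPath} {y : ℝ} {κ : ℝ≥0}
    (h : (κ : WithTop ℝ≥0) ≤ thresholdTime coord y w) :
    thresholdTime coord y w = κ + thresholdTime coord y (shiftPath κ w) := by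
  refine le_antisymm ?_ ?_
  · cases h' : thresholdTime coord y (shiftPath κ w) with
    | top => rw [add_top]; exact le_top
    | coe s => exact_mod_cast thresholdTime_le (w := w) (t := κ + s) (le_coord_thresholdTime (w := shiftPath κ w) h')
  · cases h' : thresholdTime coord y w with
    | top => exact le_top
    | coe s =>
      rw [h'] at h
      have hκ := WithTop.coe_le_coe.1 h
      have h1 : y ≤ (shiftPath κ w).1 (s - κ) := by
        show y ≤ w.1 (κ + (s - κ))
        rw [add_tsub_cancel_of_le hκ]
        exact le_coord_thresholdTime h'
      calc (κ : WithTop ℝ≥0) + thresholdTime coord y (shiftPath κ w)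
          ≤ κ + ((s - κ : ℝ≥0) : WithTop ℝ≥0) := add_le_add le_rfl (thresholdTime_le h1)
        _ = s := by rw [← WithTop.coe_add, add_tsub_cancel_of_le hκ]

section

/-! ### The Markov property -/

lemma lintegral_of_indepFun {Ω α β : Type*} [MeasurableSpace Ω] [MeasurableSpace α]
    [MeasurableSpace β] {μ : Measure Ω} [IsProbabilityMeasure μ] {Y : Ω → α} {ξ : Ω → β}
    (hY : Measurable Y) (hξ : Measurable ξ) (h : IndepFun Y ξ μ) {F : α × β → ℝ≥0∞}
    (hF : Measurable F) :
    ∫⁻ ω, F (Y ω, ξ ω) ∂μ = ∫⁻ ω, ∫⁻ u, F (Y ω, u) ∂(μ.map ξ) ∂μ := by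
  have hp := (indepFun_iff_map_prod_eq_prod_map_map hY.aemeasurable hξ.aemeasurable).1 h
  have := Measure.isProbabilityMeasure_map (μ := μ) hξ.aemeasurable
  calc ∫⁻ ω, F (Y ω, ξ ω) ∂μ = ∫⁻ p, F p ∂(μ.map fun ω => (Y ω, ξ ω)) :=
        (lintegral_map hF (hY.prodMk hξ)).symm
    _ = ∫⁻ y, ∫⁻ u, F (y, u) ∂(μ.map ξ) ∂(μ.map Y) := by
        rw [hp, lintegral_prod _ hF.aemeasurable]
    _ = _ := lintegral_map hF.lintegral_prod_right' hY

variable {Ω : Type*} [mΩ : MeasurableSpace Ω] {𝓕 : Filtration ℝ≥0 mΩ} {P : ℝ → Measure Ω}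
  {X : ℝ≥0 → Ω → ℝ}

lemma IsLevyFamily.measurable (hX : IsLevyFamily 𝓕 P X) (t : ℝ≥0) : Measurable (X t) :=
  (hX.adapted t).mono (𝓕.le t) le_rfl

lemma IsLevyFamily.measurable_of_le (hX : IsLevyFamily 𝓕 P X) {s t : ℝ≥0} (h : s ≤ t) :
    Measurable[𝓕 t] (X s) :=
  (hX.adapted s).mono (𝓕.mono h) le_rfl

lemma IsLevyFamily.lintegral_increment (hX : IsLevyFamily 𝓕 P X) {α : Type*} [MeasurableSpace α]
    (x : ℝ) (s t : ℝ≥0) {Y : Ω → α} (hY : Measurable[𝓕 s] Y) {F : α × ℝ → ℝ≥0∞}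
    (hF : Measurable F) :
    ∫⁻ ω, F (Y ω, X (s + t) ω - X s ω) ∂P x =
      ∫⁻ ω, ∫⁻ u, F (Y ω, u) ∂((P 0).map fun ω => X t ω - X 0 ω) ∂P x := by
  have := hX.isProbabilityMeasure x
  have hm : Measurable fun ω => X (s + t) ω - X s ω := (hX.measurable _).sub (hX.measurable _)
  rw [← hX.stationaryIncrements x s t]
  refine lintegral_of_indepFun (hY.mono (𝓕.le s) le_rfl) hm ?_ hF
  have hI : IndepFun (fun ω => X (s + t) ω - X s ω) Y (P x) :=
    indep_of_indep_of_le_right (hX.indepIncrements x s t) hY.comap_le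
  exact hI.symm

/-- The Markov property: given the past up to time `s + t₀`, functions of the path at later times
are averaged to a function of the present state that depends neither on `s` nor on the start. -/
theorem IsLevyFamily.exists_markov (hX : IsLevyFamily 𝓕 P X)
    (g : ℝ≥0 → BoundedContinuousFunction ℝ ℝ≥0) (I : Finset ℝ≥0) :
    ∀ t₀ : ℝ≥0, (∀ r ∈ I, t₀ ≤ r) → ∃ R : BoundedContinuousFunction ℝ ℝ≥0,
      ∀ (x z : ℝ) (s : ℝ≥0) (Z : Ω → ℝ≥0∞), Measurable[𝓕 (s + t₀)] Z →
        ∫⁻ ω, Z ω * ∏ r ∈ I, (g r (z + X (s + r) ω) : ℝ≥0∞) ∂P x =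
          ∫⁻ ω, Z ω * R (z + X (s + t₀) ω) ∂P x := by
  -- The earliest time is peeled off: the later factors are first averaged to a function R' of the
  -- state at time `a`, and then g_a · R' is averaged over the increment from t₀ to a.
  induction I using Finset.induction_on_min with
  | empty => exact fun t₀ _ => ⟨1, fun x z s Z _ => by simp⟩
  | insert a I ha ih =>
    intro t₀ ht₀
    obtain ⟨R', hR'⟩ := ih a fun r hr => (ha r hr).le
    have hta : t₀ ≤ a := ht₀ a (Finset.mem_insert_self a I)
    set ν := (P 0).map fun ω => X (a - t₀) ω - X 0 ω with hν
    have := hX.isProbabilityMeasure 0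
    have : IsProbabilityMeasure ν :=
      Measure.isProbabilityMeasure_map ((hX.measurable _).sub (hX.measurable _)).aemeasurable
    set G : BoundedContinuousFunction ℝ ℝ≥0 := g a * R' with hG
    obtain ⟨C, hC⟩ : ∃ C : ℝ, ∀ u, (G u : ℝ) ≤ C := by
      obtain ⟨C, hC⟩ := G.bounded
      refine ⟨G 0 + C, fun u => ?_⟩
      have := hC u 0
      rw [NNReal.dist_eq] at this
      linarith [le_abs_self ((G u : ℝ) - G 0)]
    have hGm : Measurable G := G.continuous.measurable
    -- Continuity of the averaged function is kept in the induction because the strong Markov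
    -- property later needs it to pass to the limit along right approximations.
    have hcont : Continuous fun z => ∫ u, (G (z + u) : ℝ) ∂ν := by
      refine continuous_of_dominated (bound := fun _ => C) (fun z => ?_) (fun z => ?_)
        (integrable_const C) ?_
      · exact ((hGm.comp (measurable_const_add z)).coe_nnreal_real).aestronglyMeasurable
      · exact Eventually.of_forall fun u => by
          rw [Real.norm_of_nonneg (NNReal.coe_nonneg _)]; exact hC _
      · exact Eventually.of_forall fun u =>
          NNReal.continuous_coe.comp (G.continuous.comp (continuous_add_const u))
    have hle : ∀ z, ∫ u, (G (z + u) : ℝ) ∂ν ≤ C := fun z => by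
      have := integral_mono_of_nonneg (μ := ν) (f := fun u => (G (z + u) : ℝ)) (g := fun _ => C)
        (Eventually.of_forall fun u => NNReal.coe_nonneg _) (integrable_const C)
        (Eventually.of_forall fun u => hC _)
      simpa using this
    have hRl : ∀ z, ((∫ u, (G (z + u) : ℝ) ∂ν).toNNReal : ℝ≥0∞) = ∫⁻ u, G (z + u) ∂ν := by
      intro z
      have hi : Integrable (fun u => (G (z + u) : ℝ)) ν :=
        Integrable.of_bound
          ((hGm.comp (measurable_const_add z)).coe_nnreal_real).aestronglyMeasurable C
          (Eventually.of_forall fun u => by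
            rw [Real.norm_of_nonneg (NNReal.coe_nonneg _)]; exact hC _)
      have := ofReal_integral_eq_lintegral_ofReal hi
        (Eventually.of_forall fun u => NNReal.coe_nonneg _)
      simpa [ENNReal.ofReal] using this
    refine ⟨BoundedContinuousFunction.mkOfBound
      ⟨fun z => (∫ u, (G (z + u) : ℝ) ∂ν).toNNReal, continuous_real_toNNReal.comp hcont⟩
      (C.toNNReal + C.toNNReal) fun z z' => ?_, ?_⟩
    · refine (NNReal.dist_eq _ _).trans_le ?_
      have h1 := Real.toNNReal_le_toNNReal (hle z)
      have h2 := Real.toNNReal_le_toNNReal (hle z')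
      rw [← NNReal.coe_le_coe] at h1 h2
      simp only [ContinuousMap.coe_mk]
      rw [abs_le]
      constructor <;>
      linarith [NNReal.coe_nonneg (∫ u, (G (z + u) : ℝ) ∂ν).toNNReal,
        NNReal.coe_nonneg (∫ u, (G (z' + u) : ℝ) ∂ν).toNNReal, NNReal.coe_nonneg C.toNNReal]
    · intro x z s Z hZ
      have hanot : a ∉ I := fun h => lt_irrefl _ (ha a h)
      have hsa : s + t₀ + (a - t₀) = s + a := by
        rw [add_assoc, add_tsub_cancel_of_le hta]
      have hZ' : Measurable[𝓕 (s + a)] fun ω => Z ω * (g a (z + X (s + a) ω) : ℝ≥0∞) := by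
        refine Measurable.mul (hZ.mono (𝓕.mono (add_le_add le_rfl hta)) le_rfl) ?_
        exact ((g a).continuous.measurable.comp
          ((hX.adapted (s + a)).const_add z)).coe_nnreal_ennreal
      have h1 := hR' x z s _ hZ'
      simp_rw [Finset.prod_insert hanot, ← mul_assoc]
      rw [h1]
      have hF : Measurable fun p : (ℝ≥0∞ × ℝ) × ℝ => p.1.1 * (G (z + p.1.2 + p.2) : ℝ≥0∞) := by
        have : Measurable fun p : (ℝ≥0∞ × ℝ) × ℝ => z + p.1.2 + p.2 := by fun_prop
        exact measurable_fst.fst.mul (hGm.comp this).coe_nnreal_ennreal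
      have h2 := hX.lintegral_increment x (s + t₀) (a - t₀) (Y := fun ω => (Z ω, X (s + t₀) ω))
        (hZ.prodMk (hX.adapted _)) hF
      rw [hsa] at h2
      refine Eq.trans (lintegral_congr fun ω => ?_) (h2.trans (lintegral_congr fun ω => ?_))
      · show _ = Z ω * (G _ : ℝ≥0∞)
        have : z + X (s + t₀) ω + (X (s + a) ω - X (s + t₀) ω) = z + X (s + a) ω := by ring
        rw [this, mul_assoc, hG]
        simp
      · have hm : Measurable fun u => (G (z + X (s + t₀) ω + u) : ℝ≥0∞) :=
          (hGm.comp (measurable_const_add _)).coe_nnreal_ennreal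
        exact (lintegral_const_mul (Z ω) hm).trans (by rw [← hν, ← hRl]; rfl)

end

section

/-! ### The strong Markov property -/

/-- The extensionality principle used concerns two finite families of coordinates; the second family
is taken to be empty, its factor being an empty product. -/
lemma Measure.ext_of_lintegral_prod_finset {I : Finset ℝ≥0} {μ ν : Measure (I → ℝ)}
    [IsFiniteMeasure μ]
    (h : ∀ g : I → BoundedContinuousFunction ℝ ℝ≥0,
      ∫⁻ w, ∏ i, (g i (w i) : ℝ≥0∞) ∂μ = ∫⁻ w, ∏ i, (g i (w i) : ℝ≥0∞) ∂ν) : μ = ν := by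
  let e : (I → ℝ) → (I → ℝ) × (Empty → ℝ) := fun w => (w, Empty.elim)
  have he : Measurable e := measurable_id.prodMk measurable_const
  have key : μ.map e = ν.map e := by
    refine Measure.ext_of_lintegral_prod_mul_prod_boundedContinuousFunction fun f g => ?_
    have hm : Measurable fun p : (I → ℝ) × (Empty → ℝ) =>
        (∏ i, (f i (p.1 i) : ℝ≥0∞)) * ∏ j, (g j (p.2 j) : ℝ≥0∞) := by
      refine Measurable.mul (Finset.measurable_prod _ fun i _ => ?_)
        (Finset.measurable_prod _ fun i _ => ?_)
      · exact ((f i).continuous.measurable.comp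
          ((measurable_pi_apply i).comp measurable_fst)).coe_nnreal_ennreal
      · exact ((g i).continuous.measurable.comp
          ((measurable_pi_apply i).comp measurable_snd)).coe_nnreal_ennreal
    simp only [ENNReal.ofNNReal_finsetProd]
    rw [lintegral_map hm he, lintegral_map hm he]
    simpa [e] using h f
  have hfst : ∀ κ : Measure (I → ℝ), (κ.map e).map Prod.fst = κ := fun κ => by
    rw [Measure.map_map measurable_fst he]
    exact Measure.map_id
  rw [← hfst μ, key, hfst]

/-- The σ-algebra on paths is the trace of the product σ-algebra, so a finite measure is fixed by
its finite-dimensional marginals, by uniqueness of projective limits. These are in turn fixed by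
products of bounded continuous functions. -/
lemma RegularPath.measure_ext {μ ν : Measure RegularPath} [IsFiniteMeasure μ] [IsFiniteMeasure ν]
    (h : ∀ (g : ℝ≥0 → BoundedContinuousFunction ℝ ℝ≥0) (I : Finset ℝ≥0),
      ∫⁻ w, ∏ r ∈ I, (g r (coord r w) : ℝ≥0∞) ∂μ = ∫⁻ w, ∏ r ∈ I, (g r (coord r w) : ℝ≥0∞) ∂ν) :
    μ = ν := by
  have hval : Measurable (Subtype.val : RegularPath → ℝ≥0 → ℝ) := measurable_subtype_coe
  have key : μ.map Subtype.val = ν.map Subtype.val := by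
    refine IsProjectiveLimit.unique (P := fun I => (μ.map Subtype.val).map I.restrict)
      (fun I => rfl) fun I => ?_
    show (ν.map Subtype.val).map I.restrict = (μ.map Subtype.val).map I.restrict
    rw [Measure.map_map (Finset.measurable_restrict I) hval,
      Measure.map_map (Finset.measurable_restrict I) hval]
    have hm := (Finset.measurable_restrict (X := fun _ : ℝ≥0 => ℝ) I).comp hval
    have := Measure.isFiniteMeasure_map ν ((I.restrict (π := fun _ => ℝ)) ∘ Subtype.val)
    refine Measure.ext_of_lintegral_prod_finset fun f => ?_
    have hf : Measurable fun w : I → ℝ => ∏ i, (f i (w i) : ℝ≥0∞) :=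
      Finset.measurable_prod _ fun i _ =>
        ((f i).continuous.measurable.comp (measurable_pi_apply i)).coe_nnreal_ennreal
    rw [lintegral_map hf hm, lintegral_map hf hm]
    have := h (fun r => if hr : r ∈ I then f ⟨r, hr⟩ else 1) I
    have e : ∀ w : RegularPath, ∏ r ∈ I,
        (((if hr : r ∈ I then f ⟨r, hr⟩ else 1 : BoundedContinuousFunction ℝ ℝ≥0)
          (coord r w) : ℝ≥0) : ℝ≥0∞) =
        ∏ i : I, (f i ((I.restrict (π := fun _ => ℝ) ∘ Subtype.val) w i) : ℝ≥0∞) := by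
      intro w
      rw [← Finset.prod_coe_sort]
      refine Finset.prod_congr rfl fun i _ => ?_
      rw [dif_pos i.2]
      rfl
    simp_rw [e] at this
    exact this.symm
  ext s hs
  obtain ⟨S, hS, rfl⟩ := hs
  rw [← Measure.map_apply hval hS, key, Measure.map_apply hval hS]

variable {Ω : Type*} [mΩ : MeasurableSpace Ω] {𝓕 : Filtration ℝ≥0 mΩ} {P : ℝ → Measure Ω}
  {X : ℝ≥0 → Ω → ℝ}

/-- Spatial homogeneity: for products of coordinate functions both sides equal R(z), with the same R
from `exists_markov`, once started in z and once started in 0 and translated by z. -/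
lemma IsLevyFamily.map_pathMap (hX : IsLevyFamily 𝓕 P X)
    (hreg : ∀ ω, IsRegularPath fun t => X t ω) (z : ℝ) :
    (P z).map (pathMap X hreg) = ((P 0).map (pathMap X hreg)).map (translatePath z) := by
  have := hX.isProbabilityMeasure
  have hp := measurable_pathMap hX.measurable hreg
  have ht : Measurable (translatePath z) :=
    measurable_translatePath.comp (measurable_const.prodMk measurable_id)
  rw [Measure.map_map ht hp]
  have := Measure.isFiniteMeasure_map (P z) (pathMap X hreg)
  have := Measure.isFiniteMeasure_map (P 0) (translatePath z ∘ pathMap X hreg)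
  refine RegularPath.measure_ext fun g I => ?_
  have hm : Measurable fun w => ∏ r ∈ I, (g r (coord r w) : ℝ≥0∞) :=
    Finset.measurable_prod _ fun i _ =>
      ((g i).continuous.measurable.comp (measurable_coord i)).coe_nnreal_ennreal
  rw [lintegral_map hm hp, lintegral_map hm (ht.comp hp)]
  obtain ⟨R, hR⟩ := hX.exists_markov g I 0 fun r _ => zero_le
  have h1 := hR z 0 0 (fun _ => 1) measurable_const
  have h2 := hR 0 z 0 (fun _ => 1) measurable_const
  simp only [one_mul, zero_add] at h1 h2
  calc _ = ∫⁻ ω, (R (X 0 ω) : ℝ≥0∞) ∂P z := h1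
    _ = R z := by
        rw [lintegral_congr_ae ((hX.start z).mono fun ω hω => by rw [hω])]
        simp
    _ = ∫⁻ ω, (R (z + X 0 ω) : ℝ≥0∞) ∂P 0 := by
        rw [lintegral_congr_ae (g := fun _ => (R z : ℝ≥0∞))
          ((hX.start 0).mono fun ω hω => by simp only [hω, add_zero])]
        simp
    _ = _ := h2.symm

lemma IsLevyFamily.lintegral_path (hX : IsLevyFamily 𝓕 P X)
    (hreg : ∀ ω, IsRegularPath fun t => X t ω) (z : ℝ) {F : RegularPath → ℝ≥0∞}
    (hF : Measurable F) :
    ∫⁻ ω, F (pathMap X hreg ω) ∂P z = ∫⁻ ω, F (translatePath z (pathMap X hreg ω)) ∂P 0 := by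
  have hp := measurable_pathMap hX.measurable hreg
  have ht : Measurable (translatePath z) :=
    measurable_translatePath.comp (measurable_const.prodMk measurable_id)
  rw [← lintegral_map hF hp, hX.map_pathMap hreg, lintegral_map hF ht]
  exact lintegral_map (hF.comp ht) hp

/-- `P` is not assumed to be a kernel; measurability in the starting point comes from expressing
every `P z` by a translation of paths under `P 0`. -/
lemma IsLevyFamily.measurable_lintegral_path (hX : IsLevyFamily 𝓕 P X)
    (hreg : ∀ ω, IsRegularPath fun t => X t ω) {F : RegularPath → ℝ≥0∞} (hF : Measurable F) :
    Measurable fun z => ∫⁻ ω, F (pathMap X hreg ω) ∂P z := by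
  have := hX.isProbabilityMeasure
  have hp := measurable_pathMap hX.measurable hreg
  simp_rw [hX.lintegral_path hreg _ hF]
  refine Measurable.lintegral_prod_right' (f := fun p : ℝ × Ω =>
    F (translatePath p.1 (pathMap X hreg p.2))) (hF.comp ?_)
  exact measurable_translatePath.comp (measurable_fst.prodMk (hp.comp measurable_snd))

/-- The path of `X` seen from the random time `τ` on. -/
def pathAfter (X : ℝ≥0 → Ω → ℝ) (hreg : ∀ ω, IsRegularPath fun t => X t ω)
    (τ : Ω → WithTop ℝ≥0) (ω : Ω) : RegularPath :=
  shiftPath (τ ω).untopA (pathMap X hreg ω)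

lemma measurable_pathAfter (hX : ∀ t, Measurable (X t))
    (hreg : ∀ ω, IsRegularPath fun t => X t ω) {τ : Ω → WithTop ℝ≥0} (hτ : Measurable τ) :
    Measurable (pathAfter X hreg τ) :=
  measurable_shiftPath.comp (hτ.untopA.prodMk (measurable_pathMap hX hreg))

lemma measurable_stoppedValue_of_regular (hX : ∀ t, Measurable (X t))
    (hreg : ∀ ω, IsRegularPath fun t => X t ω) {τ : Ω → WithTop ℝ≥0} (hτ : Measurable τ) :
    Measurable (stoppedValue X τ) :=
  measurable_eval.comp ((measurable_pathMap hX hreg).prodMk hτ.untopA)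

lemma exists_forall_le_coe (R : BoundedContinuousFunction ℝ ℝ≥0) : ∃ C : ℝ≥0, ∀ u, R u ≤ C := by
  obtain ⟨C, hC⟩ := R.bounded
  refine ⟨R 0 + C.toNNReal, fun u => ?_⟩
  have h := hC u 0
  rw [NNReal.dist_eq] at h
  rw [← NNReal.coe_le_coe, NNReal.coe_add]
  linarith [le_abs_self ((R u : ℝ) - R 0), Real.le_coe_toNNReal C]

/-- The strong Markov property. -/
theorem IsLevyFamily.strongMarkov (hX : IsLevyFamily 𝓕 P X)
    (hreg : ∀ ω, IsRegularPath fun t => X t ω) {τ : Ω → WithTop ℝ≥0} (hτ : IsStoppingTime 𝓕 τ)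
    {x : ℝ} (hfin : ∀ᵐ ω ∂P x, τ ω ≠ ⊤) {F : RegularPath → ℝ≥0∞} (hF : Measurable F) :
    ∫⁻ ω, F (pathAfter X hreg τ ω) ∂P x =
      ∫⁻ ω, (∫⁻ ω', F (pathMap X hreg ω') ∂P (stoppedValue X τ ω)) ∂P x := by
  have := hX.isProbabilityMeasure
  have hp := measurable_pathMap hX.measurable hreg
  have hτm : Measurable τ := hτ.measurable'
  have hθ := measurable_pathAfter hX.measurable hreg hτm
  have hS := measurable_stoppedValue_of_regular hX.measurable hreg hτm
  -- The claimed law of the path after τ: an independent path under `P 0`, translated by the state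
  -- at τ.
  set e : Ω × Ω → RegularPath := fun p => translatePath (stoppedValue X τ p.1) (pathMap X hreg p.2)
  have he : Measurable e := measurable_translatePath.comp
    ((hS.comp measurable_fst).prodMk (hp.comp measurable_snd))
  have hlaw : ∀ {F : RegularPath → ℝ≥0∞}, Measurable F → ∫⁻ w, F w ∂(((P x).prod (P 0)).map e) =
      ∫⁻ ω, (∫⁻ ω', F (pathMap X hreg ω') ∂P (stoppedValue X τ ω)) ∂P x := by
    intro F hF
    rw [lintegral_map hF he]
    refine (lintegral_prod (fun p => F (e p)) (hF.comp he).aemeasurable).trans ?_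
    refine lintegral_congr fun ω => ?_
    rw [hX.lintegral_path hreg _ hF]
  suffices h : (P x).map (pathAfter X hreg τ) = ((P x).prod (P 0)).map e by
    rw [← lintegral_map hF hθ, h, hlaw hF]
  have := Measure.isFiniteMeasure_map (P x) (pathAfter X hreg τ)
  have := Measure.isFiniteMeasure_map ((P x).prod (P 0)) e
  refine RegularPath.measure_ext fun g I => ?_
  have hm : Measurable fun w => ∏ r ∈ I, (g r (coord r w) : ℝ≥0∞) :=
    Finset.measurable_prod _ fun i _ =>
      ((g i).continuous.measurable.comp (measurable_coord i)).coe_nnreal_ennreal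
  rw [hlaw hm, lintegral_map hm hθ]
  obtain ⟨R, hR⟩ := hX.exists_markov g I 0 fun r _ => zero_le
  have hR0 : ∀ z, ∫⁻ ω', ∏ r ∈ I, (g r (coord r (pathMap X hreg ω')) : ℝ≥0∞) ∂P z = R z := by
    intro z
    have h1 := hR z 0 0 (fun _ => 1) measurable_const
    simp only [one_mul, zero_add] at h1
    refine Eq.trans h1 ?_
    rw [lintegral_congr_ae ((hX.start z).mono fun ω hω => by rw [hω])]
    simp
  simp_rw [hR0]
  set u : Ω → ℝ≥0 := fun ω => (τ ω).untopA with hu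
  -- The simple Markov property at each value of the discretized time. Since `approxTime` lies
  -- strictly above τ, the event that it equals (j + 1)/(k + 1) is j/(k + 1) ≤ τ < (j + 1)/(k + 1),
  -- which is known at that time.
  have hstep : ∀ k : ℕ, ∫⁻ ω, ∏ r ∈ I, (g r (X (approxTime k (u ω) + r) ω) : ℝ≥0∞) ∂P x =
      ∫⁻ ω, (R (X (approxTime k (u ω)) ω) : ℝ≥0∞) ∂P x := by
    intro k
    set A : ℕ → Set Ω := fun j => {ω | τ ω ≠ ⊤ ∧ ⌊(k + 1) * u ω⌋₊ = j} with hA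
    have hAm : ∀ j : ℕ, MeasurableSet[𝓕 ((j + 1) / (k + 1))] (A j) := by
      intro j
      have h1 : A j = {ω | τ ω < (((j + 1) / (k + 1) : ℝ≥0) : WithTop ℝ≥0)} \
          {ω | τ ω < (((j : ℝ≥0) / (k + 1) : ℝ≥0) : WithTop ℝ≥0)} := by
        ext ω
        simp only [hA, hu, mem_ofPred_eq, Set.mem_sdiff, not_lt]
        cases hω : τ ω with
        | top => exact ⟨fun h => absurd rfl h.1, fun h => absurd h.1 not_top_lt⟩
        | coe v =>
          have hk : (0 : ℝ≥0) < k + 1 := by positivity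
          have huv : WithTop.untopA (v : WithTop ℝ≥0) = v := rfl
          simp only [WithTop.coe_lt_coe, WithTop.coe_le_coe, huv]
          rw [Nat.floor_eq_iff zero_le, lt_div_iff₀ hk, div_le_iff₀ hk, mul_comm v]
          exact ⟨fun h => ⟨h.2.2, h.2.1⟩, fun h => ⟨WithTop.coe_ne_top, h.2, h.1⟩⟩
      rw [h1]
      refine (hτ.measurableSet_lt _).diff (𝓕.mono ?_ _ (hτ.measurableSet_lt _))
      gcongr
      simp
    have hdisj : Pairwise (Function.onFun Disjoint A) := by
      intro i j hij
      refine Set.disjoint_left.2 fun ω hi hj => hij (hi.2.symm.trans hj.2)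
    have hae : ∀ᵐ ω ∂P x, ω ∈ ⋃ j, A j := by
      filter_upwards [hfin] with ω hω
      exact mem_iUnion.2 ⟨_, hω, rfl⟩
    have hsum : ∀ f : Ω → ℝ≥0∞, ∫⁻ ω, f ω ∂P x = ∑' j, ∫⁻ ω in A j, f ω ∂P x := by
      intro f
      rw [← lintegral_iUnion (fun j => 𝓕.le _ _ (hAm j)) hdisj, Measure.restrict_eq_self_of_ae_mem hae]
    rw [hsum, hsum]
    refine tsum_congr fun j => ?_
    have happrox : ∀ ω ∈ A j, approxTime k (u ω) = (j + 1) / (k + 1) := fun ω hω => by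
      rw [approxTime, hω.2]
    have h1 := hR x 0 ((j + 1) / (k + 1)) ((A j).indicator fun _ => 1)
      (Measurable.indicator (@measurable_const ℝ≥0∞ Ω _ (𝓕 _) 1) (by rw [add_zero]; exact hAm j))
    rw [← lintegral_indicator (𝓕.le _ _ (hAm j)), ← lintegral_indicator (𝓕.le _ _ (hAm j))]
    refine Eq.trans (lintegral_congr fun ω => ?_) (h1.trans (lintegral_congr fun ω => ?_))
    · by_cases hω : ω ∈ A j
      · simp [hω, happrox ω hω]
      · simp [hω]
    · by_cases hω : ω ∈ A j
      · simp [hω, happrox ω hω]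
      · simp [hω]
  have hmeas : ∀ k r, Measurable fun ω => X (approxTime k (u ω) + r) ω := by
    intro k r
    have ha : Measurable fun ω => approxTime k (u ω) + r := by
      have h0 : Measurable fun ω => (⌊(k + 1) * u ω⌋₊ : ℝ≥0) :=
        (measurable_from_top (f := fun n : ℕ => (n : ℝ≥0))).comp
          (Nat.measurable_floor.comp (hτm.untopA.const_mul _))
      exact ((h0.add_const 1).div_const _).add_const r
    exact measurable_eval.comp (hp.prodMk ha)
  choose C hC using fun r => exists_forall_le_coe (g r)
  obtain ⟨CR, hCR⟩ := exists_forall_le_coe R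
  -- The discretized times decrease to τ in the limit from the right, so right continuity of paths
  -- and dominated convergence carry `hstep` over to τ.
  have hlim1 : Tendsto (fun k => ∫⁻ ω, ∏ r ∈ I, (g r (X (approxTime k (u ω) + r) ω) : ℝ≥0∞) ∂P x)
      atTop (𝓝 (∫⁻ ω, ∏ r ∈ I, (g r (coord r (pathAfter X hreg τ ω)) : ℝ≥0∞) ∂P x)) := by
    refine tendsto_lintegral_of_dominated_convergence (fun _ => ∏ r ∈ I, (C r : ℝ≥0∞))
      (fun k => ?_) (fun k => ?_) ?_ ?_
    · exact Finset.measurable_prod _ fun r _ =>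
        ((g r).continuous.measurable.comp (hmeas k r)).coe_nnreal_ennreal
    · exact Eventually.of_forall fun ω => Finset.prod_le_prod' fun r _ =>
        ENNReal.coe_le_coe.2 (hC r _)
    · simp [ENNReal.prod_ne_top]
    · refine Eventually.of_forall fun ω => ?_
      simp_rw [← ENNReal.ofNNReal_finsetProd]
      refine (ENNReal.continuous_coe.tendsto _).comp (tendsto_finsetProd _ fun r _ => ?_)
      refine ((g r).continuous.tendsto _).comp ?_
      refine ((hreg ω).1 (u ω + r)).tendsto.comp ?_
      have h1 : Tendsto (fun k => approxTime k (u ω) + r) atTop (𝓝 (u ω + r)) :=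
        ((tendsto_approxTime (u ω)).mono_right nhdsWithin_le_nhds).add_const r
      exact tendsto_nhdsWithin_iff.2 ⟨h1, Eventually.of_forall fun k =>
        add_le_add (lt_approxTime k (u ω)).le le_rfl⟩
  have hlim2 : Tendsto (fun k => ∫⁻ ω, (R (X (approxTime k (u ω)) ω) : ℝ≥0∞) ∂P x)
      atTop (𝓝 (∫⁻ ω, (R (stoppedValue X τ ω) : ℝ≥0∞) ∂P x)) := by
    refine tendsto_lintegral_of_dominated_convergence (fun _ => (CR : ℝ≥0∞))
      (fun k => ?_) (fun k => ?_) ?_ ?_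
    · have := hmeas k 0
      simp only [add_zero] at this
      exact (R.continuous.measurable.comp this).coe_nnreal_ennreal
    · exact Eventually.of_forall fun ω => ENNReal.coe_le_coe.2 (hCR _)
    · simp
    · refine Eventually.of_forall fun ω => (ENNReal.continuous_coe.tendsto _).comp ?_
      exact (R.continuous.tendsto _).comp (tendsto_of_rightContinuous ((hreg ω).1 (u ω)))
  exact tendsto_nhds_unique hlim1 (by simpa only [hstep] using hlim2)

end

section

variable {Ω : Type*} [mΩ : MeasurableSpace Ω] {𝓕 : Filtration ℝ≥0 mΩ} {P : ℝ → Measure Ω}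
  {X : ℝ≥0 → Ω → ℝ}

/-! ### Threshold times have finite mean -/

lemma IsLevyFamily.integrable_increment (hX : IsLevyFamily 𝓕 P X) :
    Integrable id ((P 0).map fun ω => X 1 ω - X 0 ω) ∧
      0 < ∫ u, u ∂((P 0).map fun ω => X 1 ω - X 0 ω) := by
  have := hX.isProbabilityMeasure 0
  have hm : Measurable fun ω => X 1 ω - X 0 ω := (hX.measurable _).sub (hX.measurable _)
  have hae : (fun ω => X 1 ω - X 0 ω) =ᵐ[P 0] X 1 := by
    filter_upwards [hX.start 0] with ω hω
    rw [hω, sub_zero]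
  constructor
  · rw [integrable_map_measure aestronglyMeasurable_id hm.aemeasurable]
    exact (integrable_congr hae).2 hX.integrable_one
  · rw [integral_map hm.aemeasurable (f := fun u => u) aestronglyMeasurable_id,
      integral_congr_ae hae]
    exact hX.mean_pos

/-- Truncating the increments from above keeps a positive drift while bounding the overshoot over a
level, which is what the Wald argument needs. -/
lemma exists_truncation_integral_pos {ν : Measure ℝ} (hi : Integrable id ν)
    (hpos : 0 < ∫ u, u ∂ν) : ∃ n : ℕ, 0 < ∫ u, min u n ∂ν := by
  have hlim : Tendsto (fun n : ℕ => ∫ u, min u n ∂ν) atTop (𝓝 (∫ u, u ∂ν)) := by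
    refine tendsto_integral_of_dominated_convergence (fun u => |u|) (fun n => ?_) hi.abs
      (fun n => Eventually.of_forall fun u => ?_) (Eventually.of_forall fun u => ?_)
    · exact (measurable_id.min measurable_const).aestronglyMeasurable
    · rw [Real.norm_eq_abs]
      rcases le_total u n with h | h
      · rw [min_eq_left h]
      · rw [min_eq_right h, abs_of_nonneg (Nat.cast_nonneg n)]
        exact h.trans (le_abs_self u)
    · obtain ⟨N, hN⟩ := exists_nat_ge u
      refine tendsto_const_nhds.congr' ?_
      filter_upwards [eventually_ge_atTop N] with n hn
      rw [min_eq_left (hN.trans (Nat.cast_le.2 hn))]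
  exact (hlim.eventually (lt_mem_nhds hpos)).exists

/-- Wald's argument at integer times: while the walk is below y, each truncated step adds m > 0 on
average, whereas the total gain stays below |y - x| + c. Hence the mean number of steps is at most
(|y - x| + c)/m. -/
theorem IsLevyFamily.thresholdTime_finite_mean (hX : IsLevyFamily 𝓕 P X) (x y : ℝ) :
    expectedTime (P x) (thresholdTime X y) < ⊤ ∧ ∀ᵐ ω ∂P x, thresholdTime X y ω ≠ ⊤ := by
  have := hX.isProbabilityMeasure x
  obtain ⟨hi, hpos⟩ := hX.integrable_increment
  obtain ⟨c, hc⟩ := exists_truncation_integral_pos hi hpos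
  set ν := (P 0).map fun ω => X 1 ω - X 0 ω with hν
  set m := ∫ u, min u (c : ℝ) ∂ν with hmdef
  set ξ : ℕ → Ω → ℝ := fun k ω => min (X (k + 1) ω - X k ω) c with hξ
  have hinc : ∀ k : ℕ, Measurable fun ω => X (k + 1) ω - X k ω := fun k =>
    (hX.measurable _).sub (hX.measurable _)
  have hmin : Measurable fun u : ℝ => min u (c : ℝ) := measurable_id.min measurable_const
  have hmini : Integrable (fun u : ℝ => min u (c : ℝ)) ν := by
    have := hX.isProbabilityMeasure 0
    have : IsProbabilityMeasure ν := Measure.isProbabilityMeasure_map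
      ((hX.measurable _).sub (hX.measurable _)).aemeasurable
    exact hi.inf (integrable_const _)
  have hlaw : ∀ k : ℕ, (P x).map (fun ω => X (k + 1) ω - X k ω) = ν := fun k =>
    hX.stationaryIncrements x k 1
  have hξi : ∀ k, Integrable (ξ k) (P x) := fun k => by
    rw [← hlaw k] at hmini
    exact hmini.comp_measurable (hinc k)
  have hξm : ∀ k, ∫ ω, ξ k ω ∂P x = m := fun k => by
    rw [hmdef, ← hlaw k, integral_map (hinc k).aemeasurable hmin.aestronglyMeasurable]
  set A : ℕ → Set Ω := fun k => {ω | ∀ j ≤ k, X j ω < y} with hA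
  have hAm : ∀ k : ℕ, MeasurableSet[𝓕 k] (A k) := fun k => by
    have : A k = ⋂ j ∈ Iic k, {ω | X j ω < y} := by ext; simp [hA]
    rw [this]
    refine MeasurableSet.biInter (to_countable _) fun j hj => ?_
    exact hX.measurable_of_le (Nat.cast_le.2 hj) measurableSet_Iio
  -- Being below y at the times 0, ..., k is an event of the past, independent of the next
  -- increment.
  have hAint : ∀ k, ∫ ω in A k, ξ k ω ∂P x = m * (P x).real (A k) := by
    intro k
    have h1 := condExp_indep_eq (μ := P x) (f := ξ k) (hinc k).comap_le (𝓕.le k)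
      ((hmin.comp (comap_measurable _)).stronglyMeasurable) (hX.indepIncrements x k 1)
    rw [← setIntegral_condExp (𝓕.le k) (hξi k) (hAm k), setIntegral_congr_ae (g := fun _ => m)
      (𝓕.le _ _ (hAm k)) (h1.mono fun ω hω _ => by rw [hω, hξm]), setIntegral_const]
    rw [smul_eq_mul, mul_comm]
  have hanti : ∀ k, A (k + 1) ⊆ A k := fun k ω h j hj => h j (hj.trans k.le_succ)
  -- Before the last step the sum is at most X_n - X_0 < y - X_0, and the step that leaves the
  -- region adds at most the truncation level c.
  have hpath : ∀ ω, ∀ n : ℕ, ((∑ k ∈ Finset.range n, (A k).indicator (ξ k) ω) ≤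
      |y - X 0 ω| + c) ∧ (ω ∈ A n → ∑ k ∈ Finset.range n, (A k).indicator (ξ k) ω ≤
        X n ω - X 0 ω) := by
    intro ω n
    induction n with
    | zero => refine ⟨by simp; positivity, fun _ => by simp⟩
    | succ n ih =>
      rw [Finset.sum_range_succ]
      by_cases h : ω ∈ A n
      · have h1 := ih.2 h
        have h2 := h n le_rfl
        rw [indicator_of_mem h]
        have h3 : ξ n ω ≤ c := min_le_right _ _
        have h4 : ξ n ω ≤ X (n + 1) ω - X n ω := min_le_left _ _
        refine ⟨by linarith [le_abs_self (y - X 0 ω)], fun _ => ?_⟩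
        push_cast
        linarith
      · rw [indicator_of_notMem h, add_zero]
        exact ⟨ih.1, fun h' => absurd (hanti n h') h⟩
  have hsum : ∀ n : ℕ, ∑ k ∈ Finset.range n, (P x).real (A k) ≤ (|y - x| + c) / m := by
    intro n
    rw [le_div_iff₀ hc, mul_comm, Finset.mul_sum]
    have hint : ∀ k, Integrable ((A k).indicator (ξ k)) (P x) := fun k =>
      (hξi k).indicator (𝓕.le _ _ (hAm k))
    calc ∑ k ∈ Finset.range n, m * (P x).real (A k)
        = ∫ ω, ∑ k ∈ Finset.range n, (A k).indicator (ξ k) ω ∂P x := by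
          rw [integral_finsetSum _ fun k _ => hint k]
          refine Finset.sum_congr rfl fun k _ => ?_
          rw [integral_indicator (𝓕.le _ _ (hAm k)), hAint]
      _ ≤ ∫ ω, (|y - x| + c) ∂P x := by
          refine integral_mono_ae (integrable_finsetSum _ fun k _ => hint k)
            (integrable_const _) ?_
          filter_upwards [hX.start x] with ω hω
          have := (hpath ω n).1
          rwa [hω] at this
      _ = |y - x| + c := by simp
  -- If L is the first integer with ω outside A_L, then τ_y ≤ L, and L counts the sets A_0, ...,
  -- A_{L-1}.
  have hle : ∀ ω, timeToENNReal (thresholdTime X y ω) ≤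
      ∑' k, (A k).indicator (fun _ => (1 : ℝ≥0∞)) ω := by
    intro ω
    by_cases hall : ∀ k, ω ∈ A k
    · have : ∀ k, (A k).indicator (fun _ => (1 : ℝ≥0∞)) ω = 1 := fun k =>
        indicator_of_mem (hall k) _
      simp [this]
    · push Not at hall
      classical
      have hex := Nat.find_spec hall
      set L := Nat.find hall with hL
      have hlt : ∀ k < L, ω ∈ A k := fun k hk => by
        have := Nat.find_min hall hk
        push Not at this
        exact this
      have : ∃ j ≤ L, y ≤ X j ω := by
        simpa [hA] using hex
      obtain ⟨j, hj, hjy⟩ := this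
      have h1 : thresholdTime X y ω ≤ (j : ℝ≥0) := hittingAfter_le_of_mem zero_le hjy
      calc timeToENNReal (thresholdTime X y ω) ≤ timeToENNReal ((j : ℝ≥0) : WithTop ℝ≥0) :=
            timeToENNReal_mono h1
        _ = j := ENNReal.coe_natCast j
        _ ≤ L := by exact_mod_cast hj
        _ = ∑ k ∈ Finset.range L, (A k).indicator (fun _ => (1 : ℝ≥0∞)) ω := by
            rw [Finset.sum_congr rfl fun k hk =>
              indicator_of_mem (hlt k (Finset.mem_range.1 hk)) _]
            simp
        _ ≤ _ := ENNReal.sum_le_tsum _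
  have hlt : ∫⁻ ω, ∑' k, (A k).indicator (fun _ => (1 : ℝ≥0∞)) ω ∂P x < ⊤ := by
    calc ∫⁻ ω, ∑' k, (A k).indicator (fun _ => (1 : ℝ≥0∞)) ω ∂P x
        = ∑' k, P x (A k) := by
          rw [lintegral_tsum fun k =>
            (measurable_const.indicator (𝓕.le _ _ (hAm k))).aemeasurable]
          refine tsum_congr fun k => ?_
          rw [lintegral_indicator_const (𝓕.le _ _ (hAm k)), one_mul]
      _ ≤ ENNReal.ofReal ((|y - x| + c) / m) := by
          refine ENNReal.tsum_le_of_sum_range_le fun n => ?_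
          rw [← ENNReal.ofReal_toReal
            (ENNReal.sum_ne_top.2 fun k _ => measure_ne_top (P x) (A k)),
            ENNReal.toReal_sum fun k _ => measure_ne_top (P x) (A k)]
          exact ENNReal.ofReal_le_ofReal (hsum n)
      _ < ⊤ := ENNReal.ofReal_lt_top
  refine ⟨(lintegral_mono hle).trans_lt hlt, ?_⟩
  filter_upwards [ae_lt_top (Measurable.tsum fun k =>
    measurable_const.indicator (𝓕.le _ _ (hAm k))) hlt.ne] with ω hω h
  exact ((hle ω).trans_lt hω).ne (timeToENNReal_eq_top.2 h)

lemma ae_ne_top_of_expectedTime_lt_top {μ : Measure Ω} {τ : Ω → WithTop ℝ≥0} (hτ : Measurable τ)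
    (h : expectedTime μ τ < ⊤) : ∀ᵐ ω ∂μ, τ ω ≠ ⊤ := by
  filter_upwards [ae_lt_top (measurable_timeToENNReal.comp hτ) h.ne] with ω hω
  exact fun h => hω.ne (timeToENNReal_eq_top.2 h)

end

section

/-! ### Threshold times are stopping times -/

/-- A right-continuous path that enters an open half-line stays there for a while, hence is there at
a rational time. This fails for closed half-lines, which explains the detour through open ones. -/
lemma hittingAfter_Ioi_lt_iff {w : RegularPath} {c : ℝ} {t : ℝ≥0} :
    hittingAfter coord (Ioi c) 0 w < t ↔
      ∃ q : ℚ, (q : ℝ).toNNReal < t ∧ c < coord (q : ℝ).toNNReal w := by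
  constructor
  · intro h
    obtain ⟨r, hr, hc⟩ := exists_mem_lt_of_hittingAfter_lt h
    have hev := (w.2.1 r).eventually (lt_mem_nhds (show c < w.1 r from hc))
    obtain ⟨u, hu, hsub⟩ := (mem_nhdsGE_iff_exists_Ico_subset' hr).1 hev
    have hlt : (r : ℝ) < min u t := lt_min hu hr
    obtain ⟨q, hq1, hq2⟩ := exists_rat_btwn hlt
    have hq0 : (0 : ℝ) ≤ q := r.coe_nonneg.trans hq1.le
    have hqu : (q : ℝ).toNNReal < u := by
      rw [← NNReal.coe_lt_coe, Real.coe_toNNReal _ hq0]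
      exact hq2.trans_le (min_le_left _ _)
    refine ⟨q, ?_, hsub ⟨?_, hqu⟩⟩
    · rw [← NNReal.coe_lt_coe, Real.coe_toNNReal _ hq0]
      exact hq2.trans_le (min_le_right _ _)
    · rw [← NNReal.coe_le_coe, Real.coe_toNNReal _ hq0]
      exact hq1.le
  · rintro ⟨q, hq, hc⟩
    exact (hittingAfter_le_of_mem zero_le (show coord _ w ∈ Ioi c from hc)).trans_lt
      (WithTop.coe_lt_coe.2 hq)

lemma measurable_hittingAfter_Ioi (c : ℝ) : Measurable (hittingAfter coord (Ioi c) 0) := by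
  have h : ∀ t : ℝ≥0, MeasurableSet {w | hittingAfter coord (Ioi c) 0 w < t} := fun t => by
    simp_rw [hittingAfter_Ioi_lt_iff, ofPred_exists]
    refine MeasurableSet.iUnion fun q => ?_
    by_cases hq : (q : ℝ).toNNReal < t
    · simpa [hq] using measurableSet_lt measurable_const (measurable_coord _)
    · simp [hq]
  refine measurable_of_Iio fun a => ?_
  cases a with
  | coe t => exact h t
  | top =>
    have : (hittingAfter coord (Ioi c) 0) ⁻¹' Iio ⊤ =
        ⋃ n : ℕ, {w | hittingAfter coord (Ioi c) 0 w < ((n : ℝ≥0) : WithTop ℝ≥0)} := by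
      ext w
      simp only [mem_preimage, mem_Iio, mem_iUnion, mem_ofPred_eq]
      constructor
      · intro hw
        cases hw' : hittingAfter coord (Ioi c) 0 w with
        | top => exact absurd hw' hw.ne
        | coe s =>
          obtain ⟨n, hn⟩ := exists_nat_gt s
          exact ⟨n, WithTop.coe_lt_coe.2 hn⟩
      · rintro ⟨n, hn⟩
        exact hn.trans (WithTop.coe_lt_top _)
    rw [this]
    exact MeasurableSet.iUnion fun n => h n

/-- The supremum of the hitting times of the open half-lines `(y - 1 / (n + 1), ∞)`: the first time
at which the path or its left limit reaches `y`. -/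
def announcedTime (y : ℝ) (w : RegularPath) : WithTop ℝ≥0 :=
  ⨆ n : ℕ, hittingAfter coord (Ioi (y - 1 / (n + 1))) 0 w

lemma measurable_announcedTime (y : ℝ) : Measurable (announcedTime y) :=
  Measurable.iSup fun _ => measurable_hittingAfter_Ioi _

lemma hittingAfter_Ioi_le_thresholdTime (w : RegularPath) {c y : ℝ} (h : c < y) :
    hittingAfter coord (Ioi c) 0 w ≤ thresholdTime coord y w := by
  cases h' : thresholdTime coord y w with
  | top => exact le_top
  | coe s =>
    exact hittingAfter_le_of_mem zero_le
      (show coord s w ∈ Ioi c from h.trans_le (le_coord_thresholdTime h'))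

lemma announcedTime_le (y : ℝ) (w : RegularPath) : announcedTime y w ≤ thresholdTime coord y w :=
  iSup_le fun n => hittingAfter_Ioi_le_thresholdTime w (by
    have : (0 : ℝ) < 1 / (n + 1) := by positivity
    linarith)

lemma le_coord_of_hittingAfter_Ioi {w : RegularPath} {c : ℝ} {s : ℝ≥0}
    (h : hittingAfter coord (Ioi c) 0 w = s) : c ≤ w.1 s := by
  have := coord_hittingAfter_mem_closure h
  rwa [closure_Ioi] at this

variable {Ω : Type*} [mΩ : MeasurableSpace Ω] {𝓕 : Filtration ℝ≥0 mΩ} {P : ℝ → Measure Ω}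
  {X : ℝ≥0 → Ω → ℝ}

lemma IsLevyFamily.isStoppingTime_hittingAfter_Ioi (hX : IsLevyFamily 𝓕 P X)
    (hreg : ∀ ω, IsRegularPath fun t => X t ω) (c : ℝ) :
    IsStoppingTime 𝓕 (hittingAfter X (Ioi c) 0) := by
  have := hX.rightContinuous
  refine isStoppingTime_of_measurableSet_lt_of_isRightContinuous fun t => ?_
  have h : {ω | hittingAfter X (Ioi c) 0 ω < t} =
      ⋃ q : ℚ, {ω | (q : ℝ).toNNReal < t ∧ c < X (q : ℝ).toNNReal ω} := by
    ext ω
    rw [mem_iUnion]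
    exact hittingAfter_Ioi_lt_iff (w := pathMap X hreg ω)
  rw [h]
  refine MeasurableSet.iUnion fun q => ?_
  by_cases hq : (q : ℝ).toNNReal < t
  · simp only [hq, true_and]
    exact hX.measurable_of_le hq.le measurableSet_Ioi
  · simp [hq]

/-- Completeness puts every subset of the exceptional set, measurable or not, into `𝓕 0`. -/
lemma IsLevyFamily.isStoppingTime_of_ae_eq (hX : IsLevyFamily 𝓕 P X) {τ τ' : Ω → WithTop ℝ≥0}
    (hτ : IsStoppingTime 𝓕 τ') (h : ∀ x, ∀ᵐ ω ∂P x, τ ω = τ' ω) : IsStoppingTime 𝓕 τ := by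
  have hN : ∀ N ⊆ {ω | τ ω ≠ τ' ω}, ∀ t, MeasurableSet[𝓕 t] N := fun N hN t =>
    𝓕.mono zero_le _ (hX.complete N fun x => measure_mono_null hN (h x))
  intro t
  have : {ω | τ ω ≤ t} = ({ω | τ' ω ≤ t} \ {ω | τ ω ≠ τ' ω}) ∪
      ({ω | τ ω ≤ t} ∩ {ω | τ ω ≠ τ' ω}) := by
    ext ω
    by_cases hω : τ ω = τ' ω <;> simp [hω]
  rw [this]
  exact ((hτ t).diff (hN _ subset_rfl t)).union (hN _ inter_subset_right t)

lemma IsLevyFamily.measure_increment_after (hX : IsLevyFamily 𝓕 P X)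
    (hreg : ∀ ω, IsRegularPath fun t => X t ω) {τ : Ω → WithTop ℝ≥0} (hτ : IsStoppingTime 𝓕 τ)
    {x : ℝ} (hfin : ∀ᵐ ω ∂P x, τ ω ≠ ⊤) (t : ℝ≥0) {B : Set ℝ} (hB : MeasurableSet B) :
    P x {ω | X ((τ ω).untopA + t) ω - X (τ ω).untopA ω ∈ B} = P 0 {ω | X t ω - X 0 ω ∈ B} := by
  have := hX.isProbabilityMeasure
  set S : Set RegularPath := {w | coord t w - coord 0 w ∈ B} with hS
  have hSm : MeasurableSet S := ((measurable_coord t).sub (measurable_coord 0)) hB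
  have hp := measurable_pathMap hX.measurable hreg
  have hinc : ∀ z, P z (pathMap X hreg ⁻¹' S) = P 0 {ω | X t ω - X 0 ω ∈ B} := by
    intro z
    have hm : Measurable fun ω => X t ω - X 0 ω := (hX.measurable _).sub (hX.measurable _)
    have h1 := hX.stationaryIncrements z 0 t
    rw [zero_add] at h1
    have h2 := congrArg (fun μ => μ B) h1
    simp only [Measure.map_apply hm hB] at h2
    exact h2
  have h := hX.strongMarkov hreg hτ hfin (F := S.indicator 1) (measurable_one.indicator hSm)
  have hθ := measurable_pathAfter hX.measurable hreg hτ.measurable'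
  have e1 : ∀ z, ∫⁻ ω, S.indicator 1 (pathMap X hreg ω) ∂P z = P 0 {ω | X t ω - X 0 ω ∈ B} := by
    intro z
    rw [← hinc z, ← lintegral_indicator_one (hp hSm)]
    rfl
  simp_rw [e1] at h
  have e2 : ∫⁻ ω, S.indicator 1 (pathAfter X hreg τ ω) ∂P x = P x (pathAfter X hreg τ ⁻¹' S) := by
    rw [← lintegral_indicator_one (hθ hSm)]
    rfl
  rw [e2, lintegral_const, measure_univ, mul_one] at h
  rw [← h]
  congr 1
  ext ω
  simp [hS, pathAfter, shiftPath, coord, pathMap]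

/-- Right continuity at time 0 makes downward jumps of size ε over short intervals unlikely. -/
lemma IsLevyFamily.tendsto_measure_increment (hX : IsLevyFamily 𝓕 P X)
    (hreg : ∀ ω, IsRegularPath fun t => X t ω) {ε : ℝ} (hε : 0 < ε) :
    Tendsto (fun k : ℕ => P 0 {ω | X (1 / (k + 1)) ω - X 0 ω ∈ Iio (-ε)}) atTop (𝓝 0) := by
  have := hX.isProbabilityMeasure 0
  have hm : ∀ k : ℕ, MeasurableSet {ω | X (1 / (k + 1)) ω - X 0 ω ∈ Iio (-ε)} := fun k =>
    ((hX.measurable _).sub (hX.measurable _)) measurableSet_Iio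
  have h0 : ∀ k : ℕ, ∫⁻ ω, {ω | X (1 / (k + 1)) ω - X 0 ω ∈ Iio (-ε)}.indicator 1 ω ∂P 0 =
      P 0 {ω | X (1 / (k + 1)) ω - X 0 ω ∈ Iio (-ε)} := fun k => lintegral_indicator_one (hm k)
  simp_rw [← h0]
  have hlim := tendsto_lintegral_of_dominated_convergence (μ := P 0) (F := fun (k : ℕ) ω =>
    {ω | X (1 / (k + 1)) ω - X 0 ω ∈ Iio (-ε)}.indicator (1 : Ω → ℝ≥0∞) ω) (f := fun _ => 0)
    (fun _ => 1) (fun k => measurable_one.indicator (hm k))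
    (fun k => Eventually.of_forall fun ω => indicator_le_self' (fun _ _ => zero_le) ω) (by simp)
    (Eventually.of_forall fun ω => ?_)
  · simpa using hlim
  · have h1 : Tendsto (fun k : ℕ => (1 / (k + 1) : ℝ≥0)) atTop (𝓝[≥] 0) :=
      tendsto_nhdsWithin_iff.2 ⟨tendsto_one_div_add_atTop_nhds_zero_nat,
        Eventually.of_forall fun _ => mem_Ici.2 zero_le⟩
    have h2 : Tendsto (fun k : ℕ => X (1 / (k + 1)) ω - X 0 ω) atTop (𝓝 0) := by
      have := (((hreg ω).1 0).tendsto.comp h1).sub_const (X 0 ω)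
      simpa using this
    refine tendsto_const_nhds.congr' ?_
    filter_upwards [h2.eventually (lt_mem_nhds (neg_lt_zero.2 hε))] with k hk
    rw [indicator_of_notMem]
    simpa using hk.le

/-- Quasi-left-continuity: a.s. a level cannot be reached by a left limit only. -/
theorem IsLevyFamily.ae_announcedTime_eq (hX : IsLevyFamily 𝓕 P X)
    (hreg : ∀ ω, IsRegularPath fun t => X t ω) (y x : ℝ)
    (hfin : ∀ᵐ ω ∂P x, thresholdTime X y ω ≠ ⊤) :
    ∀ᵐ ω ∂P x, announcedTime y (pathMap X hreg ω) = thresholdTime X y ω := by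
  have hprob := hX.isProbabilityMeasure
  set σ : ℕ → Ω → WithTop ℝ≥0 := fun n => hittingAfter X (Ioi (y - 1 / (n + 1))) 0 with hσ
  have hlt : ∀ n : ℕ, y - 1 / (n + 1) < y := fun n => by
    have : (0 : ℝ) < 1 / (n + 1) := by positivity
    linarith
  have hσT : ∀ n ω, σ n ω ≤ thresholdTime X y ω := fun n ω =>
    hittingAfter_Ioi_le_thresholdTime (pathMap X hreg ω) (hlt n)
  have hσfin : ∀ n, ∀ᵐ ω ∂P x, σ n ω ≠ ⊤ := fun n => by
    filter_upwards [hfin] with ω hω h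
    exact hω (top_le_iff.1 (h ▸ hσT n ω))
  have hσmono : ∀ ω, Monotone fun n => σ n ω := by
    intro ω m n hmn
    refine hittingAfter_anti X 0 (Ioi_subset_Ioi ?_) ω
    have : (1 : ℝ) / (n + 1) ≤ 1 / (m + 1) := by
      gcongr
    linarith
  -- The bad event, made countable: the announced time is some finite s, yet X stays below y by the
  -- margin 2/(i + 1) on [s, s + 1/(j + 1)).
  set A : ℕ → ℕ → Set Ω := fun i j => {ω | ∃ s : ℝ≥0, announcedTime y (pathMap X hreg ω) = s ∧
    ∀ u, s ≤ u → u < s + 1 / (j + 1) → X u ω < y - 2 * (1 / (i + 1))} with hA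
  have hA0 : ∀ i j, P x (A i j) = 0 := by
    intro i j
    set ε : ℝ := 1 / (i + 1) with hε
    have hεpos : 0 < ε := by positivity
    -- On the bad event, for large n, σ_n ≤ s < σ_n + t with X ≥ y - ε at σ_n but X < y - 2ε at σ_n
    -- + t. Such a drop within time t has, by the strong Markov property, the same probability for
    -- every n, and this probability tends to 0 with t.
    have hbound : ∀ t : ℝ≥0, 0 < t → t < 1 / (j + 1) →
        P x (A i j) ≤ P 0 {ω | X t ω - X 0 ω ∈ Iio (-ε)} := by
      intro t ht0 ht
      set B : ℕ → Set Ω := fun n =>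
        {ω | X ((σ n ω).untopA + t) ω - X (σ n ω).untopA ω ∈ Iio (-ε)} with hB
      have hBP : ∀ n, P x (B n) = P 0 {ω | X t ω - X 0 ω ∈ Iio (-ε)} := fun n =>
        hX.measure_increment_after hreg (hX.isStoppingTime_hittingAfter_Ioi hreg _) (hσfin n) t
          measurableSet_Iio
      have hsub : A i j ⊆ ⋃ N, ⋂ n ∈ Ici N, B n := by
        rintro ω ⟨s, hs, hsu⟩
        have hσs : ∀ n, σ n ω ≤ s := fun n => hs ▸
          le_iSup (fun n : ℕ => hittingAfter coord (Ioi (y - 1 / (n + 1))) 0 (pathMap X hreg ω)) n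
        have hN1 : ∃ N, ∀ n ≥ N, ∀ v : ℝ≥0, σ n ω = v → s < v + t := by
          -- The case s = 0 is separate because s - t < s fails for truncated subtraction at 0.
          rcases eq_or_ne s 0 with rfl | hs0
          · exact ⟨0, fun n _ v _ => ht0.trans_le le_add_self⟩
          · have h1 : ((s - t : ℝ≥0) : WithTop ℝ≥0) < announcedTime y (pathMap X hreg ω) := by
              rw [hs, WithTop.coe_lt_coe]
              exact tsub_lt_self (pos_iff_ne_zero.2 hs0) ht0
            obtain ⟨N, hN⟩ := lt_iSup_iff.1 h1
            refine ⟨N, fun n hn v hv => ?_⟩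
            have h2 := hN.trans_le (hσmono ω hn)
            simp only [hv, WithTop.coe_lt_coe] at h2
            exact lt_add_of_tsub_lt_right h2
        obtain ⟨N, hN⟩ := hN1
        refine mem_iUnion.2 ⟨max N i, mem_iInter₂.2 fun n hn => ?_⟩
        have hnN : N ≤ n := (le_max_left _ _).trans hn
        have hni : i ≤ n := (le_max_right _ _).trans hn
        cases hv : σ n ω with
        | top => exact absurd (hσs n) (by rw [hv]; exact WithTop.not_top_le_coe s)
        | coe v =>
          have hvs : v ≤ s := by
            have := hσs n
            rw [hv] at this
            exact WithTop.coe_le_coe.1 this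
          have h1 : X (v + t) ω < y - 2 * ε :=
            hsu _ (hN n hnN v hv).le (add_lt_add_of_le_of_lt hvs ht)
          have h2 : y - 1 / (n + 1) ≤ X v ω :=
            le_coord_of_hittingAfter_Ioi (w := pathMap X hreg ω) hv
          have h3 : (1 : ℝ) / (n + 1) ≤ ε := by
            rw [hε]
            gcongr
          have huv : WithTop.untopA (v : WithTop ℝ≥0) = v := rfl
          simp only [hB, hv, huv, mem_ofPred_eq, mem_Iio]
          linarith
      calc P x (A i j) ≤ P x (⋃ N, ⋂ n ∈ Ici N, B n) := measure_mono hsub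
        _ = ⨆ N, P x (⋂ n ∈ Ici N, B n) := by
            refine Monotone.measure_iUnion fun N M hNM => ?_
            exact biInter_subset_biInter_left (Ici_subset_Ici.2 hNM)
        _ ≤ _ := iSup_le fun N => (measure_mono (biInter_subset_of_mem (mem_Ici.2 le_rfl))).trans
            (hBP N).le
    refine le_antisymm ?_ zero_le
    refine ge_of_tendsto (hX.tendsto_measure_increment hreg hεpos) ?_
    filter_upwards [eventually_gt_atTop j] with k hk
    refine hbound _ (by positivity) ?_
    gcongr
  have hU : P x (⋃ i, ⋃ j, A i j) = 0 := measure_iUnion_null fun i => measure_iUnion_null (hA0 i)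
  refine measure_mono_null ?_ hU
  intro ω hω
  have hle := announcedTime_le y (pathMap X hreg ω)
  cases hs : announcedTime y (pathMap X hreg ω) with
  | top =>
    rw [hs, top_le_iff] at hle
    exact absurd (hs.trans hle.symm) hω
  | coe s =>
    -- If the announced time s were not the threshold time, X would be below y at s, and by right
    -- continuity for a while after, which puts ω into some A_{ij}.
    have hXs : X s ω < y := by
      by_contra! hge
      refine hω (le_antisymm hle ?_)
      rw [hs]
      exact thresholdTime_le (w := pathMap X hreg ω) hge
    obtain ⟨i, hi⟩ := exists_nat_one_div_lt (half_pos (sub_pos.2 hXs))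
    have hXi : X s ω < y - 2 * (1 / (i + 1)) := by linarith
    have hev := ((hreg ω).1 s).eventually (gt_mem_nhds hXi)
    obtain ⟨u, hu, hsub⟩ := (mem_nhdsGE_iff_exists_Ico_subset).1 hev
    obtain ⟨j, hj⟩ := exists_nat_one_div_lt (tsub_pos_of_lt (mem_Ioi.1 hu))
    refine mem_iUnion₂.2 ⟨i, j, s, hs, fun v hv hvj => hsub ⟨hv, hvj.trans ?_⟩⟩
    exact lt_tsub_iff_left.1 hj

end

/-! ### Measurability of threshold times -/

section

/-- The paths that reach the level `y` in finite time, and not by a left limit only. -/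
def reachingPaths (y : ℝ) : Set RegularPath :=
  {w | announcedTime y w ≠ ⊤ ∧ y ≤ w.1 (announcedTime y w).untopA}

lemma measurableSet_reachingPaths (y : ℝ) : MeasurableSet (reachingPaths y) := by
  have h1 : MeasurableSet {w | announcedTime y w ≠ ⊤} :=
    ((measurable_announcedTime y) (measurableSet_singleton ⊤)).compl
  exact h1.inter (measurableSet_le measurable_const
    (measurable_eval.comp (measurable_id.prodMk (measurable_announcedTime y).untopA)))

/-- On these paths the threshold time may be replaced by `announcedTime`, a supremum of measurable
hitting times and therefore a measurable functional of the path. -/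
lemma thresholdTime_of_mem_reachingPaths {y : ℝ} {w : RegularPath} (h : w ∈ reachingPaths y) :
    thresholdTime coord y w = announcedTime y w := by
  refine le_antisymm ?_ (announcedTime_le y w)
  obtain ⟨h1, h2⟩ := h
  cases h' : announcedTime y w with
  | top => exact le_top
  | coe s => rw [h'] at h2; exact thresholdTime_le h2

variable {Ω : Type*} [mΩ : MeasurableSpace Ω] {𝓕 : Filtration ℝ≥0 mΩ} {P : ℝ → Measure Ω}
  {X : ℝ≥0 → Ω → ℝ}

lemma IsLevyFamily.ae_mem_reachingPaths (hX : IsLevyFamily 𝓕 P X)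
    (hreg : ∀ ω, IsRegularPath fun t => X t ω) (y x : ℝ) :
    ∀ᵐ ω ∂P x, pathMap X hreg ω ∈ reachingPaths y := by
  have hfin := (hX.thresholdTime_finite_mean x y).2
  filter_upwards [hfin, hX.ae_announcedTime_eq hreg y x hfin] with ω h1 h2
  have h3 : thresholdTime coord y (pathMap X hreg ω) = announcedTime y (pathMap X hreg ω) := h2.symm
  refine ⟨fun h => h1 (h2.symm.trans h), ?_⟩
  cases h' : announcedTime y (pathMap X hreg ω) with
  | top => exact absurd (h2.symm.trans h') h1
  | coe s => exact le_coord_thresholdTime (h3.trans h')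

/-- The exceptional set of paths is null from every starting point, so by the strong Markov property
it is also null for the path after τ. -/
lemma IsLevyFamily.ae_pathAfter_mem_reachingPaths (hX : IsLevyFamily 𝓕 P X)
    (hreg : ∀ ω, IsRegularPath fun t => X t ω) {τ : Ω → WithTop ℝ≥0} (hτ : IsStoppingTime 𝓕 τ)
    {x : ℝ} (hfin : ∀ᵐ ω ∂P x, τ ω ≠ ⊤) (y : ℝ) :
    ∀ᵐ ω ∂P x, pathAfter X hreg τ ω ∈ reachingPaths y := by
  have hm := (measurableSet_reachingPaths y).compl
  have h := hX.strongMarkov hreg hτ hfin (measurable_one.indicator hm)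
  have h0 : ∀ z, ∫⁻ ω, (reachingPaths y)ᶜ.indicator 1 (pathMap X hreg ω) ∂P z = 0 := fun z => by
    rw [← lintegral_zero (μ := P z)]
    refine lintegral_congr_ae ?_
    filter_upwards [hX.ae_mem_reachingPaths hreg y z] with ω hω
    exact indicator_of_notMem (fun h : _ ∈ (reachingPaths y)ᶜ => h hω) _
  simp_rw [h0, lintegral_zero] at h
  have hθ := measurable_pathAfter hX.measurable hreg hτ.measurable'
  filter_upwards [(lintegral_eq_zero_iff ((measurable_one.indicator hm).comp hθ)).1 h] with ω hω
  by_contra hc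
  have h1 : (reachingPaths y)ᶜ.indicator (1 : RegularPath → ℝ≥0∞) (pathAfter X hreg τ ω) = 1 :=
    indicator_of_mem hc _
  exact one_ne_zero (h1.symm.trans hω)

/-- A.s. the threshold time is the supremum of the hitting times of open half-lines, which are
stopping times by right continuity of the filtration; completeness absorbs the null set. -/
lemma IsLevyFamily.isStoppingTime_thresholdTime (hX : IsLevyFamily 𝓕 P X)
    (hreg : ∀ ω, IsRegularPath fun t => X t ω) (y : ℝ) : IsStoppingTime 𝓕 (thresholdTime X y) := by
  refine hX.isStoppingTime_of_ae_eq (τ' := fun ω => announcedTime y (pathMap X hreg ω))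
    (fun t => ?_) fun x => ?_
  · have : {ω | announcedTime y (pathMap X hreg ω) ≤ t} =
        ⋂ n : ℕ, {ω | hittingAfter X (Ioi (y - 1 / (n + 1))) 0 ω ≤ t} := by
      ext ω
      rw [mem_iInter]
      exact iSup_le_iff (f := fun n : ℕ =>
        hittingAfter coord (Ioi (y - 1 / (n + 1))) 0 (pathMap X hreg ω))
    rw [this]
    exact MeasurableSet.iInter fun n => hX.isStoppingTime_hittingAfter_Ioi hreg _ t
  · filter_upwards [hX.ae_mem_reachingPaths hreg y x] with ω hω
    exact thresholdTime_of_mem_reachingPaths hω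

/-! ### Extended expectations and time integrals -/

lemma coe_ennreal_sub_coe_ennreal {a b : ℝ≥0∞} (ha : a ≠ ⊤) (hb : b ≠ ⊤) :
    (a : EReal) - (b : EReal) = ((a.toReal - b.toReal : ℝ) : EReal) := by
  lift a to ℝ≥0 using ha
  lift b to ℝ≥0 using hb
  rw [EReal.coe_sub]
  rfl

lemma extExp_of_integrable {μ : Measure Ω} {Z : Ω → ℝ} (hZ : Integrable Z μ) :
    extExp μ Z = ((∫ ω, Z ω ∂μ : ℝ) : EReal) := by
  have h1 : ∫⁻ ω, ENNReal.ofReal (Z ω) ∂μ ≠ ⊤ :=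
    ((lintegral_mono fun ω => Real.ofReal_le_enorm _).trans_lt hZ.2).ne
  have h2 : ∫⁻ ω, ENNReal.ofReal (-Z ω) ∂μ ≠ ⊤ :=
    ((lintegral_mono fun ω => Real.ofReal_le_enorm _).trans_lt hZ.neg.2).ne
  rw [extExp, coe_ennreal_sub_coe_ennreal h1 h2,
    integral_eq_lintegral_pos_part_sub_lintegral_neg_part hZ]

/-- An infinite negative part always gives ⊥, as ⊤ - ⊤ = ⊥; with a finite negative part, an infinite
positive part gives ⊤. So a real value excludes both. -/
lemma integrable_of_extExp {μ : Measure Ω} {Z : Ω → ℝ} (hm : AEStronglyMeasurable Z μ)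
    (h1 : extExp μ Z ≠ ⊤) (h2 : extExp μ Z ≠ ⊥) : Integrable Z μ := by
  rw [extExp] at h1 h2
  set a := ∫⁻ ω, ENNReal.ofReal (Z ω) ∂μ with ha
  set b := ∫⁻ ω, ENNReal.ofReal (-Z ω) ∂μ with hb
  have hb' : b ≠ ⊤ := by
    intro h
    rw [h] at h2
    exact h2 (by simp)
  have ha' : a ≠ ⊤ := by
    intro h
    rw [h] at h1
    rw [← ENNReal.coe_toNNReal hb'] at h1
    exact h1 (EReal.top_sub_coe _)
  refine ⟨hm, ?_⟩
  have : ∀ ω, ‖Z ω‖ₑ ≤ ENNReal.ofReal (Z ω) + ENNReal.ofReal (-Z ω) := fun ω => by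
    rcases le_total 0 (Z ω) with h | h
    · rw [Real.enorm_of_nonneg h]
      exact le_self_add
    · rw [← enorm_neg, Real.enorm_of_nonneg (neg_nonneg.2 h)]
      exact le_add_self
  refine (lintegral_mono this).trans_lt ?_
  rw [lintegral_add_left' hm.aemeasurable.ennreal_ofReal]
  exact ENNReal.add_lt_top.2 ⟨ha'.lt_top, hb'.lt_top⟩

lemma integral_timeSet_sub {U : WithTop ℝ≥0} {g₁ g₂ : ℝ≥0 → ℝ} (h₁ : Measurable g₁)
    (h₂ : Measurable g₂) (n₁ : ∀ t, 0 ≤ g₁ t) (n₂ : ∀ t, 0 ≤ g₂ t)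
    (f₁ : timeLIntegral U (fun t => ENNReal.ofReal (g₁ t)) ≠ ⊤)
    (f₂ : timeLIntegral U (fun t => ENNReal.ofReal (g₂ t)) ≠ ⊤) :
    ∫ s in timeSet U, (g₂ s.toNNReal - g₁ s.toNNReal) =
      (timeLIntegral U fun t => ENNReal.ofReal (g₂ t)).toReal -
        (timeLIntegral U fun t => ENNReal.ofReal (g₁ t)).toReal := by
  have key : ∀ g : ℝ≥0 → ℝ, Measurable g → (∀ t, 0 ≤ g t) →
      timeLIntegral U (fun t => ENNReal.ofReal (g t)) ≠ ⊤ →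
      IntegrableOn (fun s : ℝ => g s.toNNReal) (timeSet U) ∧
      ∫ s in timeSet U, g s.toNNReal = (timeLIntegral U fun t => ENNReal.ofReal (g t)).toReal := by
    intro g hg hn hf
    have hm : AEStronglyMeasurable (fun s : ℝ => g s.toNNReal) (volume.restrict (timeSet U)) :=
      (hg.comp measurable_real_toNNReal).aestronglyMeasurable
    refine ⟨⟨hm, ?_⟩, integral_eq_lintegral_of_nonneg_ae (Eventually.of_forall fun s => hn _) hm⟩
    rw [hasFiniteIntegral_iff_ofReal (Eventually.of_forall fun s => hn _)]
    exact hf.lt_top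
  obtain ⟨i₁, e₁⟩ := key g₁ h₁ n₁ f₁
  obtain ⟨i₂, e₂⟩ := key g₂ h₂ n₂ f₂
  rw [integral_sub i₂ i₁, e₁, e₂]

/-! ### Functionals of the path -/

/-- The integral `∫_0^U φ(sup_{r ≤ t} w_r) dt` for nonnegative `φ`. -/
def supIntegral (U : WithTop ℝ≥0) (φ : ℝ → ℝ) (w : RegularPath) : ℝ≥0∞ :=
  timeLIntegral U fun t => ENNReal.ofReal (φ (runningSup coord t w))

/-- The integral `∫_0^U φ(w_t) dt` for nonnegative `φ`. -/
def stateIntegral (U : WithTop ℝ≥0) (φ : ℝ → ℝ) (w : RegularPath) : ℝ≥0∞ :=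
  timeLIntegral U fun t => ENNReal.ofReal (φ (w.1 t))

lemma measurable_runningSup_time (w : RegularPath) : Measurable fun t => runningSup coord t w :=
  measurable_runningSup.comp (measurable_const.prodMk measurable_id)

lemma measurable_path (w : RegularPath) : Measurable w.1 :=
  measurable_eval.comp (measurable_const.prodMk measurable_id)

lemma measurable_supIntegral {α : Type*} [MeasurableSpace α] {U : α → WithTop ℝ≥0}
    (hU : Measurable U) {φ : ℝ → ℝ} (hφ : Measurable φ) {w : α → RegularPath} (hw : Measurable w) :
    Measurable fun a => supIntegral (U a) φ (w a) :=
  measurable_timeLIntegral hU (hφ.comp (measurable_runningSup.comp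
    ((hw.comp measurable_fst).prodMk measurable_snd))).ennreal_ofReal

lemma measurable_stateIntegral {α : Type*} [MeasurableSpace α] {U : α → WithTop ℝ≥0}
    (hU : Measurable U) {φ : ℝ → ℝ} (hφ : Measurable φ) {w : α → RegularPath} (hw : Measurable w) :
    Measurable fun a => stateIntegral (U a) φ (w a) :=
  measurable_timeLIntegral hU (hφ.comp (measurable_eval.comp
    ((hw.comp measurable_fst).prodMk measurable_snd))).ennreal_ofReal

lemma supIntegral_add {U : WithTop ℝ≥0} {φ ψ : ℝ → ℝ} (hφ : Measurable φ) (nφ : ∀ m, 0 ≤ φ m)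
    (nψ : ∀ m, 0 ≤ ψ m) (w : RegularPath) :
    supIntegral U (fun m => φ m + ψ m) w = supIntegral U φ w + supIntegral U ψ w := by
  refine (timeLIntegral_congr fun t _ => ENNReal.ofReal_add (nφ _) (nψ _)).trans ?_
  exact timeLIntegral_add (hφ.comp (measurable_runningSup_time w)).ennreal_ofReal

lemma supIntegral_const (U : WithTop ℝ≥0) (c : ℝ) (w : RegularPath) :
    supIntegral U (fun _ => c) w = ENNReal.ofReal c * timeToENNReal U :=
  timeLIntegral_const U _

/-- If `φ` vanishes on `[y, ∞)`, only the time before the threshold time of `y` counts. -/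
lemma supIntegral_top_eq {φ : ℝ → ℝ} {y : ℝ} (h : ∀ m, y ≤ m → φ m = 0) {w : RegularPath}
    (hw : w ∈ reachingPaths y) : supIntegral ⊤ φ w = supIntegral (announcedTime y w) φ w := by
  rw [← thresholdTime_of_mem_reachingPaths hw]
  cases hT : thresholdTime coord y w with
  | top => rfl
  | coe s =>
    have h1 := timeLIntegral_coe_add s ⊤ fun t => ENNReal.ofReal (φ (runningSup coord t w))
    rw [add_top] at h1
    rw [supIntegral, h1, supIntegral]
    have : timeLIntegral ⊤ (fun t => ENNReal.ofReal (φ (runningSup coord (s + t) w))) =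
        timeLIntegral ⊤ fun _ => 0 := by
      refine timeLIntegral_congr fun t _ => ?_
      rw [h _ (le_runningSup_of_thresholdTime_le (hT.trans_le (WithTop.coe_le_coe.2 le_self_add))),
        ENNReal.ofReal_zero]
    rw [this, timeLIntegral_zero_fun, add_zero]

end

section

/-! ### The maximum representation in terms of nonnegative integrals -/

/-- A decomposition `f + ρ = p + q - r` into a nonincreasing part `p` and a bounded part `r`, both
vanishing on `[c, ∞)`, and a nondecreasing part `q`, all nonnegative. -/
structure GainDecomposition (f : ℝ → ℝ) (ρ c : ℝ) (p q r : ℝ → ℝ) : Prop where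
  antitone_left : Antitone p
  left_nonneg : ∀ m, 0 ≤ p m
  left_zero : ∀ m, c ≤ m → p m = 0
  monotone_right : Monotone q
  right_nonneg : ∀ m, 0 ≤ q m
  measurable_mid : Measurable r
  mid_nonneg : ∀ m, 0 ≤ r m
  mid_zero : ∀ m, c ≤ m → r m = 0
  mid_le : ∃ C, ∀ m, r m ≤ C
  eq : ∀ m, f m = p m + q m - r m - ρ

/-- The excess `γ(w_T) - γ(x)` of the payoff at the time `T` at which `y` is reached. -/
def endExcess (γ : ℝ → ℝ) (x y : ℝ) (w : RegularPath) : ℝ≥0∞ :=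
  ENNReal.ofReal (γ (w.1 (announcedTime y w).untopA) - γ x)

lemma measurable_endExcess {γ : ℝ → ℝ} (hγ : Measurable γ) (x y : ℝ) :
    Measurable (endExcess γ x y) :=
  ((hγ.comp (measurable_eval.comp (measurable_id.prodMk
    (measurable_announcedTime y).untopA))).sub_const _).ennreal_ofReal

lemma announcedTime_eq_zero {y : ℝ} {w : RegularPath} (h : y ≤ w.1 0) : announcedTime y w = 0 :=
  le_antisymm ((announcedTime_le y w).trans (thresholdTime_le h)) zero_le

variable {Ω : Type*} [mΩ : MeasurableSpace Ω] {𝓕 : Filtration ℝ≥0 mΩ} {P : ℝ → Measure Ω}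
  {X : ℝ≥0 → Ω → ℝ}

lemma extExp_congr {μ : Measure Ω} {Z Z' : Ω → ℝ} (hZ : Z =ᵐ[μ] Z') :
    extExp μ Z = extExp μ Z' := by
  rw [extExp, extExp, lintegral_congr_ae (hZ.mono fun ω hω => congrArg ENNReal.ofReal hω),
    lintegral_congr_ae (hZ.mono fun ω hω => congrArg (fun a => ENNReal.ofReal (-a)) hω)]

/-- Before y is reached the running supremum stays between the starting point and y, so only bounds
on that interval matter. -/
lemma supIntegral_le_of_reachingPaths {φ : ℝ → ℝ} {y C : ℝ} {w : RegularPath}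
    (hw : w ∈ reachingPaths y) (h : ∀ m, w.1 0 ≤ m → m ≤ y → φ m ≤ C) :
    supIntegral (announcedTime y w) φ w ≤
      ENNReal.ofReal C * timeToENNReal (announcedTime y w) := by
  rw [← timeLIntegral_const]
  refine timeLIntegral_mono le_rfl fun t ht => ENNReal.ofReal_le_ofReal (h _ ?_ ?_)
  · exact le_runningSup w zero_le
  · rw [← thresholdTime_of_mem_reachingPaths hw] at ht
    exact runningSup_le_of_lt_thresholdTime ht

lemma IsLevyFamily.lintegral_announcedTime_lt_top (hX : IsLevyFamily 𝓕 P X)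
    (hreg : ∀ ω, IsRegularPath fun t => X t ω) (y z : ℝ) :
    ∫⁻ ω, timeToENNReal (announcedTime y (pathMap X hreg ω)) ∂P z < ⊤ :=
  (lintegral_mono fun _ => timeToENNReal_mono (announcedTime_le y _)).trans_lt
    (hX.thresholdTime_finite_mean z y).1

lemma IsLevyFamily.lintegral_stateIntegral_lt_top (hX : IsLevyFamily 𝓕 P X)
    (hreg : ∀ ω, IsRegularPath fun t => X t ω) {γ h : ℝ → ℝ} (hγh : PayoffCostAssumption P X γ h)
    (y z : ℝ) :
    ∫⁻ ω, stateIntegral (announcedTime y (pathMap X hreg ω)) h (pathMap X hreg ω) ∂P z < ⊤ := by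
  rcases lt_or_ge z y with hzy | hyz
  -- The assumption on the cost covers only starting points below y; from y on the time interval is
  -- empty.
  · exact (lintegral_mono fun ω => timeLIntegral_mono (announcedTime_le y _)
      fun t _ => le_rfl).trans_lt (hγh.cost_lt_top z y hzy)
  · have : ∀ᵐ ω ∂P z, stateIntegral (announcedTime y (pathMap X hreg ω)) h (pathMap X hreg ω) =
        (fun _ => 0) ω := by
      filter_upwards [hX.start z] with ω hω
      rw [announcedTime_eq_zero (show y ≤ X 0 ω by rw [hω]; exact hyz)]
      exact timeLIntegral_zero _
    rw [lintegral_congr_ae this]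
    simp

/-- The maximum representation from z up to level y, rearranged so that every term is nonnegative:
r, ρ⁺ and h on one side, p, q and ρ⁻ on the other. Subtracting γ(x) with x ≤ z makes the payoff
terms nonnegative as well. Since p and r vanish from c ≤ y on, their integrals may run over all time
and no longer depend on y. -/
theorem IsLevyFamily.lintegral_representation (hX : IsLevyFamily 𝓕 P X)
    (hreg : ∀ ω, IsRegularPath fun t => X t ω) {γ h f : ℝ → ℝ}
    (hγh : PayoffCostAssumption P X γ h) (hrep : MaxRepresentation P X γ h f) {ρ c : ℝ}
    {p q r : ℝ → ℝ} (hd : GainDecomposition f ρ c p q r) {x y z : ℝ} (hcy : c ≤ y) (hxz : x ≤ z) :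
    ENNReal.ofReal (γ z - γ x) + (∫⁻ ω, supIntegral ⊤ r (pathMap X hreg ω) ∂P z +
      ENNReal.ofReal ρ * ∫⁻ ω, timeToENNReal (announcedTime y (pathMap X hreg ω)) ∂P z +
      ∫⁻ ω, stateIntegral (announcedTime y (pathMap X hreg ω)) h (pathMap X hreg ω) ∂P z) =
    ∫⁻ ω, supIntegral ⊤ p (pathMap X hreg ω) ∂P z +
      ∫⁻ ω, supIntegral (announcedTime y (pathMap X hreg ω)) q (pathMap X hreg ω) ∂P z +
      ENNReal.ofReal (-ρ) * ∫⁻ ω, timeToENNReal (announcedTime y (pathMap X hreg ω)) ∂P z +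
      ∫⁻ ω, endExcess γ x y (pathMap X hreg ω) ∂P z := by
  have := hX.isProbabilityMeasure z
  have hp := measurable_pathMap hX.measurable hreg
  have hT : Measurable fun ω => announcedTime y (pathMap X hreg ω) :=
    (measurable_announcedTime y).comp hp
  have hpm := hd.antitone_left.measurable
  have hqm := hd.monotone_right.measurable
  have hrm := hd.measurable_mid
  have hreach := hX.ae_mem_reachingPaths hreg y z
  -- Started at or above y, the threshold time is 0 and only the payoff terms survive. The case is
  -- needed because X_κ may overshoot y.
  rcases le_or_gt y z with hyz | hzy
  · have h0 : ∀ᵐ ω ∂P z, X 0 ω = z ∧ announcedTime y (pathMap X hreg ω) = 0 := by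
      filter_upwards [hX.start z] with ω hω
      exact ⟨hω, announcedTime_eq_zero (show y ≤ X 0 ω by rw [hω]; exact hyz)⟩
    have e0 : ∀ {F : Ω → ℝ≥0∞}, (∀ᵐ ω ∂P z, F ω = (fun _ => 0) ω) → ∫⁻ ω, F ω ∂P z = 0 :=
      fun {F} hF => by rw [lintegral_congr_ae hF]; simp
    rw [e0 (F := fun ω => supIntegral ⊤ r (pathMap X hreg ω)),
      e0 (F := fun ω => supIntegral ⊤ p (pathMap X hreg ω)),
      e0 (F := fun ω => timeToENNReal (announcedTime y (pathMap X hreg ω))),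
      e0 (F := fun ω => stateIntegral (announcedTime y (pathMap X hreg ω)) h (pathMap X hreg ω)),
      e0 (F := fun ω => supIntegral (announcedTime y (pathMap X hreg ω)) q (pathMap X hreg ω)),
      lintegral_congr_ae (g := fun _ => ENNReal.ofReal (γ z - γ x)) (μ := P z)
        (f := fun ω => endExcess γ x y (pathMap X hreg ω))]
    · simp
    · filter_upwards [h0] with ω hω
      rw [endExcess, hω.2]
      exact congrArg (fun a => ENNReal.ofReal (γ a - γ x)) hω.1
    · filter_upwards [h0] with ω hω
      rw [hω.2]
      exact timeLIntegral_zero _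
    · filter_upwards [h0] with ω hω
      rw [hω.2]
      exact timeLIntegral_zero _
    · filter_upwards [h0] with ω hω
      rw [hω.2]
      rfl
    · filter_upwards [h0, hreach] with ω hω hω'
      rw [supIntegral_top_eq (fun m hm => hd.left_zero m (hcy.trans hm)) hω', hω.2]
      exact timeLIntegral_zero _
    · filter_upwards [h0, hreach] with ω hω hω'
      rw [supIntegral_top_eq (fun m hm => hd.mid_zero m (hcy.trans hm)) hω', hω.2]
      exact timeLIntegral_zero _
  set ET := ∫⁻ ω, timeToENNReal (announcedTime y (pathMap X hreg ω)) ∂P z with hET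
  have hETfin : ET < ⊤ := hX.lintegral_announcedTime_lt_top hreg y z
  have hTm : Measurable fun ω => timeToENNReal (announcedTime y (pathMap X hreg ω)) :=
    measurable_timeToENNReal.comp hT
  set φ₁ : ℝ → ℝ := fun m => r m + max ρ 0 with hφ₁
  set φ₂ : ℝ → ℝ := fun m => p m + q m + max (-ρ) 0 with hφ₂
  have hf : f = fun m => φ₂ m - φ₁ m := by
    funext m
    rw [hd.eq m, hφ₁, hφ₂]
    rcases le_total 0 ρ with h | h
    · simp only [max_eq_left h, max_eq_right (neg_nonpos.2 h)]; ring
    · simp only [max_eq_right h, max_eq_left (neg_nonneg.2 h)]; ring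
  have hφ₁m : Measurable φ₁ := hrm.add_const _
  have hφ₂m : Measurable φ₂ := (hpm.add hqm).add_const _
  have hφ₁n : ∀ m, 0 ≤ φ₁ m := fun m => add_nonneg (hd.mid_nonneg m) (le_max_right _ _)
  have hφ₂n : ∀ m, 0 ≤ φ₂ m := fun m =>
    add_nonneg (add_nonneg (hd.left_nonneg m) (hd.right_nonneg m)) (le_max_right _ _)
  set S₁ : Ω → ℝ≥0∞ := fun ω =>
    supIntegral (announcedTime y (pathMap X hreg ω)) φ₁ (pathMap X hreg ω) with hS₁
  set S₂ : Ω → ℝ≥0∞ := fun ω =>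
    supIntegral (announcedTime y (pathMap X hreg ω)) φ₂ (pathMap X hreg ω) with hS₂
  set H : Ω → ℝ≥0∞ := fun ω =>
    stateIntegral (announcedTime y (pathMap X hreg ω)) h (pathMap X hreg ω) with hH
  have hS₁m : Measurable S₁ := measurable_supIntegral hT hφ₁m hp
  have hS₂m : Measurable S₂ := measurable_supIntegral hT hφ₂m hp
  have hHm : Measurable H := measurable_stateIntegral hT hγh.continuous.measurable hp
  have hmax : ∀ a : ℝ, ENNReal.ofReal (max a 0) = ENNReal.ofReal a := fun a => by
    rw [ENNReal.ofReal_max]; simp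
  have hS₁int : ∫⁻ ω, S₁ ω ∂P z =
      ∫⁻ ω, supIntegral ⊤ r (pathMap X hreg ω) ∂P z + ENNReal.ofReal ρ * ET := by
    rw [hET, ← lintegral_const_mul _ hTm,
      ← lintegral_add_left (measurable_supIntegral measurable_const hrm hp)]
    refine lintegral_congr_ae ?_
    filter_upwards [hreach] with ω hω
    rw [supIntegral_top_eq (fun m hm => hd.mid_zero m (hcy.trans hm)) hω, hS₁]
    refine (supIntegral_add hrm hd.mid_nonneg (fun _ => le_max_right _ _) _).trans ?_
    rw [supIntegral_const, hmax]
  have hS₂int : ∫⁻ ω, S₂ ω ∂P z = ∫⁻ ω, supIntegral ⊤ p (pathMap X hreg ω) ∂P z +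
      ∫⁻ ω, supIntegral (announcedTime y (pathMap X hreg ω)) q (pathMap X hreg ω) ∂P z +
      ENNReal.ofReal (-ρ) * ET := by
    have hpq : Measurable fun ω => supIntegral ⊤ p (pathMap X hreg ω) +
        supIntegral (announcedTime y (pathMap X hreg ω)) q (pathMap X hreg ω) :=
      (measurable_supIntegral measurable_const hpm hp).add (measurable_supIntegral hT hqm hp)
    rw [hET, ← lintegral_const_mul _ hTm,
      ← lintegral_add_left (measurable_supIntegral measurable_const hpm hp),
      ← lintegral_add_left hpq]
    refine lintegral_congr_ae ?_
    filter_upwards [hreach] with ω hω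
    rw [supIntegral_top_eq (fun m hm => hd.left_zero m (hcy.trans hm)) hω, hS₂]
    refine (supIntegral_add (hpm.add hqm)
      (fun m => add_nonneg (hd.left_nonneg m) (hd.right_nonneg m))
      (fun _ => le_max_right _ _) _).trans ?_
    rw [supIntegral_const, hmax]
    congr 1
    exact supIntegral_add hpm hd.left_nonneg hd.right_nonneg _
  have hfin : ∀ {φ : ℝ → ℝ} {C : ℝ}, (∀ m, z ≤ m → m ≤ y → φ m ≤ C) →
      ∫⁻ ω, supIntegral (announcedTime y (pathMap X hreg ω)) φ (pathMap X hreg ω) ∂P z ≠ ⊤ := by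
    intro φ C hC
    refine ne_of_lt (lt_of_le_of_lt (lintegral_mono_ae
      (g := fun ω => ENNReal.ofReal C * timeToENNReal (announcedTime y (pathMap X hreg ω))) ?_) ?_)
    · filter_upwards [hreach, hX.start z] with ω hω hω0
      refine supIntegral_le_of_reachingPaths hω fun m hm => hC m ?_
      rw [← hω0]
      exact hm
    · rw [lintegral_const_mul _ hTm]
      exact ENNReal.mul_lt_top ENNReal.ofReal_lt_top hETfin
  have hS₁fin : ∫⁻ ω, S₁ ω ∂P z ≠ ⊤ := by
    obtain ⟨C, hC⟩ := hd.mid_le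
    exact hfin (C := C + max ρ 0) fun m _ _ => add_le_add (hC m) le_rfl
  -- On [z, y] the functions p and q are bounded by p(z) and q(y), by monotonicity.
  have hS₂fin : ∫⁻ ω, S₂ ω ∂P z ≠ ⊤ :=
    hfin (C := p z + q y + max (-ρ) 0) fun m hm hmy =>
      add_le_add (add_le_add (hd.antitone_left hm) (hd.monotone_right hmy)) le_rfl
  have hHfin : ∫⁻ ω, H ω ∂P z ≠ ⊤ := (hX.lintegral_stateIntegral_lt_top hreg hγh y z).ne
  have hS₁ae := ae_lt_top hS₁m hS₁fin
  have hS₂ae := ae_lt_top hS₂m hS₂fin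
  have hHae := ae_lt_top hHm hHfin
  have hS₁i := integrable_toReal_of_lintegral_ne_top hS₁m.aemeasurable hS₁fin
  have hS₂i := integrable_toReal_of_lintegral_ne_top hS₂m.aemeasurable hS₂fin
  have hHi := integrable_toReal_of_lintegral_ne_top hHm.aemeasurable hHfin
  set Y : Ω → ℝ := fun ω =>
    γ ((pathMap X hreg ω).1 (announcedTime y (pathMap X hreg ω)).untopA) with hY
  have hYm : Measurable Y := hγh.monotone.measurable.comp
    (measurable_eval.comp (hp.prodMk hT.untopA))
  have hreach' : ∀ᵐ ω ∂P z, thresholdTime X y ω = announcedTime y (pathMap X hreg ω) := by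
    filter_upwards [hreach] with ω hω
    exact thresholdTime_of_mem_reachingPaths hω
  have hZa : timeIntegral f (runningSup X) (thresholdTime X y) =ᵐ[P z]
      fun ω => (S₂ ω).toReal - (S₁ ω).toReal := by
    filter_upwards [hreach', hS₁ae, hS₂ae] with ω hω h1 h2
    rw [timeIntegral, hω, hf]
    exact integral_timeSet_sub (U := announcedTime y (pathMap X hreg ω))
      (hφ₁m.comp (measurable_runningSup_time (pathMap X hreg ω)))
      (hφ₂m.comp (measurable_runningSup_time (pathMap X hreg ω)))
      (fun _ => hφ₁n _) (fun _ => hφ₂n _) h1.ne h2.ne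
  have hZb : (fun ω => γ (stoppedValue X (thresholdTime X y) ω) -
      timeIntegral h X (thresholdTime X y) ω) =ᵐ[P z] fun ω => Y ω - (H ω).toReal := by
    filter_upwards [hreach', hHae] with ω hω h1
    rw [timeIntegral, stoppedValue, hω]
    congr 1
    have h2 := integral_timeSet_sub (U := announcedTime y (pathMap X hreg ω)) (g₁ := fun _ => 0)
      measurable_const (hγh.continuous.measurable.comp (measurable_path (pathMap X hreg ω)))
      (fun _ => le_rfl) (fun _ => hγh.nonneg _) (by simp [timeLIntegral]) h1.ne
    simp only [sub_zero, ENNReal.ofReal_zero, timeLIntegral_zero_fun, ENNReal.toReal_zero] at h2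
    exact h2
  have hrepz := hrep z y hzy.le
  have hSi : Integrable (fun ω => (S₂ ω).toReal - (S₁ ω).toReal) (P z) := hS₂i.sub hS₁i
  rw [extExp_congr hZa, extExp_congr hZb, extExp_of_integrable hSi] at hrepz
  -- Integrability of the payoff is read off from the representation itself: γ(z) and the first
  -- expectation are real, hence so is the second.
  have hYH : Integrable (fun ω => Y ω - (H ω).toReal) (P z) := by
    refine integrable_of_extExp
      (hYm.sub hHm.ennreal_toReal).aestronglyMeasurable (fun h => ?_) (fun h => ?_)
    · rw [h, EReal.coe_add_top] at hrepz
      exact EReal.coe_ne_top _ hrepz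
    · rw [h, EReal.add_bot] at hrepz
      exact EReal.coe_ne_bot _ hrepz
  rw [extExp_of_integrable hYH, ← EReal.coe_add, EReal.coe_eq_coe_iff] at hrepz
  have hYi : Integrable Y (P z) := by
    have := hYH.add hHi
    refine this.congr (Eventually.of_forall fun ω => ?_)
    simp
  rw [integral_sub hS₂i hS₁i, integral_sub hYi hHi,
    integral_toReal hS₂m.aemeasurable hS₂ae, integral_toReal hS₁m.aemeasurable hS₁ae,
    integral_toReal hHm.aemeasurable hHae] at hrepz
  have hYx : ∀ᵐ ω ∂P z, 0 ≤ Y ω - γ x := by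
    filter_upwards [hreach] with ω hω
    exact sub_nonneg.2 (hγh.monotone (hxz.trans (hzy.le.trans hω.2)))
  have hG : ∫⁻ ω, endExcess γ x y (pathMap X hreg ω) ∂P z =
      ENNReal.ofReal (∫ ω, Y ω ∂P z - γ x) := by
    have h1 := ofReal_integral_eq_lintegral_ofReal (hYi.sub (integrable_const (γ x))) hYx
    have h2 : ∫ ω, (Y ω - γ x) ∂P z = ∫ ω, Y ω ∂P z - γ x := by
      rw [integral_sub hYi (integrable_const _)]
      simp
    rw [← h2]
    exact h1.symm
  have hGn : 0 ≤ ∫ ω, Y ω ∂P z - γ x := by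
    have h2 : ∫ ω, (Y ω - γ x) ∂P z = ∫ ω, Y ω ∂P z - γ x := by
      rw [integral_sub hYi (integrable_const _)]
      simp
    rw [← h2]
    exact integral_nonneg_of_ae hYx
  rw [← hS₁int, ← hS₂int, hG, ← ENNReal.ofReal_toReal hS₁fin, ← ENNReal.ofReal_toReal hS₂fin,
    ← ENNReal.ofReal_toReal hHfin, ← ENNReal.ofReal_add ENNReal.toReal_nonneg ENNReal.toReal_nonneg,
    ← ENNReal.ofReal_add (sub_nonneg.2 (hγh.monotone hxz))
      (add_nonneg ENNReal.toReal_nonneg ENNReal.toReal_nonneg),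
    ← ENNReal.ofReal_add ENNReal.toReal_nonneg hGn]
  congr 1
  linarith

end

section

/-! ### The upper bound for the expected gain -/

section Paths

variable {y : ℝ} {κ : ℝ≥0} {w : RegularPath}

lemma announcedTime_eq_add (hw : w ∈ reachingPaths y) (hκ : κ ≤ thresholdTime coord y w)
    (hs : shiftPath κ w ∈ reachingPaths y) :
    announcedTime y w = κ + announcedTime y (shiftPath κ w) := by
  rw [← thresholdTime_of_mem_reachingPaths hw, ← thresholdTime_of_mem_reachingPaths hs]
  exact thresholdTime_eq_add hκ

lemma endExcess_shiftPath (h : announcedTime y w = κ + announcedTime y (shiftPath κ w))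
    (hs : shiftPath κ w ∈ reachingPaths y) (γ : ℝ → ℝ) (x : ℝ) :
    endExcess γ x y (shiftPath κ w) = endExcess γ x y w := by
  cases hv : announcedTime y (shiftPath κ w) with
  | top => exact absurd hv hs.1
  | coe v =>
    rw [hv, ← WithTop.coe_add] at h
    rw [endExcess, endExcess, hv, h]
    rfl

/-- Forgetting the past can only lower the running supremum, and q is nondecreasing; the time before
κ is discarded. -/
lemma supIntegral_shiftPath_le (h : announcedTime y w = κ + announcedTime y (shiftPath κ w))
    {q : ℝ → ℝ} (hq : Monotone q) :
    supIntegral (announcedTime y (shiftPath κ w)) q (shiftPath κ w) ≤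
      supIntegral (announcedTime y w) q w := by
  rw [supIntegral, supIntegral, h, timeLIntegral_coe_add]
  exact (timeLIntegral_mono le_rfl fun t _ =>
    ENNReal.ofReal_le_ofReal (hq (runningSup_shiftPath_le κ t w))).trans le_add_self

lemma stateIntegral_eq_add (h : announcedTime y w = κ + announcedTime y (shiftPath κ w))
    (φ : ℝ → ℝ) :
    stateIntegral (announcedTime y w) φ w =
      stateIntegral κ φ w + stateIntegral (announcedTime y (shiftPath κ w)) φ (shiftPath κ w) := by
  rw [stateIntegral, h, timeLIntegral_coe_add]
  rfl

end Paths

variable {Ω : Type*} [mΩ : MeasurableSpace Ω] {𝓕 : Filtration ℝ≥0 mΩ} {P : ℝ → Measure Ω}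
  {X : ℝ≥0 → Ω → ℝ}

/-- By spatial homogeneity, a higher start translates the same path, and with it its running
supremum, upwards. -/
lemma IsLevyFamily.lintegral_supIntegral_antitone (hX : IsLevyFamily 𝓕 P X)
    (hreg : ∀ ω, IsRegularPath fun t => X t ω) {p : ℝ → ℝ} (hp : Antitone p) :
    Antitone fun z => ∫⁻ ω, supIntegral ⊤ p (pathMap X hreg ω) ∂P z := by
  intro x z hxz
  have hm : Measurable fun w => supIntegral ⊤ p w :=
    measurable_supIntegral measurable_const hp.measurable measurable_id
  simp only [hX.lintegral_path hreg _ hm]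
  refine lintegral_mono fun ω => timeLIntegral_mono le_rfl fun t _ =>
    ENNReal.ofReal_le_ofReal (hp ?_)
  rw [runningSup_translatePath, runningSup_translatePath]
  exact add_le_add hxz le_rfl

lemma lintegral_affine_eq {μ : Measure Ω} {A R T H F Q E : Ω → ℝ≥0∞} {a b : ℝ≥0∞}
    (hA : Measurable A) (hR : Measurable R) (hT : Measurable T) (hH : Measurable H)
    (hF : Measurable F) (hQ : Measurable Q)
    (h : ∀ᵐ ω ∂μ, A ω + (R ω + a * T ω + H ω) = F ω + Q ω + b * T ω + E ω) :
    ∫⁻ ω, A ω ∂μ + (∫⁻ ω, R ω ∂μ + a * ∫⁻ ω, T ω ∂μ + ∫⁻ ω, H ω ∂μ) =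
      ∫⁻ ω, F ω ∂μ + ∫⁻ ω, Q ω ∂μ + b * ∫⁻ ω, T ω ∂μ + ∫⁻ ω, E ω ∂μ := by
  have hFQ : Measurable fun ω => F ω + Q ω := hF.add hQ
  have hFQT : Measurable fun ω => F ω + Q ω + b * T ω := hFQ.add (hT.const_mul b)
  rw [← lintegral_const_mul _ hT, ← lintegral_const_mul _ hT, ← lintegral_add_left hR,
    ← lintegral_add_right _ hH, ← lintegral_add_left hA, ← lintegral_add_left hF,
    ← lintegral_add_left hFQ, ← lintegral_add_left hFQT]
  exact lintegral_congr_ae h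

/-- The core inequality. The representation averaged over the start X_κ (`hA`) is compared with the
one from x (`hB`): time and cost up to τ_y split at κ, the payoff at τ_y is the same, and the p- and
q-terms do not increase. What remains is the gain of κ. -/
theorem IsLevyFamily.gain_le_of_le_thresholdTime (hX : IsLevyFamily 𝓕 P X)
    (hreg : ∀ ω, IsRegularPath fun t => X t ω) {γ h f : ℝ → ℝ}
    (hγh : PayoffCostAssumption P X γ h) (hrep : MaxRepresentation P X γ h f) {ρ c : ℝ}
    {p q r : ℝ → ℝ} (hd : GainDecomposition f ρ c p q r) {x y : ℝ} (hcy : c ≤ y)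
    {κ : Ω → WithTop ℝ≥0} (hκ : IsStoppingTime 𝓕 κ)
    (hκy : ∀ᵐ ω ∂P x, κ ω ≤ thresholdTime X y ω) (hκx : ∀ᵐ ω ∂P x, x ≤ stoppedValue X κ ω) :
    ∫⁻ ω, ENNReal.ofReal (γ (stoppedValue X κ ω) - γ x) ∂P x +
        ENNReal.ofReal (-ρ) * expectedTime (P x) κ ≤
      ∫⁻ ω, supIntegral ⊤ r (pathMap X hreg ω) ∂P x + ENNReal.ofReal ρ * expectedTime (P x) κ +
        ∫⁻ ω, stateIntegral (κ ω) h (pathMap X hreg ω) ∂P x := by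
  have hpm := measurable_pathMap hX.measurable hreg
  have hκm : Measurable κ := hκ.measurable'
  have hθm := measurable_pathAfter hX.measurable hreg hκm
  have hfin : ∀ᵐ ω ∂P x, κ ω ≠ ⊤ := by
    filter_upwards [hκy, (hX.thresholdTime_finite_mean x y).2] with ω h1 h2
    exact ne_top_of_le_ne_top h2 h1
  have hSM := fun {F : RegularPath → ℝ≥0∞} (hF : Measurable F) => hX.strongMarkov hreg hκ hfin hF
  have hγm := hγh.monotone.measurable
  have hTm : Measurable fun w => timeToENNReal (announcedTime y w) :=
    measurable_timeToENNReal.comp (measurable_announcedTime y)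
  have hrm : Measurable fun w => supIntegral ⊤ r w :=
    measurable_supIntegral measurable_const hd.measurable_mid measurable_id
  have hprm : Measurable fun w => supIntegral ⊤ p w :=
    measurable_supIntegral measurable_const hd.antitone_left.measurable measurable_id
  have hqm : Measurable fun w => supIntegral (announcedTime y w) q w :=
    measurable_supIntegral (measurable_announcedTime y) hd.monotone_right.measurable measurable_id
  have hhm : Measurable fun w => stateIntegral (announcedTime y w) h w :=
    measurable_stateIntegral (measurable_announcedTime y) hγh.continuous.measurable measurable_id
  have hem := measurable_endExcess hγm x y
  have hsm := measurable_stoppedValue_of_regular hX.measurable hreg hκm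
  -- the representation started in `X_κ`
  have hA : ∫⁻ ω, ENNReal.ofReal (γ (stoppedValue X κ ω) - γ x) ∂P x +
      (∫⁻ ω, supIntegral ⊤ r (pathAfter X hreg κ ω) ∂P x +
      ENNReal.ofReal ρ * ∫⁻ ω, timeToENNReal (announcedTime y (pathAfter X hreg κ ω)) ∂P x +
      ∫⁻ ω, stateIntegral (announcedTime y (pathAfter X hreg κ ω)) h (pathAfter X hreg κ ω) ∂P x) =
    ∫⁻ ω, (∫⁻ ω', supIntegral ⊤ p (pathMap X hreg ω') ∂P (stoppedValue X κ ω)) ∂P x +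
      ∫⁻ ω, supIntegral (announcedTime y (pathAfter X hreg κ ω)) q (pathAfter X hreg κ ω) ∂P x +
      ENNReal.ofReal (-ρ) * ∫⁻ ω, timeToENNReal (announcedTime y (pathAfter X hreg κ ω)) ∂P x +
      ∫⁻ ω, endExcess γ x y (pathAfter X hreg κ ω) ∂P x := by
    have m1 := (hX.measurable_lintegral_path hreg hrm).comp hsm
    have m2 := (hX.measurable_lintegral_path hreg hTm).comp hsm
    have m3 := (hX.measurable_lintegral_path hreg hqm).comp hsm
    have m4 := (hX.measurable_lintegral_path hreg hprm).comp hsm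
    have m5 : Measurable fun ω => ENNReal.ofReal (γ (stoppedValue X κ ω) - γ x) :=
      ((hγm.comp hsm).sub_const _).ennreal_ofReal
    have m6 := (hX.measurable_lintegral_path hreg hhm).comp hsm
    rw [hSM hrm, hSM hTm, hSM hqm, hSM hhm, hSM hem]
    refine lintegral_affine_eq m5 m1 m2 m6 m4 m3 ?_
    filter_upwards [hκx] with ω hω
    exact hX.lintegral_representation hreg hγh hrep hd hcy hω
  have hB := hX.lintegral_representation hreg hγh hrep hd hcy (le_refl x)
  rw [sub_self, ENNReal.ofReal_zero, zero_add] at hB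
  have hadd : ∀ᵐ ω ∂P x, announcedTime y (pathMap X hreg ω) =
      (κ ω).untopA + announcedTime y (pathAfter X hreg κ ω) ∧
      pathAfter X hreg κ ω ∈ reachingPaths y ∧ κ ω = (κ ω).untopA := by
    filter_upwards [hX.ae_mem_reachingPaths hreg y x,
      hX.ae_pathAfter_mem_reachingPaths hreg hκ hfin y, hfin, hκy] with ω h1 h2 h3 h4
    have h5 : κ ω = (κ ω).untopA := by
      obtain ⟨v, hv⟩ := WithTop.ne_top_iff_exists.1 h3
      rw [← hv]
      rfl
    refine ⟨announcedTime_eq_add h1 ?_ h2, h2, h5⟩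
    rw [← h5]
    exact h4
  have hT : ∫⁻ ω, timeToENNReal (announcedTime y (pathMap X hreg ω)) ∂P x =
      expectedTime (P x) κ +
        ∫⁻ ω, timeToENNReal (announcedTime y (pathAfter X hreg κ ω)) ∂P x := by
    rw [expectedTime, ← lintegral_add_left (f := fun ω => timeToENNReal (κ ω))
      (measurable_timeToENNReal.comp hκm)]
    refine lintegral_congr_ae ?_
    filter_upwards [hadd] with ω hω
    rw [hω.1, timeToENNReal_coe_add, ← timeToENNReal_coe, ← hω.2.2]
  have hH : ∫⁻ ω, stateIntegral (announcedTime y (pathMap X hreg ω)) h (pathMap X hreg ω) ∂P x =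
      ∫⁻ ω, stateIntegral (κ ω) h (pathMap X hreg ω) ∂P x +
      ∫⁻ ω, stateIntegral (announcedTime y (pathAfter X hreg κ ω)) h (pathAfter X hreg κ ω) ∂P x := by
    rw [← lintegral_add_left (measurable_stateIntegral hκm hγh.continuous.measurable hpm)]
    refine lintegral_congr_ae ?_
    filter_upwards [hadd] with ω hω
    rw [stateIntegral_eq_add hω.1, ← hω.2.2]
    rfl
  have hE : ∫⁻ ω, endExcess γ x y (pathAfter X hreg κ ω) ∂P x =
      ∫⁻ ω, endExcess γ x y (pathMap X hreg ω) ∂P x := by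
    refine lintegral_congr_ae ?_
    filter_upwards [hadd] with ω hω
    exact endExcess_shiftPath hω.1 hω.2.1 γ x
  have hQ : ∫⁻ ω, supIntegral (announcedTime y (pathAfter X hreg κ ω)) q
        (pathAfter X hreg κ ω) ∂P x ≤
      ∫⁻ ω, supIntegral (announcedTime y (pathMap X hreg ω)) q (pathMap X hreg ω) ∂P x := by
    refine lintegral_mono_ae ?_
    filter_upwards [hadd] with ω hω
    exact supIntegral_shiftPath_le hω.1 hd.monotone_right
  have hPi : ∫⁻ ω, (∫⁻ ω', supIntegral ⊤ p (pathMap X hreg ω') ∂P (stoppedValue X κ ω)) ∂P x ≤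
      ∫⁻ ω, supIntegral ⊤ p (pathMap X hreg ω) ∂P x := by
    have := hX.isProbabilityMeasure x
    refine (lintegral_mono_ae (g := fun _ => ∫⁻ ω, supIntegral ⊤ p (pathMap X hreg ω) ∂P x)
      ?_).trans (by simp)
    filter_upwards [hκx] with ω hω
    exact hX.lintegral_supIntegral_antitone hreg hd.antitone_left hω
  have hTfin := hX.lintegral_announcedTime_lt_top hreg y x
  have hHfin := hX.lintegral_stateIntegral_lt_top hreg hγh y x
  rw [hT] at hTfin hB
  rw [hH] at hHfin hB
  rw [hE] at hA
  generalize ∫⁻ ω, timeToENNReal (announcedTime y (pathAfter X hreg κ ω)) ∂P x = T at *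
  generalize ∫⁻ ω, stateIntegral (announcedTime y (pathAfter X hreg κ ω)) h
    (pathAfter X hreg κ ω) ∂P x = H at *
  have hfin' : ENNReal.ofReal ρ * T + H ≠ ⊤ :=
    ENNReal.add_ne_top.2 ⟨ENNReal.mul_ne_top ENNReal.ofReal_ne_top
      (ENNReal.add_ne_top.1 hTfin.ne).2, (ENNReal.add_ne_top.1 hHfin.ne).2⟩
  -- The remaining time and cost after κ occur on both sides and are cancelled; this is where their
  -- finiteness is needed.
  refine (ENNReal.add_le_add_iff_right hfin').1 ?_
  -- The nonnegative mean of R(X_κ), with R(z) the mean r-integral from z, is added here; it is the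
  -- slack in the bound.
  calc _ ≤ (∫⁻ ω, ENNReal.ofReal (γ (stoppedValue X κ ω) - γ x) ∂P x +
          (∫⁻ ω, supIntegral ⊤ r (pathAfter X hreg κ ω) ∂P x + ENNReal.ofReal ρ * T + H)) +
          ENNReal.ofReal (-ρ) * expectedTime (P x) κ := by
        rw [add_right_comm, add_assoc (∫⁻ ω, supIntegral ⊤ r (pathAfter X hreg κ ω) ∂P x)]
        exact add_le_add (add_le_add le_rfl le_add_self) le_rfl
    _ ≤ _ := by
        rw [hA]
        refine (add_le_add_left (add_le_add_left (add_le_add_left (add_le_add hPi hQ) _) _)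
          _).trans (le_of_eq ?_)
        refine Eq.trans ?_ (hB.symm.trans ?_)
        · ring
        · ring

end

/-! ### Localization to general stopping times, and equality for the threshold time -/

section

lemma le_stoppedValue_thresholdTime {Ω : Type*} {X : ℝ≥0 → Ω → ℝ}
    (hreg : ∀ ω, IsRegularPath fun t => X t ω) {y : ℝ} {ω : Ω}
    (h : thresholdTime X y ω ≠ ⊤) : y ≤ stoppedValue X (thresholdTime X y) ω := by
  obtain ⟨s, hs⟩ := WithTop.ne_top_iff_exists.1 h
  rw [stoppedValue, ← hs]
  exact le_coord_thresholdTime (w := pathMap X hreg ω) hs.symm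

/-- The path is bounded above on [0, τ], so high levels are not reached by then. -/
lemma eventually_min_thresholdTime_eq {Ω : Type*} {X : ℝ≥0 → Ω → ℝ}
    (hreg : ∀ ω, IsRegularPath fun t => X t ω)
    {τ : Ω → WithTop ℝ≥0} {ω : Ω} (h : τ ω ≠ ⊤) (b : ℝ) :
    ∀ᶠ n : ℕ in atTop, min (τ ω) (thresholdTime X (b + n) ω) = τ ω := by
  obtain ⟨t, ht⟩ := WithTop.ne_top_iff_exists.1 h
  obtain ⟨n₀, hn₀⟩ := exists_nat_gt (runningSup coord t (pathMap X hreg ω) - b)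
  filter_upwards [eventually_ge_atTop n₀] with n hn
  have hn' : (n₀ : ℝ) ≤ n := Nat.cast_le.2 hn
  refine min_eq_left (not_lt.1 fun hlt => ?_)
  rw [← ht] at hlt
  have := le_runningSup_of_thresholdTime_le (w := pathMap X hreg ω) (y := b + n) hlt.le
  linarith

variable {Ω : Type*} [mΩ : MeasurableSpace Ω] {𝓕 : Filtration ℝ≥0 mΩ} {P : ℝ → Measure Ω}
  {X : ℝ≥0 → Ω → ℝ}

/-- Localize by κ_n = τ ∧ τ_{y_n} with y_n → ∞. The upper bound for κ_n is monotone in the time and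
so is at most the one for τ; on the left, Fatou's lemma applies to integrands that are a.s.
eventually equal to their limit. -/
theorem IsLevyFamily.lintegral_gain_le (hX : IsLevyFamily 𝓕 P X)
    (hreg : ∀ ω, IsRegularPath fun t => X t ω) {γ h f : ℝ → ℝ}
    (hγh : PayoffCostAssumption P X γ h) (hrep : MaxRepresentation P X γ h f) {ρ c : ℝ}
    {p q r : ℝ → ℝ} (hd : GainDecomposition f ρ c p q r) {x : ℝ}
    {τ : Ω → WithTop ℝ≥0} (hτ : IsStoppingTime 𝓕 τ) (hfin : ∀ᵐ ω ∂P x, τ ω ≠ ⊤)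
    (hτx : ∀ᵐ ω ∂P x, x ≤ stoppedValue X τ ω) :
    ∫⁻ ω, ENNReal.ofReal (γ (stoppedValue X τ ω) - γ x) ∂P x +
        ENNReal.ofReal (-ρ) * expectedTime (P x) τ ≤
      ∫⁻ ω, supIntegral ⊤ r (pathMap X hreg ω) ∂P x + ENNReal.ofReal ρ * expectedTime (P x) τ +
        ∫⁻ ω, stateIntegral (τ ω) h (pathMap X hreg ω) ∂P x := by
  have hγm := hγh.monotone.measurable
  -- Levels above c are required by the representation, and levels above x keep X_{κ_n} ≥ x.
  set y : ℕ → ℝ := fun n => max c x + n with hy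
  have hcy : ∀ n, c ≤ y n := fun n =>
    (le_max_left c x).trans (le_add_of_nonneg_right n.cast_nonneg)
  have hxy : ∀ n, x ≤ y n := fun n =>
    (le_max_right c x).trans (le_add_of_nonneg_right n.cast_nonneg)
  set κ : ℕ → Ω → WithTop ℝ≥0 := fun n ω => min (τ ω) (thresholdTime X (y n) ω) with hκ
  have hκs : ∀ n, IsStoppingTime 𝓕 (κ n) := fun n =>
    hτ.min (hX.isStoppingTime_thresholdTime hreg (y n))
  have hκx : ∀ n, ∀ᵐ ω ∂P x, x ≤ stoppedValue X (κ n) ω := fun n => by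
    filter_upwards [hτx, (hX.thresholdTime_finite_mean x (y n)).2] with ω h1 h2
    rcases min_choice (τ ω) (thresholdTime X (y n) ω) with h3 | h3
    · rw [stoppedValue, hκ]
      simp only [h3]
      exact h1
    · rw [stoppedValue, hκ]
      simp only [h3]
      exact (hxy n).trans (le_stoppedValue_thresholdTime hreg h2)
  have hm : ∀ {σ : Ω → WithTop ℝ≥0}, IsStoppingTime 𝓕 σ →
      Measurable (fun ω => ENNReal.ofReal (γ (stoppedValue X σ ω) - γ x)) ∧
        Measurable fun ω => timeToENNReal (σ ω) := fun {σ} hσ =>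
    ⟨((hγm.comp (measurable_stoppedValue_of_regular hX.measurable hreg
      hσ.measurable')).sub_const _).ennreal_ofReal, measurable_timeToENNReal.comp hσ.measurable'⟩
  have hsum : ∀ {σ : Ω → WithTop ℝ≥0}, IsStoppingTime 𝓕 σ →
      ∫⁻ ω, ENNReal.ofReal (γ (stoppedValue X σ ω) - γ x) ∂P x +
        ENNReal.ofReal (-ρ) * expectedTime (P x) σ =
      ∫⁻ ω, (ENNReal.ofReal (γ (stoppedValue X σ ω) - γ x) +
        ENNReal.ofReal (-ρ) * timeToENNReal (σ ω)) ∂P x := fun {σ} hσ => by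
    rw [lintegral_add_left (hm hσ).1, lintegral_const_mul _ (hm hσ).2]
    rfl
  set B := ∫⁻ ω, supIntegral ⊤ r (pathMap X hreg ω) ∂P x +
    ENNReal.ofReal ρ * expectedTime (P x) τ +
        ∫⁻ ω, stateIntegral (τ ω) h (pathMap X hreg ω) ∂P x
  have hbound : ∀ n, ∫⁻ ω, (ENNReal.ofReal (γ (stoppedValue X (κ n) ω) - γ x) +
      ENNReal.ofReal (-ρ) * timeToENNReal (κ n ω)) ∂P x ≤ B := fun n => by
    rw [← hsum (hκs n)]
    refine (hX.gain_le_of_le_thresholdTime hreg hγh hrep hd (hcy n) (hκs n)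
      (Eventually.of_forall fun ω => min_le_right _ _) (hκx n)).trans ?_
    refine add_le_add (add_le_add le_rfl (mul_le_mul_right (lintegral_mono fun ω =>
      timeToENNReal_mono (min_le_left _ _)) _)) (lintegral_mono fun ω => ?_)
    exact timeLIntegral_mono (min_le_left _ _) fun _ _ => le_rfl
  rw [hsum hτ]
  calc _ = ∫⁻ ω, liminf (fun n => ENNReal.ofReal (γ (stoppedValue X (κ n) ω) - γ x) +
        ENNReal.ofReal (-ρ) * timeToENNReal (κ n ω)) atTop ∂P x := by
        refine lintegral_congr_ae ?_
        filter_upwards [hfin] with ω hω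
        refine (Tendsto.liminf_eq (tendsto_const_nhds.congr' ?_)).symm
        filter_upwards [eventually_min_thresholdTime_eq hreg hω (max c x)] with n hn
        have hn' : κ n ω = τ ω := hn
        rw [stoppedValue, stoppedValue, hn']
    _ ≤ liminf (fun n => ∫⁻ ω, (ENNReal.ofReal (γ (stoppedValue X (κ n) ω) - γ x) +
        ENNReal.ofReal (-ρ) * timeToENNReal (κ n ω)) ∂P x) atTop :=
        lintegral_liminf_le fun n => (hm (hκs n)).1.add ((hm (hκs n)).2.const_mul _)
    _ ≤ B := (liminf_le_liminf (Eventually.of_forall hbound)).trans (by simp)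

lemma IsLevyFamily.lintegral_supIntegral_lt_top (hX : IsLevyFamily 𝓕 P X)
    (hreg : ∀ ω, IsRegularPath fun t => X t ω) {r : ℝ → ℝ} {c C : ℝ}
    (h0 : ∀ m, c ≤ m → r m = 0) (hC : ∀ m, r m ≤ C) (x : ℝ) :
    ∫⁻ ω, supIntegral ⊤ r (pathMap X hreg ω) ∂P x < ⊤ := by
  have hTm : Measurable fun ω => timeToENNReal (announcedTime c (pathMap X hreg ω)) :=
    measurable_timeToENNReal.comp
      ((measurable_announcedTime c).comp (measurable_pathMap hX.measurable hreg))
  refine lt_of_le_of_lt (lintegral_mono_ae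
    (g := fun ω => ENNReal.ofReal C * timeToENNReal (announcedTime c (pathMap X hreg ω))) ?_) ?_
  · filter_upwards [hX.ae_mem_reachingPaths hreg c x] with ω hω
    rw [supIntegral_top_eq h0 hω]
    exact supIntegral_le_of_reachingPaths hω fun m _ _ => hC m
  · rw [lintegral_const_mul _ hTm]
    exact ENNReal.mul_lt_top ENNReal.ofReal_lt_top (hX.lintegral_announcedTime_lt_top hreg c x)

lemma IsLevyFamily.ae_thresholdTime_eq (hX : IsLevyFamily 𝓕 P X)
    (hreg : ∀ ω, IsRegularPath fun t => X t ω) (y x : ℝ) :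
    ∀ᵐ ω ∂P x, thresholdTime X y ω = announcedTime y (pathMap X hreg ω) := by
  filter_upwards [hX.ae_mem_reachingPaths hreg y x] with ω hω
  exact thresholdTime_of_mem_reachingPaths hω

/-- Equality holds for the threshold time of `c` if the running supremum stays in the region where
`p` and `q` vanish. -/
theorem IsLevyFamily.lintegral_gain_thresholdTime (hX : IsLevyFamily 𝓕 P X)
    (hreg : ∀ ω, IsRegularPath fun t => X t ω) {γ h f : ℝ → ℝ}
    (hγh : PayoffCostAssumption P X γ h) (hrep : MaxRepresentation P X γ h f) {ρ c : ℝ}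
    {p q r : ℝ → ℝ} (hd : GainDecomposition f ρ c p q r) {x : ℝ}
    (hp : ∀ m, x ≤ m → p m = 0) (hq : ∀ m ≤ c, q m = 0) :
    ∫⁻ ω, ENNReal.ofReal (γ (stoppedValue X (thresholdTime X c) ω) - γ x) ∂P x +
        ENNReal.ofReal (-ρ) * expectedTime (P x) (thresholdTime X c) =
      ∫⁻ ω, supIntegral ⊤ r (pathMap X hreg ω) ∂P x +
        ENNReal.ofReal ρ * expectedTime (P x) (thresholdTime X c) +
        ∫⁻ ω, stateIntegral (thresholdTime X c ω) h (pathMap X hreg ω) ∂P x := by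
  have hB := hX.lintegral_representation hreg hγh hrep hd le_rfl (le_refl x)
  have heq := hX.ae_thresholdTime_eq hreg c x
  have h1 : ∫⁻ ω, supIntegral ⊤ p (pathMap X hreg ω) ∂P x = ∫⁻ _, 0 ∂P x := by
    refine lintegral_congr_ae ?_
    filter_upwards [hX.start x] with ω hω
    rw [← timeLIntegral_zero_fun ⊤]
    refine timeLIntegral_congr fun t _ => ?_
    rw [hp _ (le_trans ?_ (le_runningSup (pathMap X hreg ω) (zero_le (a := t)))), ENNReal.ofReal_zero]
    exact hω.ge
  have h2 : ∫⁻ ω, supIntegral (announcedTime c (pathMap X hreg ω)) q (pathMap X hreg ω) ∂P x =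
      ∫⁻ _, 0 ∂P x := by
    refine lintegral_congr_ae ?_
    filter_upwards [heq] with ω hω
    rw [← hω, ← timeLIntegral_zero_fun (thresholdTime X c ω)]
    refine timeLIntegral_congr fun t ht => ?_
    rw [hq _ (runningSup_le_of_lt_thresholdTime (w := pathMap X hreg ω) ht), ENNReal.ofReal_zero]
  have h3 : expectedTime (P x) (thresholdTime X c) =
      ∫⁻ ω, timeToENNReal (announcedTime c (pathMap X hreg ω)) ∂P x :=
    lintegral_congr_ae (heq.mono fun ω hω => congrArg timeToENNReal hω)
  have h4 : ∫⁻ ω, stateIntegral (thresholdTime X c ω) h (pathMap X hreg ω) ∂P x =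
      ∫⁻ ω, stateIntegral (announcedTime c (pathMap X hreg ω)) h (pathMap X hreg ω) ∂P x :=
    lintegral_congr_ae (heq.mono fun ω hω =>
      congrArg (fun U => stateIntegral U h (pathMap X hreg ω)) hω)
  have h5 : ∫⁻ ω, ENNReal.ofReal (γ (stoppedValue X (thresholdTime X c) ω) - γ x) ∂P x =
      ∫⁻ ω, endExcess γ x c (pathMap X hreg ω) ∂P x :=
    lintegral_congr_ae (heq.mono fun ω hω =>
      congrArg (fun U : WithTop ℝ≥0 => ENNReal.ofReal (γ (X U.untopA ω) - γ x)) hω)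
  rw [h1, h2, sub_self, ENNReal.ofReal_zero, lintegral_zero] at hB
  rw [h3, h4, h5]
  simp only [zero_add] at hB
  rw [hB, add_comm]

/-- The expected gain in terms of nonnegative integrals. -/
lemma IsLevyFamily.expectedGain_eq (hX : IsLevyFamily 𝓕 P X) (hreg : ∀ ω, IsRegularPath fun t => X t ω)
    {γ h : ℝ → ℝ} (hγh : PayoffCostAssumption P X γ h) {ρ x : ℝ} {τ : Ω → WithTop ℝ≥0}
    (hτ : IsStoppingTime 𝓕 τ) (hτx : ∀ᵐ ω ∂P x, x ≤ stoppedValue X τ ω)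
    (hT : expectedTime (P x) τ ≠ ⊤)
    (hH : ∫⁻ ω, stateIntegral (τ ω) h (pathMap X hreg ω) ∂P x ≠ ⊤)
    (hG : ∫⁻ ω, ENNReal.ofReal (γ (stoppedValue X τ ω) - γ x) ∂P x ≠ ⊤) :
    expectedGain P X γ h ρ x τ = ((γ x +
      (∫⁻ ω, ENNReal.ofReal (γ (stoppedValue X τ ω) - γ x) ∂P x).toReal -
      (∫⁻ ω, stateIntegral (τ ω) h (pathMap X hreg ω) ∂P x).toReal -
      ρ * (expectedTime (P x) τ).toReal : ℝ) : EReal) := by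
  have := hX.isProbabilityMeasure x
  have hτm : Measurable τ := hτ.measurable'
  have hp := measurable_pathMap hX.measurable hreg
  have hhm := hγh.continuous.measurable
  have hTm : Measurable fun ω => timeToENNReal (τ ω) := measurable_timeToENNReal.comp hτm
  have hHm : Measurable fun ω => stateIntegral (τ ω) h (pathMap X hreg ω) :=
    measurable_stateIntegral hτm hhm hp
  have hGm : Measurable fun ω => ENNReal.ofReal (γ (stoppedValue X τ ω) - γ x) :=
    ((hγh.monotone.measurable.comp
      (measurable_stoppedValue_of_regular hX.measurable hreg hτm)).sub_const _).ennreal_ofReal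
  have hTae := ae_lt_top hTm hT
  have hHae := ae_lt_top hHm hH
  have hTi := integrable_toReal_of_lintegral_ne_top hTm.aemeasurable hT
  have hHi := integrable_toReal_of_lintegral_ne_top hHm.aemeasurable hH
  have hGi := integrable_toReal_of_lintegral_ne_top hGm.aemeasurable hG
  -- As X_τ ≥ x and γ is nondecreasing, γ(X_τ) - γ(x) is nonnegative and survives the passage
  -- through `ENNReal.ofReal`.
  have hZ : (fun ω => γ (stoppedValue X τ ω) - timeIntegral (fun z => h z + ρ) X τ ω) =ᵐ[P x]
      fun ω => γ x + (ENNReal.ofReal (γ (stoppedValue X τ ω) - γ x)).toReal -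
        (stateIntegral (τ ω) h (pathMap X hreg ω)).toReal - ρ * (timeToENNReal (τ ω)).toReal := by
    filter_upwards [hτx, hTae, hHae] with ω h1 h2 h3
    have hwm := hhm.comp (measurable_path (pathMap X hreg ω))
    have e1 : timeLIntegral (τ ω) (fun t => ENNReal.ofReal (h (X t ω) + max ρ 0)) =
        stateIntegral (τ ω) h (pathMap X hreg ω) +
          ENNReal.ofReal (max ρ 0) * timeToENNReal (τ ω) := by
      rw [← timeLIntegral_const, stateIntegral]
      refine Eq.trans ?_ (timeLIntegral_add (f := fun t => ENNReal.ofReal (h (X t ω)))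
        hwm.ennreal_ofReal)
      exact timeLIntegral_congr fun t _ => ENNReal.ofReal_add (hγh.nonneg _) (le_max_right _ _)
    have e2 := timeLIntegral_const (τ ω) (ENNReal.ofReal (max (-ρ) 0))
    have f1 : ENNReal.ofReal (max ρ 0) * timeToENNReal (τ ω) ≠ ⊤ :=
      ENNReal.mul_ne_top ENNReal.ofReal_ne_top h2.ne
    have f2 : ENNReal.ofReal (max (-ρ) 0) * timeToENNReal (τ ω) ≠ ⊤ :=
      ENNReal.mul_ne_top ENNReal.ofReal_ne_top h2.ne
    have key := integral_timeSet_sub (U := τ ω) (g₁ := fun _ => max (-ρ) 0)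
      (g₂ := fun t => h (X t ω) + max ρ 0) measurable_const (hwm.add_const _)
      (fun _ => le_max_right _ _) (fun _ => add_nonneg (hγh.nonneg _) (le_max_right _ _))
      (by rw [e2]; exact f2) (by rw [e1]; exact ENNReal.add_ne_top.2 ⟨h3.ne, f1⟩)
    rw [e1, e2, ENNReal.toReal_add h3.ne f1, ENNReal.toReal_mul, ENNReal.toReal_mul,
      ENNReal.toReal_ofReal (le_max_right _ _), ENNReal.toReal_ofReal (le_max_right _ _)] at key
    have hρ : max ρ 0 - max (-ρ) 0 = ρ := by
      rcases le_total 0 ρ with h | h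
      · rw [max_eq_left h, max_eq_right (neg_nonpos.2 h), sub_zero]
      · rw [max_eq_right h, max_eq_left (neg_nonneg.2 h), zero_sub, neg_neg]
    have e3 : timeIntegral (fun z => h z + ρ) X τ ω =
        ∫ s in timeSet (τ ω), (h (X s.toNNReal ω) + max ρ 0 - max (-ρ) 0) := by
      refine integral_congr_ae (Eventually.of_forall fun s => ?_)
      show h (X s.toNNReal ω) + ρ = _
      linarith
    rw [e3, key, ENNReal.toReal_ofReal (sub_nonneg.2 (hγh.monotone h1))]
    have : ρ * (timeToENNReal (τ ω)).toReal = max ρ 0 * (timeToENNReal (τ ω)).toReal -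
        max (-ρ) 0 * (timeToENNReal (τ ω)).toReal := by rw [← sub_mul, hρ]
    linarith
  have i1 : Integrable (fun ω => γ x + (ENNReal.ofReal (γ (stoppedValue X τ ω) - γ x)).toReal)
      (P x) := (integrable_const _).add hGi
  have i2 : Integrable (fun ω => γ x + (ENNReal.ofReal (γ (stoppedValue X τ ω) - γ x)).toReal -
      (stateIntegral (τ ω) h (pathMap X hreg ω)).toReal) (P x) := i1.sub hHi
  have i3 : Integrable (fun ω => γ x + (ENNReal.ofReal (γ (stoppedValue X τ ω) - γ x)).toReal -
      (stateIntegral (τ ω) h (pathMap X hreg ω)).toReal - ρ * (timeToENNReal (τ ω)).toReal)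
      (P x) := i2.sub (hTi.const_mul ρ)
  rw [expectedGain, extExp_of_integrable (i3.congr hZ.symm), integral_congr_ae hZ,
    integral_sub i2 (hTi.const_mul ρ), integral_sub i1 hHi, integral_add (integrable_const _) hGi,
    integral_const_mul, integral_toReal hGm.aemeasurable (ae_lt_top hGm hG),
    integral_toReal hHm.aemeasurable hHae, integral_toReal hTm.aemeasurable hTae]
  simp [expectedTime]

end

/-! ### Decomposition of f + ρ, and the supremum after first passage -/

section

/-- Freezing the argument at a from above and from below splits f into a nonincreasing and a
nondecreasing function. -/
lemma IsUnimodal.measurable {f : ℝ → ℝ} (hf : IsUnimodal f) : Measurable f := by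
  obtain ⟨a, h1, h2⟩ := hf
  have e : f = fun m => f (min m a) + f (max m a) - f a := by
    funext m
    rcases le_total m a with h | h
    · rw [min_eq_left h, max_eq_right h]; ring
    · rw [min_eq_right h, max_eq_left h]; ring
  have m1 : Antitone fun m => f (min m a) := fun m m' h =>
    h1.antitoneOn (mem_Iic.2 (min_le_right _ _)) (mem_Iic.2 (min_le_right _ _))
      (min_le_min_right a h)
  have m2 : Monotone fun m => f (max m a) := fun m m' h =>
    h2.monotoneOn (mem_Ici.2 (le_max_right _ _)) (mem_Ici.2 (le_max_right _ _))
      (max_le_max_right a h)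
  rw [e]
  exact (m1.measurable.add m2.measurable).sub_const _

/-- The two roots lie on different sides of the minimizer a, since f is injective on each side. Thus
p and q are the restrictions of f + ρ to the outer half-lines, where it is nonnegative and monotone,
and r is its negative part, bounded by the value at a. -/
lemma IsUnimodal.exists_gainDecomposition {f : ℝ → ℝ} (hf : IsUnimodal f) {ρ xlo xhi : ℝ}
    (hlt : xlo < xhi) (hlo : f xlo + ρ = 0) (hhi : f xhi + ρ = 0) :
    ∃ p q r : ℝ → ℝ, GainDecomposition f ρ xhi p q r ∧ (∀ m, xlo ≤ m → p m = 0) ∧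
      (∀ m ≤ xhi, q m = 0) ∧ ∀ m ≤ xlo, r m = 0 := by
  have hfm := hf.measurable
  obtain ⟨a, h1, h2⟩ := hf
  have ha1 : xlo < a := not_le.1 fun h => by
    have := h2 (mem_Ici.2 h) (mem_Ici.2 (h.trans hlt.le)) hlt
    linarith
  have ha2 : a < xhi := not_le.1 fun h => by
    have := h1 (mem_Iic.2 (hlt.le.trans h)) (mem_Iic.2 h) hlt
    linarith
  have hl : ∀ m m', m ≤ m' → m' ≤ xlo → f m' ≤ f m := fun m m' h h' =>
    h1.antitoneOn (mem_Iic.2 ((h.trans h').trans ha1.le)) (mem_Iic.2 (h'.trans ha1.le)) h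
  have hr : ∀ m m', xhi ≤ m → m ≤ m' → f m ≤ f m' := fun m m' h h' =>
    h2.monotoneOn (mem_Ici.2 (ha2.le.trans h)) (mem_Ici.2 (ha2.le.trans (h.trans h'))) h'
  have hmid : ∀ m, xlo ≤ m → m ≤ xhi → f m + ρ ≤ 0 := fun m h h' => by
    rcases le_total m a with hm | hm
    · have := h1.antitoneOn (mem_Iic.2 ha1.le) (mem_Iic.2 hm) h
      linarith
    · have := h2.monotoneOn (mem_Ici.2 hm) (mem_Ici.2 ha2.le) h'
      linarith
  refine ⟨fun m => if m < xlo then f m + ρ else 0, fun m => if xhi < m then f m + ρ else 0,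
    fun m => max (-(f m + ρ)) 0, ?_, fun m h => if_neg (not_lt.2 h), fun m h => if_neg (not_lt.2 h),
    fun m h => max_eq_right (by linarith [hl m xlo h le_rfl])⟩
  constructor
  · intro m m' h
    dsimp only
    split_ifs with c1 c2 c2
    · linarith [hl m m' h c1.le]
    · exact absurd (h.trans_lt c1) c2
    · linarith [hl m xlo c2.le le_rfl]
    · exact le_rfl
  · intro m
    split_ifs with c1
    · linarith [hl m xlo c1.le le_rfl]
    · exact le_rfl
  · exact fun m h => if_neg (not_lt.2 (hlt.le.trans h))
  · intro m m' h
    dsimp only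
    split_ifs with c1 c2 c2
    · linarith [hr m m' c1.le h]
    · exact absurd (c1.trans_le h) c2
    · linarith [hr xhi m' le_rfl c2.le]
    · exact le_rfl
  · intro m
    split_ifs with c1
    · linarith [hr xhi m le_rfl c1.le]
    · exact le_rfl
  · exact ((hfm.add_const ρ).neg).max measurable_const
  · exact fun m => le_max_right _ _
  · exact fun m h => max_eq_right (by linarith [hr xhi m le_rfl h])
  · refine ⟨max (-(f a + ρ)) 0, fun m => max_le_max_right 0 (neg_le_neg (add_le_add ?_ le_rfl))⟩
    rcases le_total m a with hm | hm
    · exact h1.antitoneOn (mem_Iic.2 hm) (mem_Iic.2 le_rfl) hm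
    · exact h2.monotoneOn (mem_Ici.2 le_rfl) (mem_Ici.2 hm) hm
  · intro m
    split_ifs with c1 c2 c2
    · linarith
    · rw [max_eq_right (by linarith [hl m xlo c1.le le_rfl])]; ring
    · rw [max_eq_right (by linarith [hr xhi m le_rfl c2.le])]; ring
    · rw [max_eq_left (by linarith [hmid m (not_lt.1 c1) (not_lt.1 c2)])]; ring

/-- At the first passage over y the path is at least y, hence above all its earlier values, so the
past no longer affects the supremum. -/
lemma runningSup_add_thresholdTime {w : RegularPath} {y : ℝ} {κ : ℝ≥0}
    (hκ : thresholdTime coord y w = κ) (t : ℝ≥0) :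
    runningSup coord (κ + t) w = runningSup coord t (shiftPath κ w) := by
  refine le_antisymm (runningSup_le fun s hs => ?_) (runningSup_shiftPath_le κ t w)
  have key : ∀ s, κ ≤ s → s ≤ κ + t → w.1 s ≤ runningSup coord t (shiftPath κ w) :=
    fun s h h' => by
      obtain ⟨u, rfl⟩ := exists_add_of_le h
      exact le_runningSup (shiftPath κ w) (le_of_add_le_add_left h')
  rcases le_or_gt κ s with h | h
  · exact key s h hs
  · refine le_trans ?_ (key κ le_rfl le_self_add)
    refine le_trans (coord_lt_of_lt_thresholdTime ?_).le (le_coord_thresholdTime hκ)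
    rw [hκ]
    exact WithTop.coe_lt_coe.2 h

/-- If `r` vanishes on `(-∞, y]`, only the time after the threshold time of `y` counts. -/
lemma supIntegral_top_shiftPath {r : ℝ → ℝ} {w : RegularPath} {y : ℝ} {κ : ℝ≥0}
    (hκ : thresholdTime coord y w = κ) (hr : ∀ m ≤ y, r m = 0) :
    supIntegral ⊤ r w = supIntegral ⊤ r (shiftPath κ w) := by
  have h1 := timeLIntegral_coe_add κ ⊤ fun t => ENNReal.ofReal (r (runningSup coord t w))
  have h2 : timeLIntegral κ (fun t => ENNReal.ofReal (r (runningSup coord t w))) = 0 := by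
    rw [← timeLIntegral_zero_fun κ]
    refine timeLIntegral_congr fun t ht => ?_
    rw [hr _ (runningSup_le_of_lt_thresholdTime (hκ ▸ ht)), ENNReal.ofReal_zero]
  rw [add_top, h2, zero_add] at h1
  rw [supIntegral, h1]
  exact timeLIntegral_congr fun t _ => by rw [runningSup_add_thresholdTime hκ]

variable {Ω : Type*} [mΩ : MeasurableSpace Ω] {𝓕 : Filtration ℝ≥0 mΩ} {P : ℝ → Measure Ω}
  {X : ℝ≥0 → Ω → ℝ}

/-- By the strong Markov property at τ_y the left side is a mean of the right side over z = X_{τ_y},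
and some value is at least the mean. -/
lemma IsLevyFamily.exists_lintegral_supIntegral_le (hX : IsLevyFamily 𝓕 P X)
    (hreg : ∀ ω, IsRegularPath fun t => X t ω) {r : ℝ → ℝ} (hrm : Measurable r) {y : ℝ}
    (hr : ∀ m ≤ y, r m = 0) {x : ℝ}
    (hR : ∫⁻ ω, supIntegral ⊤ r (pathMap X hreg ω) ∂P x ≠ ⊤) :
    ∃ z, y ≤ z ∧ ∫⁻ ω, supIntegral ⊤ r (pathMap X hreg ω) ∂P x ≤
      ∫⁻ ω, supIntegral ⊤ r (pathMap X hreg ω) ∂P z := by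
  have := hX.isProbabilityMeasure x
  have hrm' : Measurable fun w => supIntegral ⊤ r w :=
    measurable_supIntegral measurable_const hrm measurable_id
  have hT := hX.isStoppingTime_thresholdTime hreg y
  have hfin := (hX.thresholdTime_finite_mean x y).2
  have h1 : ∫⁻ ω, supIntegral ⊤ r (pathMap X hreg ω) ∂P x =
      ∫⁻ ω, (∫⁻ ω', supIntegral ⊤ r (pathMap X hreg ω')
        ∂P (stoppedValue X (thresholdTime X y) ω)) ∂P x := by
    rw [← hX.strongMarkov hreg hT hfin hrm']
    refine lintegral_congr_ae ?_
    filter_upwards [hfin] with ω hω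
    obtain ⟨s, hs⟩ := WithTop.ne_top_iff_exists.1 hω
    rw [pathAfter, ← hs]
    exact supIntegral_top_shiftPath (w := pathMap X hreg ω) hs.symm hr
  -- Choosing ω outside the null set where τ_y = ∞ ensures z ≥ y.
  obtain ⟨ω, hω, hle⟩ := exists_notMem_null_lintegral_le (h1 ▸ hR) hfin
  simp only [mem_compl_iff, not_not] at hω
  exact ⟨_, le_stoppedValue_thresholdTime hreg hω, h1.trans_le hle⟩

/-! ### Optimality for processes with regular paths -/

/-- If `f + ρ` has the decomposition `p + q - r`, the gain when started in `x` is bounded by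
`γ x` plus the mean time integral of `r` along the running supremum. -/
theorem IsLevyFamily.expectedGain_le (hX : IsLevyFamily 𝓕 P X)
    (hreg : ∀ ω, IsRegularPath fun t => X t ω) {γ h f : ℝ → ℝ}
    (hγh : PayoffCostAssumption P X γ h) (hrep : MaxRepresentation P X γ h f) {ρ c : ℝ}
    {p q r : ℝ → ℝ} (hd : GainDecomposition f ρ c p q r) {x : ℝ} {τ : Ω → WithTop ℝ≥0}
    (hτ : τ ∈ stoppingTimesFrom 𝓕 P X h x) :
    expectedGain P X γ h ρ x τ ≤
      ((γ x + (∫⁻ ω, supIntegral ⊤ r (pathMap X hreg ω) ∂P x).toReal : ℝ) : EReal) := by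
  obtain ⟨⟨hs, hτ⟩, hτx⟩ := hτ
  have hT := (hτ x).1
  have hH : ∫⁻ ω, stateIntegral (τ ω) h (pathMap X hreg ω) ∂P x < ⊤ := (hτ x).2
  obtain ⟨C, hC⟩ := hd.mid_le
  have hR := hX.lintegral_supIntegral_lt_top hreg hd.mid_zero hC x
  have hle := hX.lintegral_gain_le hreg hγh hrep hd hs
    (ae_ne_top_of_expectedTime_lt_top hs.measurable' hT) hτx
  have hfin : ∫⁻ ω, supIntegral ⊤ r (pathMap X hreg ω) ∂P x +
      ENNReal.ofReal ρ * expectedTime (P x) τ +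
        ∫⁻ ω, stateIntegral (τ ω) h (pathMap X hreg ω) ∂P x ≠ ⊤ :=
    ENNReal.add_ne_top.2 ⟨ENNReal.add_ne_top.2 ⟨hR.ne,
      ENNReal.mul_ne_top ENNReal.ofReal_ne_top hT.ne⟩, hH.ne⟩
  have hG := ne_top_of_le_ne_top hfin (le_self_add.trans hle)
  rw [hX.expectedGain_eq hreg hγh hs hτx hT.ne hH.ne hG, EReal.coe_le_coe_iff]
  have := ENNReal.toReal_mono hfin hle
  rw [ENNReal.toReal_add hG (ENNReal.mul_ne_top ENNReal.ofReal_ne_top hT.ne),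
    ENNReal.toReal_add (ENNReal.add_ne_top.1 hfin).1 hH.ne,
    ENNReal.toReal_add hR.ne (ENNReal.mul_ne_top ENNReal.ofReal_ne_top hT.ne),
    ENNReal.toReal_mul, ENNReal.toReal_mul, ENNReal.toReal_ofReal', ENNReal.toReal_ofReal'] at this
  -- Recombines ρ⁺ - ρ⁻ = ρ, the two parts having been kept on opposite sides.
  have e := congrArg (· * (expectedTime (P x) τ).toReal) (max_zero_sub_eq_self ρ)
  simp only [sub_mul] at e
  linarith

lemma IsLevyFamily.thresholdTime_mem_stoppingTimesFrom (hX : IsLevyFamily 𝓕 P X)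
    (hreg : ∀ ω, IsRegularPath fun t => X t ω) {γ h : ℝ → ℝ}
    (hγh : PayoffCostAssumption P X γ h) (c x : ℝ) :
    thresholdTime X c ∈ stoppingTimesFrom 𝓕 P X h x := by
  refine ⟨⟨hX.isStoppingTime_thresholdTime hreg c, fun z =>
    ⟨(hX.thresholdTime_finite_mean z c).1, ?_⟩⟩, ?_⟩
  · refine lt_of_le_of_lt (le_of_eq ?_) (hX.lintegral_stateIntegral_lt_top hreg hγh c z)
    exact lintegral_congr_ae ((hX.ae_thresholdTime_eq hreg c z).mono fun ω hω =>
      congrArg (fun U => stateIntegral U h (pathMap X hreg ω)) hω)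
  · filter_upwards [(hX.thresholdTime_finite_mean x c).2, hX.start x] with ω h1 h2
    rcases le_or_gt c x with hcx | hxc
    · have h0 : thresholdTime X c ω = (0 : ℝ≥0) :=
        le_antisymm (thresholdTime_le (w := pathMap X hreg ω) (hcx.trans h2.ge)) zero_le
      rw [stoppedValue, h0]
      exact h2.ge
    · exact hxc.le.trans (le_stoppedValue_thresholdTime hreg h1)

theorem IsLevyFamily.expectedGain_thresholdTime (hX : IsLevyFamily 𝓕 P X)
    (hreg : ∀ ω, IsRegularPath fun t => X t ω) {γ h f : ℝ → ℝ}
    (hγh : PayoffCostAssumption P X γ h) (hrep : MaxRepresentation P X γ h f) {ρ c : ℝ}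
    {p q r : ℝ → ℝ} (hd : GainDecomposition f ρ c p q r) {x : ℝ}
    (hp : ∀ m, x ≤ m → p m = 0) (hq : ∀ m ≤ c, q m = 0) :
    expectedGain P X γ h ρ x (thresholdTime X c) =
      ((γ x + (∫⁻ ω, supIntegral ⊤ r (pathMap X hreg ω) ∂P x).toReal : ℝ) : EReal) := by
  obtain ⟨⟨hs, hτ⟩, hτx⟩ := hX.thresholdTime_mem_stoppingTimesFrom hreg hγh c x
  have hT := (hτ x).1
  have hH : ∫⁻ ω, stateIntegral (thresholdTime X c ω) h (pathMap X hreg ω) ∂P x < ⊤ := (hτ x).2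
  obtain ⟨C, hC⟩ := hd.mid_le
  have hR := hX.lintegral_supIntegral_lt_top hreg hd.mid_zero hC x
  have heq := hX.lintegral_gain_thresholdTime hreg hγh hrep hd hp hq
  have hfin : ∫⁻ ω, supIntegral ⊤ r (pathMap X hreg ω) ∂P x +
      ENNReal.ofReal ρ * expectedTime (P x) (thresholdTime X c) +
        ∫⁻ ω, stateIntegral (thresholdTime X c ω) h (pathMap X hreg ω) ∂P x ≠ ⊤ :=
    ENNReal.add_ne_top.2 ⟨ENNReal.add_ne_top.2 ⟨hR.ne,
      ENNReal.mul_ne_top ENNReal.ofReal_ne_top hT.ne⟩, hH.ne⟩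
  have hG := ne_top_of_le_ne_top hfin (le_self_add.trans heq.le)
  rw [hX.expectedGain_eq hreg hγh hs hτx hT.ne hH.ne hG, EReal.coe_eq_coe_iff]
  have := congrArg ENNReal.toReal heq
  rw [ENNReal.toReal_add hG (ENNReal.mul_ne_top ENNReal.ofReal_ne_top hT.ne),
    ENNReal.toReal_add (ENNReal.add_ne_top.1 hfin).1 hH.ne,
    ENNReal.toReal_add hR.ne (ENNReal.mul_ne_top ENNReal.ofReal_ne_top hT.ne),
    ENNReal.toReal_mul, ENNReal.toReal_mul, ENNReal.toReal_ofReal', ENNReal.toReal_ofReal'] at this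
  have e := congrArg (· * (expectedTime (P x) (thresholdTime X c)).toReal) (max_zero_sub_eq_self ρ)
  simp only [sub_mul] at e
  linarith

theorem IsLevyFamily.optimal_of_regular (hX : IsLevyFamily 𝓕 P X)
    (hreg : ∀ ω, IsRegularPath fun t => X t ω) {γ h f : ℝ → ℝ}
    (hγh : PayoffCostAssumption P X γ h) (hrep : MaxRepresentation P X γ h f)
    (hf : IsUnimodal f) {ρ xlo xhi : ℝ} (hlt : xlo < xhi) (hlo : f xlo + ρ = 0)
    (hhi : f xhi + ρ = 0) :
    (∀ x, xlo ≤ x → thresholdTime X xhi ∈ stoppingTimesFrom 𝓕 P X h x ∧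
      stoppingValue 𝓕 P X γ h ρ x x = expectedGain P X γ h ρ x (thresholdTime X xhi)) ∧
    (∀ x, x < xlo → ∃ xs ∈ Icc xlo xhi,
      stoppingValue 𝓕 P X γ h ρ x x ≤ stoppingValue 𝓕 P X γ h ρ xs xs) := by
  obtain ⟨p, q, r, hd, hp, hq, hr⟩ := hf.exists_gainDecomposition hlt hlo hhi
  have hmem := hX.thresholdTime_mem_stoppingTimesFrom hreg hγh xhi
  have hup : ∀ x, stoppingValue 𝓕 P X γ h ρ x x ≤
      ((γ x + (∫⁻ ω, supIntegral ⊤ r (pathMap X hreg ω) ∂P x).toReal : ℝ) : EReal) := fun x =>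
    iSup₂_le fun τ hτ => hX.expectedGain_le hreg hγh hrep hd hτ
  have heq : ∀ x, xlo ≤ x → expectedGain P X γ h ρ x (thresholdTime X xhi) =
      ((γ x + (∫⁻ ω, supIntegral ⊤ r (pathMap X hreg ω) ∂P x).toReal : ℝ) : EReal) :=
    fun x hx => hX.expectedGain_thresholdTime hreg hγh hrep hd
      (fun m hm => hp m (hx.trans hm)) hq
  have hlow : ∀ x, expectedGain P X γ h ρ x (thresholdTime X xhi) ≤
      stoppingValue 𝓕 P X γ h ρ x x := fun x => le_iSup₂_of_le _ (hmem x) le_rfl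
  refine ⟨fun x hx => ⟨hmem x, le_antisymm ((hup x).trans (heq x hx).ge) (hlow x)⟩, fun x hx => ?_⟩
  obtain ⟨C, hC⟩ := hd.mid_le
  have hR := fun z => (hX.lintegral_supIntegral_lt_top hreg hd.mid_zero hC z).ne
  obtain ⟨z, hz, hle⟩ := hX.exists_lintegral_supIntegral_le hreg hd.measurable_mid hr (hR x)
  -- If the state z overshoots `xhi`, then r vanishes along the supremum from z on and any point of
  -- the interval will do.
  have hmain : ∃ xs ∈ Icc xlo xhi, ∫⁻ ω, supIntegral ⊤ r (pathMap X hreg ω) ∂P x ≤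
      ∫⁻ ω, supIntegral ⊤ r (pathMap X hreg ω) ∂P xs := by
    rcases le_or_gt z xhi with h1 | h1
    · exact ⟨z, ⟨hz, h1⟩, hle⟩
    · refine ⟨xlo, ⟨le_rfl, hlt.le⟩, hle.trans (le_of_eq_of_le ?_ zero_le)⟩
      rw [← lintegral_zero (μ := P z)]
      refine lintegral_congr_ae ?_
      filter_upwards [hX.start z] with ω hω
      rw [← timeLIntegral_zero_fun ⊤]
      refine timeLIntegral_congr fun t _ => ?_
      rw [hd.mid_zero _ (h1.le.trans (le_trans hω.ge
        (le_runningSup (pathMap X hreg ω) (zero_le (a := t))))), ENNReal.ofReal_zero]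
  obtain ⟨xs, hxs, hle'⟩ := hmain
  refine ⟨xs, hxs, (hup x).trans (le_trans ?_ ((heq xs hxs.1).ge.trans (hlow xs)))⟩
  rw [EReal.coe_le_coe_iff]
  exact add_le_add (hγh.monotone (hx.le.trans hxs.1)) (ENNReal.toReal_mono (hR xs) hle')

end

section

/-! ### Reduction to regular paths -/

/-- Right continuity and left limits bound the path near every time; compactness of [0, t] makes the
bound uniform. -/
lemma isRegularPath_of_cadlag {w : ℝ≥0 → ℝ} (hw : ∀ t : ℝ≥0, ContinuousWithinAt w (Ici t) t ∧
    ∃ l : ℝ, Tendsto w (𝓝[<] t) (𝓝 l)) : IsRegularPath w := by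
  refine ⟨fun t => (hw t).1, fun t => ?_⟩
  have hloc : ∀ s ∈ Iic t, ∃ u ∈ 𝓝 s, BddAbove (w '' u) := fun s _ => by
    obtain ⟨h1, l, h2⟩ := hw s
    have e1 : ∀ᶠ u in 𝓝[≥] s, w u ≤ w s + 1 := h1.tendsto.eventually_le_const (lt_add_one _)
    have e2 : ∀ᶠ u in 𝓝[<] s, w u ≤ l + 1 := h2.eventually_le_const (lt_add_one _)
    have e3 : ∀ᶠ u in 𝓝 s, w u ≤ max (w s + 1) (l + 1) := by
      rw [← nhdsLT_sup_nhdsGE, eventually_sup]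
      exact ⟨e2.mono fun u hu => hu.trans (le_max_right _ _),
        e1.mono fun u hu => hu.trans (le_max_left _ _)⟩
    exact ⟨_, e3, max (w s + 1) (l + 1), by rintro _ ⟨u, hu, rfl⟩; exact hu⟩
  have hc : IsCompact (Iic t) := by
    rw [← Icc_bot]
    exact isCompact_Icc
  refine hc.induction_on (p := fun s => BddAbove (w '' s)) (by simp)
    (fun s u hsu hu => hu.mono (image_mono hsu)) (fun s u hs hu => by
      rw [image_union]; exact hs.union hu) fun s hs => ?_
  obtain ⟨u, hu, hb⟩ := hloc s hs
  exact ⟨u, mem_nhdsWithin_of_mem_nhds hu, hb⟩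

open Classical in
/-- The process `X` with all irregular paths replaced by the constant path `0`. -/
def regularization {Ω : Type*} (X : ℝ≥0 → Ω → ℝ) (t : ℝ≥0) (ω : Ω) : ℝ :=
  if IsRegularPath fun s => X s ω then X t ω else 0

lemma isRegularPath_regularization {Ω : Type*} (X : ℝ≥0 → Ω → ℝ) (ω : Ω) :
    IsRegularPath fun t => regularization X t ω := by
  by_cases h : IsRegularPath fun s => X s ω
  · simpa only [regularization, if_pos h] using h
  · simp only [regularization, if_neg h]
    exact ⟨fun t => continuousWithinAt_const, fun t => ⟨0, by rintro _ ⟨u, _, rfl⟩; exact le_rfl⟩⟩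

variable {Ω : Type*} [mΩ : MeasurableSpace Ω] {𝓕 : Filtration ℝ≥0 mΩ} {P : ℝ → Measure Ω}
  {X X' : ℝ≥0 → Ω → ℝ}

lemma IsLevyFamily.ae_isRegularPath (hX : IsLevyFamily 𝓕 P X) (x : ℝ) :
    ∀ᵐ ω ∂P x, IsRegularPath fun t => X t ω :=
  (hX.cadlag x).mono fun _ hω => isRegularPath_of_cadlag hω

lemma IsLevyFamily.ae_regularization_eq (hX : IsLevyFamily 𝓕 P X) (x : ℝ) :
    ∀ᵐ ω ∂P x, (fun t => regularization X t ω) = fun t => X t ω :=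
  (hX.ae_isRegularPath x).mono fun _ hω => funext fun _ => if_pos hω

/-- Irregularity of a path depends on all times, but it is null under every `P x` and so lies in `𝓕
0` by completeness. -/
lemma IsLevyFamily.adapted_regularization (hX : IsLevyFamily 𝓕 P X) :
    Adapted 𝓕 (regularization X) := fun t => by
  classical
  have hN : MeasurableSet[𝓕 t] {ω | IsRegularPath fun s => X s ω} := by
    rw [← MeasurableSet.compl_iff]
    exact 𝓕.mono zero_le _ (hX.complete _ hX.ae_isRegularPath)
  exact Measurable.ite hN (hX.adapted t) measurable_const

/-- Processes with a.s. the same paths are Lévy processes simultaneously. -/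
lemma IsLevyFamily.congr (hX : IsLevyFamily 𝓕 P X) (hX' : Adapted 𝓕 X')
    (h : ∀ x, ∀ᵐ ω ∂P x, (fun t => X' t ω) = fun t => X t ω) : IsLevyFamily 𝓕 P X' where
  isProbabilityMeasure := hX.isProbabilityMeasure
  rightContinuous := hX.rightContinuous
  complete := hX.complete
  adapted := hX'
  start x := by
    filter_upwards [hX.start x, h x] with ω h1 h2
    exact (congrFun h2 0).trans h1
  cadlag x := by
    filter_upwards [hX.cadlag x, h x] with ω h1 h2
    rw [h2]
    exact h1
  indepIncrements x s t := by
    rw [Indep_iff]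
    rintro _ B ⟨A, hA, rfl⟩ hB
    have e : ((fun ω => X' (s + t) ω - X' s ω) ⁻¹' A : Set Ω) =ᵐ[P x]
        ((fun ω => X (s + t) ω - X s ω) ⁻¹' A : Set Ω) := by
      filter_upwards [h x] with ω hω
      exact congrArg (fun w : ℝ≥0 → ℝ => w (s + t) - w s ∈ A) hω
    rw [measure_congr e, measure_congr (e.inter (ae_eq_refl B))]
    exact Indep_iff _ _ _ |>.1 (hX.indepIncrements x s t) _ B ⟨A, hA, rfl⟩ hB
  stationaryIncrements x s t := by
    rw [Measure.map_congr (g := fun ω => X (s + t) ω - X s ω)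
      ((h x).mono fun ω hω => congrArg (fun w : ℝ≥0 → ℝ => w (s + t) - w s) hω),
      hX.stationaryIncrements x s t]
    exact Measure.map_congr ((h 0).mono fun ω hω =>
      congrArg (fun w : ℝ≥0 → ℝ => w t - w 0) hω.symm)
  integrable_one := hX.integrable_one.congr ((h 0).mono fun ω hω => congrFun hω.symm 1)
  mean_pos := by
    rw [integral_congr_ae ((h 0).mono fun ω hω => congrFun hω 1)]
    exact hX.mean_pos

/-- The threshold time is a functional of the path alone, namely the one of the coordinate process
on all functions. The congruence lemmas below use the same device. -/
lemma ae_thresholdTime_congr {μ : Measure Ω} (h : ∀ᵐ ω ∂μ, (fun t => X' t ω) = fun t => X t ω)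
    (y : ℝ) : ∀ᵐ ω ∂μ, thresholdTime X' y ω = thresholdTime X y ω :=
  h.mono fun _ hω => congrArg (thresholdTime (fun t (w : ℝ≥0 → ℝ) => w t) y) hω

lemma expectedCost_congr {μ : Measure Ω} (h : ∀ᵐ ω ∂μ, (fun t => X' t ω) = fun t => X t ω)
    {τ τ' : Ω → WithTop ℝ≥0} (hτ : ∀ᵐ ω ∂μ, τ' ω = τ ω) (φ : ℝ → ℝ) :
    expectedCost μ φ X' τ' = expectedCost μ φ X τ := by
  refine lintegral_congr_ae ?_
  filter_upwards [h, hτ] with ω h1 h2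
  exact congrArg₂ (fun (w : ℝ≥0 → ℝ) U =>
    timeLIntegral U fun t => ENNReal.ofReal (φ (w t))) h1 h2

lemma ae_stoppedValue_congr {μ : Measure Ω} (h : ∀ᵐ ω ∂μ, (fun t => X' t ω) = fun t => X t ω)
    {τ τ' : Ω → WithTop ℝ≥0} (hτ : ∀ᵐ ω ∂μ, τ' ω = τ ω) :
    ∀ᵐ ω ∂μ, stoppedValue X' τ' ω = stoppedValue X τ ω := by
  filter_upwards [h, hτ] with ω h1 h2
  exact congrArg₂ (fun (w : ℝ≥0 → ℝ) (U : WithTop ℝ≥0) => w U.untopA) h1 h2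

lemma extExp_payoff_congr {μ : Measure Ω} (h : ∀ᵐ ω ∂μ, (fun t => X' t ω) = fun t => X t ω)
    {τ τ' : Ω → WithTop ℝ≥0} (hτ : ∀ᵐ ω ∂μ, τ' ω = τ ω) (γ φ : ℝ → ℝ) :
    extExp μ (fun ω => γ (stoppedValue X' τ' ω) - timeIntegral φ X' τ' ω) =
      extExp μ (fun ω => γ (stoppedValue X τ ω) - timeIntegral φ X τ ω) := by
  refine extExp_congr ?_
  filter_upwards [h, hτ] with ω h1 h2
  exact congrArg₂ (fun (w : ℝ≥0 → ℝ) (U : WithTop ℝ≥0) =>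
    γ (w U.untopA) - ∫ s in timeSet U, φ (w s.toNNReal)) h1 h2

lemma PayoffCostAssumption.congr {γ h : ℝ → ℝ} (hγh : PayoffCostAssumption P X γ h)
    (hX : ∀ x, ∀ᵐ ω ∂P x, (fun t => X' t ω) = fun t => X t ω) :
    PayoffCostAssumption P X' γ h where
  monotone := hγh.monotone
  differentiable := hγh.differentiable
  nonneg := hγh.nonneg
  continuous := hγh.continuous
  cost_lt_top x y hxy := by
    rw [expectedCost_congr (hX x) (ae_thresholdTime_congr (hX x) y)]
    exact hγh.cost_lt_top x y hxy

lemma MaxRepresentation.congr {γ h f : ℝ → ℝ} (hrep : MaxRepresentation P X γ h f)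
    (hX : ∀ x, ∀ᵐ ω ∂P x, (fun t => X' t ω) = fun t => X t ω) :
    MaxRepresentation P X' γ h f := by
  intro x y hxy
  have hT := ae_thresholdTime_congr (hX x) y
  rw [hrep x y hxy, extExp_payoff_congr (hX x) hT]
  congr 1
  refine extExp_congr ?_
  filter_upwards [hX x, hT] with ω h1 h2
  exact congrArg₂ (fun (w : ℝ≥0 → ℝ) (U : WithTop ℝ≥0) => ∫ s in timeSet U,
    f (sSup (w '' Iic s.toNNReal))) h1.symm h2.symm

lemma stoppingTimesFrom_congr (hX : ∀ x, ∀ᵐ ω ∂P x, (fun t => X' t ω) = fun t => X t ω)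
    (h : ℝ → ℝ) (y : ℝ) : stoppingTimesFrom 𝓕 P X' h y = stoppingTimesFrom 𝓕 P X h y := by
  ext τ
  have hτ : ∀ x, ∀ᵐ ω ∂P x, τ ω = τ ω := fun x => Eventually.of_forall fun _ => rfl
  refine and_congr (and_congr_right fun _ => forall_congr' fun x => ?_) ?_
  · rw [expectedCost_congr (hX x) (hτ x)]
  · exact eventually_congr ((ae_stoppedValue_congr (hX y) (hτ y)).mono fun ω hω => by rw [hω])

lemma stoppingValue_congr (hX : ∀ x, ∀ᵐ ω ∂P x, (fun t => X' t ω) = fun t => X t ω)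
    (γ h : ℝ → ℝ) (ρ y x : ℝ) :
    stoppingValue 𝓕 P X' γ h ρ y x = stoppingValue 𝓕 P X γ h ρ y x := by
  rw [stoppingValue, stoppingValue, stoppingTimesFrom_congr hX]
  refine iSup_congr fun τ => iSup_congr fun _ => ?_
  exact extExp_payoff_congr (hX x) (Eventually.of_forall fun _ => rfl) _ _

lemma IsLevyFamily.mem_stoppingTimesFrom_of_ae_eq (hX : IsLevyFamily 𝓕 P X) {h : ℝ → ℝ} {y : ℝ}
    {τ τ' : Ω → WithTop ℝ≥0} (hτ : τ ∈ stoppingTimesFrom 𝓕 P X h y)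
    (he : ∀ x, ∀ᵐ ω ∂P x, τ' ω = τ ω) : τ' ∈ stoppingTimesFrom 𝓕 P X h y := by
  have hr : ∀ x, ∀ᵐ ω ∂P x, (fun t => X t ω) = fun t => X t ω :=
    fun x => Eventually.of_forall fun _ => rfl
  refine ⟨⟨hX.isStoppingTime_of_ae_eq hτ.1.1 he, fun x => ⟨?_, ?_⟩⟩, ?_⟩
  · refine lt_of_eq_of_lt (lintegral_congr_ae ?_) (hτ.1.2 x).1
    exact (he x).mono fun ω hω => congrArg timeToENNReal hω
  · rw [expectedCost_congr (hr x) (he x)]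
    exact (hτ.1.2 x).2
  · filter_upwards [hτ.2, ae_stoppedValue_congr (hr y) (he y)] with ω h1 h2
    rw [h2]
    exact h1

/-- All hypotheses and conclusions depend on the paths only up to sets that are null under every `P
x`, so they transfer to the regularized process and back. -/
theorem IsLevyFamily.optimal_thresholdTime (hX : IsLevyFamily 𝓕 P X) {γ h f : ℝ → ℝ}
    (hγh : PayoffCostAssumption P X γ h) (hrep : MaxRepresentation P X γ h f)
    (hf : IsUnimodal f) {ρ xlo xhi : ℝ} (hlt : xlo < xhi) (hlo : f xlo + ρ = 0)
    (hhi : f xhi + ρ = 0) :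
    (∀ x, xlo ≤ x → thresholdTime X xhi ∈ stoppingTimesFrom 𝓕 P X h x ∧
      stoppingValue 𝓕 P X γ h ρ x x = expectedGain P X γ h ρ x (thresholdTime X xhi)) ∧
    (∀ x, x < xlo → ∃ xs ∈ Icc xlo xhi,
      stoppingValue 𝓕 P X γ h ρ x x ≤ stoppingValue 𝓕 P X γ h ρ xs xs) := by
  have he := hX.ae_regularization_eq
  obtain ⟨h1, h2⟩ := (hX.congr hX.adapted_regularization he).optimal_of_regular
    (isRegularPath_regularization X) (hγh.congr he) (hrep.congr he) hf hlt hlo hhi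
  simp only [stoppingValue_congr he, stoppingTimesFrom_congr he] at h1 h2
  have hT := fun x => ae_thresholdTime_congr (he x) xhi
  refine ⟨fun x hx => ⟨hX.mem_stoppingTimesFrom_of_ae_eq (h1 x hx).1 fun x =>
    (hT x).mono fun _ => Eq.symm, (h1 x hx).2.trans ?_⟩, h2⟩
  exact extExp_payoff_congr (he x) (hT x) _ _

end

end LevyStopping

end

theorem theorem5p5 {Ω : Type*} [mΩ : MeasurableSpace Ω]
    (𝓕 : Filtration ℝ≥0 mΩ) (P : ℝ → Measure Ω) (X : ℝ≥0 → Ω → ℝ)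
    (hX : LevyStopping.IsLevyFamily 𝓕 P X)
    (γ h : ℝ → ℝ) (hγh : LevyStopping.PayoffCostAssumption P X γ h)
    (f : ℝ → ℝ) (hrep : LevyStopping.MaxRepresentation P X γ h f)
    (hf : LevyStopping.IsUnimodal f)
    (ρ xlo xhi : ℝ) (hlt : xlo < xhi)
    (hroots : ∀ x, f x + ρ = 0 ↔ x = xlo ∨ x = xhi)
    (hneg : ∀ x ∈ Ioo xlo xhi, f x + ρ < 0) :
    (∀ x, xlo ≤ x →
      LevyStopping.thresholdTime X xhi ∈ LevyStopping.stoppingTimesFrom 𝓕 P X h x ∧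
      LevyStopping.stoppingValue 𝓕 P X γ h ρ x x =
        LevyStopping.expectedGain P X γ h ρ x (LevyStopping.thresholdTime X xhi)) ∧
    (∀ x, x < xlo → ∃ xs ∈ Icc xlo xhi,
      LevyStopping.stoppingValue 𝓕 P X γ h ρ x x ≤
        LevyStopping.stoppingValue 𝓕 P X γ h ρ xs xs) := by
  exact hX.optimal_thresholdTime hγh hrep hf hlt ((hroots xlo).2 (Or.inl rfl))
    ((hroots xhi).2 (Or.inr rfl))
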